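/- Let $B=(V_1;V_2,E)$ be a finite bipartite graph with at least one edge, $n_1=|V_1|$, $n_2=|V_2|$, $m=|E|$, and let $\kappa$ be the cardinality of a maximum matching of $B$. Form the network with a source $s$, a sink $t$, arcs $(s,u)$ ($u\in V_1$) and $(v,t)$ ($v\in V_2$) of capacity $1$, and an arc $(u,v)$ of arbitrary capacity $\ge 1$ (possibly infinite) for each edge $uv\in E$. Put $V=V_1\cup V_2$ and let $n=n_1+n_2+2$ be the number of nodes of the network. Run the labeling pseudoflow algorithm on it, given by adjacency lists in arbitrary order. All source- and sink-adjacent arcs stay saturated, and the excess of a node is its inflow minus its outflow. The algorithm keeps a pseudoflow $f$, a tree $T$ on $V\cup\{r\}$ with root $r$ (a branch is the subtree below a child of $r$, which is its root), and labels. Initially, all other arcs have flow $0$, every node is a child of $r$, and all labels are $1$. - *Selection.* While some root has positive excess and label $<n$, select such a root of lowest label (lowest-label variant) or of highest label (highest-label variant); ties are broken arbitrarily. If its label is $\ell\ge 2$ and no node has label $\ell-1$, all labels in its branch are set to $n$ (gap relabeling). Otherwise the nodes of label $\ell$ in its branch are searched from the root downwards (moving from a node to a child of label $\ell$) for a merger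 arc: a residual arc from a node of label $\ell$ in the branch to a node of label $\ell-1$. - *Scanning and relabeling.* Each node has a pointer into its adjacency list; scanning resumes behind the last scanned arc, and the pointer is reset when the node is relabeled. Since labels never fall below $1$, arcs are not scanned at nodes of label $1$. A node whose list is exhausted (or whose label is $1$) and all of whose children have label $\ge\ell+1$ is relabeled to $\ell+1$, and the search moves to its parent; when the root is relabeled, a new selection is made. - *Merger.* When a merger arc $(x,y)$ is found, the tree path from the root of the branch of $x$ to $x$ is reversed, $x$ becomes a child of $y$, and the excess of the old root is pushed along the tree path to the root of the branch of $y$, edge by edge, as far as the residual capacities allow; a node that retains positive excess is cut from its parent and becomes a child of $r$. Then a new selection is made. The work is the number of operations, where an arc scan, a selection, a move to a child and the relabeling of a node (also each node of a branch in gap relabeling) cost $1$ each, and a merger costs the number of nodes of its path from the root of the branch of $x$ to the root of the branch of $y$. There is an absolute constant $C$ such that for every such graph, capacities, adjacency lists and every execution: 1. In the lowest-label variant, the number of arc scans is at most $C\min\{\kappa m,\,n_1^2\kappa\}$. 2. In both variants, at all times $T$ is a normalized tree for $f$ (every node that violates flow balance is a child of $r$, out-of-tree arcs carry flow at their lower or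 upper bound, and in every branch all downward residual capacities are positive), and every node has depth at most $C\kappa$ in it. 3. The total work is at most $C\left(\min\{\kappa m,\,n_1^2\kappa\}+n_1\kappa^2\right)$ in the lowest-label variant and at most $C\,\kappa n_1 m$ in the highest-label variant. -/

import Mathlib

open scoped NNReal ENNReal

universe u v

namespace Pseudoflow

noncomputable section

/-! ### Flow networks, pseudoflows and normalized trees -/

/-- An `s,t`-network with inner nodes `V`. `cap i j` is the capacity of the arc `(i, j)` between inner
nodes, `capS i` that of `(s, i)` and `capT i` that of `(i, t)`; capacity `0` means that there is no
such arc. Lower bounds are zero. -/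
structure FlowNetwork (V : Type*) where
  cap : V → V → ℝ≥0∞
  capS : V → ℝ≥0
  capT : V → ℝ≥0

variable {V : Type*}

/-- `(i, j)` is an arc between inner nodes. -/
def FlowNetwork.Arc (N : FlowNetwork V) (i j : V) : Prop := 0 < N.cap i j

/-- Adjacency lists: `adj x` lists, in an arbitrary order and without repetition, the nodes that are
joined to `x` by an arc in either direction. -/
def FlowNetwork.IsAdjacencyLists (N : FlowNetwork V) (adj : V → List V) : Prop :=
  ∀ x, (adj x).Nodup ∧ ∀ y, y ∈ adj x ↔ N.Arc x y ∨ N.Arc y x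

/-- The number of nodes of the whole network: the inner nodes, the source and the sink. -/
def FlowNetwork.numNodes [Fintype V] (_N : FlowNetwork V) : ℕ := Fintype.card V + 2

/-- The capacity constraints. All source- and sink-adjacent arcs are saturated throughout, so that
only the values on the arcs between inner nodes are recorded. -/
def FlowNetwork.IsPseudoflow (N : FlowNetwork V) (f : V → V → ℝ≥0) : Prop :=
  ∀ i j, (f i j : ℝ≥0∞) ≤ N.cap i j

/-- Inflow minus outflow of an inner node, when the source- and sink-adjacent arcs are saturated. -/
def FlowNetwork.excess [Fintype V] (N : FlowNetwork V) (f : V → V → ℝ≥0) (x : V) : ℝ :=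
  ((N.capS x : ℝ) + ∑ y, (f y x : ℝ)) - ((N.capT x : ℝ) + ∑ y, (f x y : ℝ))

/-- The residual capacity from `i` to `j`. -/
def FlowNetwork.residual (N : FlowNetwork V) (f : V → V → ℝ≥0) (i j : V) : ℝ≥0∞ :=
  (N.cap i j - (f i j : ℝ≥0∞)) + (f j i : ℝ≥0∞)

/-- A tree rooted at the extra node `r` is given by parent pointers on the inner nodes: `none` means
that the parent is `r`, so that the node is the root of its branch. `RootPath par x l` says that `l`
lists the nodes from `x` up to the root of the branch of `x`, both included. Hence `l.length` is the
depth of `x`, that is, the number of tree edges between `x` and `r`. -/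
inductive RootPath (par : V → Option V) : V → List V → Prop
  | root {x : V} (h : par x = none) : RootPath par x [x]
  | step {x y : V} {l : List V} (h : par x = some y) (hl : RootPath par y l) :
      RootPath par x (x :: l)

/-- `y` belongs to the branch rooted at the child `x` of `r`. -/
def InBranch (par : V → Option V) (x y : V) : Prop :=
  par x = none ∧ ∃ l, RootPath par y l ∧ x ∈ l

/-- The pseudoflow `f` and the parent pointers `par` form a normalized tree. -/
structure FlowNetwork.IsNormalizedTree [Fintype V] (N : FlowNetwork V) (f : V → V → ℝ≥0)
    (par : V → Option V) : Prop where
  /-- every node is joined to `r` by parent pointers -/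
  tree : ∀ x, ∃ l, RootPath par x l
  /-- the tree edges that avoid `r` come from arcs of the network -/
  edges : ∀ x y, par x = some y → N.Arc x y ∨ N.Arc y x
  /-- only children of `r` may violate flow balance -/
  root_of_unbalanced : ∀ x, N.excess f x ≠ 0 → par x = none
  /-- out-of-tree arcs are at their lower or upper bound -/
  out_of_tree : ∀ i j, N.Arc i j → par i ≠ some j → par j ≠ some i →
    f i j = 0 ∨ (f i j : ℝ≥0∞) = N.cap i j
  /-- downward residual capacities are positive -/
  downward : ∀ x y, par x = some y → 0 < N.residual f y x

/-! ### Mergers -/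

section merger

variable [DecidableEq V]

/-- Make each node of the list the child of the next one. -/
def linkPath : List V → (V → Option V) → (V → Option V)
  | x :: y :: l, par => linkPath (y :: l) (Function.update par x (some y))
  | _, par => par

/-- Send `δ` units from `x` to `y`: flow on `(y, x)` is cancelled first, and the rest is put
on `(x, y)`. -/
def pushFlow (f : V → V → ℝ≥0) (x y : V) (δ : ℝ≥0) : V → V → ℝ≥0 := fun i j =>
  if i = x ∧ j = y then f x y + (δ - f y x)
  else if i = y ∧ j = x then f y x - δ
  else f i j

variable [Fintype V]

/-- The amount pushed from `x` to its parent `y`: the (positive part of the) excess of `x` or the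
residual capacity, whichever is smaller. -/
def FlowNetwork.pushAmount (N : FlowNetwork V) (f : V → V → ℝ≥0) (x y : V) : ℝ≥0 :=
  (min (ENNReal.ofReal (N.excess f x)) (N.residual f x y)).toNNReal

/-- Renormalization: push the excess along the given upward tree path, one edge after the other; a
node that retains positive excess is cut off from its parent and becomes the root of a branch
(a split). -/
def FlowNetwork.pushAlong (N : FlowNetwork V) :
    List V → (V → V → ℝ≥0) × (V → Option V) → (V → V → ℝ≥0) × (V → Option V)
  | x :: y :: l, (f, par) =>
      let f' := pushFlow f x y (N.pushAmount f x y)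
      let par' := if 0 < N.excess f' x then Function.update par x none else par
      FlowNetwork.pushAlong N (y :: l) (f', par')
  | _, s => s

/-- The merger along a path that leads from the root of the from-branch down to the tail of the
merger arc, over the merger arc, and from its head up to the root of the to-branch: the path is made
an upward path of the tree, and the excess of the root of the from-branch is pushed along it. -/
def FlowNetwork.merge (N : FlowNetwork V) (path : List V) (f : V → V → ℝ≥0)
    (par : V → Option V) : (V → V → ℝ≥0) × (V → Option V) :=
  N.pushAlong path (f, linkPath path par)

end merger

/-! ### The labeling pseudoflow algorithm -/

/-- The rule for selecting the branch to be processed. -/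
inductive Variant
  | lowest
  | highest

/-- A state of the algorithm. `ptr x` is the number of arcs in the adjacency list of `x` that have
been scanned since `x` received its current label. `cur` is the node at which the search for a merger
in the selected branch stands (`none` if no branch is selected). `scans` counts the arc scans, and
`work` counts all elementary operations. -/
structure State (V : Type*) where
  flow : V → V → ℝ≥0
  parent : V → Option V
  label : V → ℕ
  ptr : V → ℕ
  cur : Option V
  scans : ℕ
  work : ℕ

/-- The simple initialization: zero flow except on the source- and sink-adjacent arcs, every node is a
branch of its own, and all labels are `1`. -/
def State.init (V : Type*) : State V where
  flow := fun _ _ => 0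
  parent := fun _ => none
  label := fun _ => 1
  ptr := fun _ => 0
  cur := none
  scans := 0
  work := 0

section algorithm

variable [Fintype V]

/-- `x` is a root with positive excess that is still to be processed. The algorithm stops when there is
no such root, that is, all roots with positive excess have label `n`. -/
def State.Active (N : FlowNetwork V) (s : State V) (x : V) : Prop :=
  s.parent x = none ∧ 0 < N.excess s.flow x ∧ s.label x < N.numNodes

/-- `x` may be selected: it is an active root, of lowest (highest) label among the active roots. -/
def State.Selectable (N : FlowNetwork V) (var : Variant) (s : State V) (x : V) : Prop :=
  s.Active N x ∧ ∀ y, s.Active N y →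
    match var with
    | Variant.lowest => s.label x ≤ s.label y
    | Variant.highest => s.label y ≤ s.label x

/-- From `x` there is a merger arc to `y`. -/
def State.IsMergerArc (N : FlowNetwork V) (s : State V) (x y : V) : Prop :=
  0 < N.residual s.flow x y ∧ s.label y + 1 = s.label x

open Classical in
/-- The nodes of the branch with root `x`. -/
def State.branch (s : State V) (x : V) : Finset V :=
  Finset.univ.filter fun y => InBranch s.parent x y

variable [DecidableEq V]

open Classical in
/-- One step of the algorithm. Every step costs at least one unit of work; a merger costs, besides the
scan that finds it, one unit for each node of its path, and gap relabeling costs one unit for each node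
of the branch. Labels never fall below `1`, so that a node of label `1` has no merger arc: its arcs are
not scanned, and label `1` is no gap. -/
inductive Step (N : FlowNetwork V) (adj : V → List V) (var : Variant) : State V → State V → Prop
  /-- select a branch and start the search for a merger at its root -/
  | select {s : State V} {x : V} (hcur : s.cur = none) (hx : s.Selectable N var x)
      (hgap : s.label x = 1 ∨ ∃ y, s.label y + 1 = s.label x) :
      Step N adj var s { s with cur := some x, work := s.work + 1 }
  /-- gap relabeling: if no node carries the label below that of the selected root, all labels in its
  branch are set to `n` -/
  | gap {s : State V} {x : V} (hcur : s.cur = none) (hx : s.Selectable N var x)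
      (hne : s.label x ≠ 1) (hgap : ∀ y, s.label y + 1 ≠ s.label x) :
      Step N adj var s
        { s with
          label := fun y => if y ∈ s.branch x then N.numNodes else s.label y
          work := s.work + (s.branch x).card }
  /-- scan the next arc at the current node; it is not a merger arc -/
  | scanMiss {s : State V} {x y : V} (hcur : s.cur = some x) (hl : 1 < s.label x)
      (hy : (adj x)[s.ptr x]? = some y) (hm : ¬ s.IsMergerArc N x y) :
      Step N adj var s
        { s with
          ptr := Function.update s.ptr x (s.ptr x + 1)
          scans := s.scans + 1
          work := s.work + 1 }
  /-- scan the next arc at the current node; it is a merger arc, and the merger is performed -/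
  | scanMerge {s : State V} {x y : V} {p q : List V} (hcur : s.cur = some x) (hl : 1 < s.label x)
      (hy : (adj x)[s.ptr x]? = some y) (hm : s.IsMergerArc N x y)
      (hp : RootPath s.parent x p) (hq : RootPath s.parent y q) :
      Step N adj var s
        { s with
          flow := (N.merge (p.reverse ++ q) s.flow s.parent).1
          parent := (N.merge (p.reverse ++ q) s.flow s.parent).2
          ptr := Function.update s.ptr x (s.ptr x + 1)
          cur := none
          scans := s.scans + 1
          work := s.work + 1 + (p.reverse ++ q).length }
  /-- move the search down to a child of the same label -/
  | descend {s : State V} {x y : V} (hcur : s.cur = some x) (hy : s.parent y = some x)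
      (hl : s.label y = s.label x) :
      Step N adj var s { s with cur := some y, work := s.work + 1 }
  /-- relabel the current node: no merger arc is left at it, and all its children have larger labels.
  The search moves up to its parent; if it is the root, a branch has to be selected again -/
  | relabel {s : State V} {x : V} (hcur : s.cur = some x)
      (hptr : s.label x = 1 ∨ (adj x).length ≤ s.ptr x)
      (hch : ∀ y, s.parent y = some x → s.label x + 1 ≤ s.label y) :
      Step N adj var s
        { s with
          label := Function.update s.label x (s.label x + 1)
          ptr := Function.update s.ptr x 0
          cur := s.parent x
          work := s.work + 1 }

/-- The state `s` occurs in some execution of the algorithm; ties are broken arbitrarily. -/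
def Reachable (N : FlowNetwork V) (adj : V → List V) (var : Variant) (s : State V) : Prop :=
  Relation.ReflTransGen (Step N adj var) (State.init V) s

end algorithm

/-! ### Bipartite matching -/

section bipartite

variable {α : Type*} {β : Type*}

/-- No two edges share an endpoint. -/
def IsMatching (M : Finset (α × β)) : Prop :=
  ∀ e ∈ M, ∀ e' ∈ M, e.1 = e'.1 ∨ e.2 = e'.2 → e = e'

open Classical in
/-- The cardinality of a maximum matching of the bipartite graph with edge set `E`. -/
def matchingNumber (E : Finset (α × β)) : ℕ :=
  (E.powerset.filter fun M => IsMatching M).sup Finset.card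

open Classical in
/-- The network for bipartite matching: arcs `(s, a)` and `(b, t)` of capacity `1`, and an arc `(a, b)` of
capacity `c a b` for each edge `(a, b)`. -/
def bipartiteNetwork (E : Finset (α × β)) (c : α → β → ℝ≥0∞) : FlowNetwork (α ⊕ β) where
  cap
    | Sum.inl a, Sum.inr b => if (a, b) ∈ E then c a b else 0
    | _, _ => 0
  capS
    | Sum.inl _ => 1
    | Sum.inr _ => 0
  capT
    | Sum.inl _ => 0
    | Sum.inr _ => 1

end bipartite

end

end Pseudoflow

open Pseudoflow

namespace Pseudoflow

/-! ### Rooted trees given by parent pointers -/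

section tree

variable {V : Type*} {par par' : V → Option V}

/-! The flow always takes values 0 and 1 on the edges of the graph (`IntFlow`), and all of it sits
on tree edges. Left nodes never have negative excess, so each sends out at most one unit. Choosing
one incoming flow edge at every right node that receives flow (`Touched`) therefore gives a
matching, and at most κ right nodes are touched (`IntFlow.card_touched_le`). On a path to `r` the
two sides alternate, and every right node except possibly the branch root is balanced and hence
touched. This bounds the depth by 2κ+3 (`Normalized.depth_le`). Being touched means having
nonnegative excess; it is never lost, and only touched right nodes get labels above 1 (`Inv`).

A merger moves exactly one unit of excess from the root of the from-branch to a node `v` of the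
to-path: the root if nothing blocks the way, otherwise the first node whose upward residual capacity
is zero (`pushAlong_spec`, `Normalized.merge`).

Lowest-label variant (`LowInv`). The to-path of a merger has labels below every active root, so no
excess ever exceeds 1, and at most 2κ left nodes carry flow. Labels below the lowest active label
sit only on touched right nodes and on left nodes carrying flow, at most 3κ nodes in all; as long as
no label is skipped, this bounds all labels by 3κ+3 (`GapFree`). Once a label `g` is vacated, it is
never used again and every active root stays above it. From then on nodes of branches without
positive excess keep labels at most 3κ+3, and a root can be processed only next to such a node, so
labels stay at most 3κ+5 or equal n (`Gapped`). This uses that residual arcs descend at most one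
label, which is proved by following the scan pointers. A pointer at a left node only passes touched
nodes, so each relabeling of it pays for at most κ scans; a touched right node has at most n₁
neighbors (`ptr_le_scanBound`). Multiplying by the number O(κ) of labels bounds the scans.

Highest-label variant (`HighInv`). Labels below a processed root are occupied up to gap relabeling,
and at most one left node without edges has a label strictly between 1 and n. Hence labels other
than n are at most n'+κ+4, where n' counts the left nodes with an edge.

The work is bounded by a potential argument (`Inv.work_step`) combining the depth of the search, the
relabelings, the nodes retired by gap relabeling, and the mergers. A merger costs O(κ). In the
highest-label variant it is charged to the scan that finds it; in the lowest-label variant it lowers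
the sum of the labels of the active roots, which only root relabelings raise. -/

theorem RootPath.exists_cons {x : V} {l : List V} (h : RootPath par x l) : ∃ l', l = x :: l' := by
  cases h <;> exact ⟨_, rfl⟩

theorem RootPath.mem_self {x : V} {l : List V} (h : RootPath par x l) : x ∈ l := by
  obtain ⟨l', rfl⟩ := h.exists_cons
  simp

theorem RootPath.ne_nil {x : V} {l : List V} (h : RootPath par x l) : l ≠ [] :=
  List.ne_nil_of_mem h.mem_self

theorem RootPath.unique {x : V} {l l' : List V} (h : RootPath par x l) (h' : RootPath par x l') :
    l = l' := by
  induction h generalizing l' with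
  | root h => cases h' with
    | root => rfl
    | step h1 _ => simp [h] at h1
  | step h hl ih => cases h' with
    | root h1 => simp [h] at h1
    | step h1 hl' =>
      rw [h] at h1
      cases h1
      rw [ih hl']

theorem RootPath.suffix {x y : V} {l : List V} (h : RootPath par x l) (hy : y ∈ l) :
    ∃ l₁ l₂, l = l₁ ++ y :: l₂ ∧ RootPath par y (y :: l₂) := by
  induction h with
  | root h =>
    obtain rfl := List.mem_singleton.1 hy
    exact ⟨[], [], rfl, .root h⟩
  | @step a b l h hl ih =>
    rcases List.mem_cons.1 hy with rfl | hy
    · exact ⟨[], l, rfl, .step h hl⟩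
    · obtain ⟨l₁, l₂, rfl, h2⟩ := ih hy
      exact ⟨a :: l₁, l₂, rfl, h2⟩

theorem RootPath.nodup {x : V} {l : List V} (h : RootPath par x l) : l.Nodup := by
  induction h with
  | root h => simp
  | @step a b l h hl ih =>
    refine List.nodup_cons.2 ⟨fun ha => ?_, ih⟩
    obtain ⟨l₁, l₂, rfl, h2⟩ := hl.suffix ha
    have h3 := h2.unique (.step h hl)
    have := congrArg List.length h3
    simp at this
    omega

theorem RootPath.tail {x y : V} {l : List V} (h : RootPath par x (x :: y :: l)) :
    par x = some y ∧ RootPath par y (y :: l) := by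
  cases h with
  | step h hl =>
    obtain ⟨l', hl'⟩ := hl.exists_cons
    obtain ⟨rfl, rfl⟩ := List.cons.inj hl'
    exact ⟨h, hl⟩

theorem RootPath.step' {x y : V} {l : List V} (h : RootPath par x l) (hy : par x = some y) :
    ∃ l', l = x :: l' ∧ RootPath par y l' := by
  cases h with
  | root h => simp [h] at hy
  | step h hl =>
    rw [h] at hy
    cases hy
    exact ⟨_, rfl, hl⟩

theorem RootPath.exists_root {x : V} {l : List V} (h : RootPath par x l) :
    ∃ l' r, l = l' ++ [r] ∧ par r = none := by
  induction h with
  | @root x h => exact ⟨[], x, rfl, h⟩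
  | @step a b l h hl ih =>
    obtain ⟨l', r, rfl, hr⟩ := ih
    exact ⟨a :: l', r, rfl, hr⟩

theorem RootPath.parent_ne_none {x w : V} {l : List V} (h : RootPath par x l)
    (hw : w ∈ l.dropLast) : par w ≠ none := by
  induction h with
  | root => simp at hw
  | @step a b l h hl ih =>
    obtain ⟨l', rfl⟩ := hl.exists_cons
    rcases List.mem_cons.1 (by simpa using hw) with rfl | hw
    · simp [h]
    · exact ih hw

theorem RootPath.congr {x : V} {l : List V} (h : RootPath par x l)
    (he : ∀ w ∈ l, par' w = par w) : RootPath par' x l := by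
  induction h with
  | @root x h => exact .root ((he x (by simp)).trans h)
  | @step a b l h hl ih =>
    exact .step ((he a (by simp)).trans h) (ih fun w hw => he w (by simp [hw]))

theorem RootPath.closed {x : V} {l : List V} (h : RootPath par x l) {S : V → Prop} (hx : S x)
    (hS : ∀ w y, S w → par w = some y → S y) : ∀ y ∈ l, S y := by
  induction h with
  | root h => simpa using hx
  | @step a b l h hl ih =>
    simp only [List.mem_cons, forall_eq_or_imp]
    exact ⟨hx, ih (hS _ _ hx h)⟩

/-- Reads parent pointers off a root path; applied to the path after relinking, it determines all
pointers changed by a merger. -/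
theorem RootPath.parent_of_pair {x w y : V} {l : List V} (h : RootPath par x l) (hw : [w, y] <:+: l) :
    par w = some y := by
  obtain ⟨s, t, hst⟩ := hw
  have hl : l = s ++ w :: y :: t := by simp [← hst]
  obtain ⟨l₁, l₂, h1, h2⟩ := h.suffix (y := w) (by simp [hl])
  have hn := h.nodup
  -- Both decompositions of `l` mark an occurrence of `w`; as `l` has no duplicates, they split it
  -- at the same place.
  have : l₂ = y :: t := by
    rw [h1] at hl hn
    have := List.append_inj_right' hl ?_
    · simpa using this
    · by_contra hne
      rcases List.append_eq_append_iff.1 hl with ⟨a, ha, hb⟩ | ⟨a, ha, hb⟩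
      · rcases a with _ | ⟨a0, a⟩
        · simp at hb; simp [hb] at hne
        · obtain ⟨rfl, rfl⟩ := List.cons.inj hb
          simp [List.nodup_append] at hn
      · rcases a with _ | ⟨a0, a⟩
        · simp at hb; simp [hb] at hne
        · obtain ⟨rfl, hb⟩ := List.cons.inj hb
          subst ha
          simp [List.nodup_append] at hn
  rw [this] at h2
  exact h2.tail.1

theorem RootPath.pair_of_mem {x w y : V} {l : List V} (h : RootPath par x l) (hw : w ∈ l)
    (hy : par w = some y) : [w, y] <:+: l := by
  obtain ⟨l₁, l₂, rfl, h2⟩ := h.suffix hw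
  obtain ⟨l', h3, h4⟩ := h2.step' hy
  obtain ⟨l'', rfl⟩ := h4.exists_cons
  obtain ⟨-, rfl⟩ := List.cons.inj h3
  exact ⟨l₁, l'', by simp⟩

theorem RootPath.cut [DecidableEq V] {x z : V} {l : List V} (h : RootPath par x l) :
    ∃ l', RootPath (Function.update par z none) x l' := by
  induction h with
  | @root x h =>
    refine ⟨_, .root ?_⟩
    by_cases hx : x = z <;> simp [hx, h]
  | @step a b l h hl ih =>
    obtain ⟨l', hl'⟩ := ih
    by_cases hx : a = z
    · exact ⟨_, .root (by simp [hx])⟩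
    · exact ⟨_, .step (by simp [hx, h]) hl'⟩

theorem RootPath.no_two_cycle {x y : V} {l : List V} (h : RootPath par x l) (hy : par x = some y) :
    par y ≠ some x := by
  intro hx
  obtain ⟨l', rfl, h2⟩ := h.step' hy
  obtain ⟨l'', rfl, h3⟩ := h2.step' hx
  have := h.nodup
  have h4 := h3.mem_self
  simp [h4] at this

theorem InBranch.of_rootPath {x r : V} {l : List V} (h : RootPath par x (l ++ [r])) :
    InBranch par r x := by
  obtain ⟨l', r', he, hr⟩ := h.exists_root
  have := (List.append_inj' he rfl).2
  simp at this
  subst this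
  exact ⟨hr, _, h, by simp⟩

theorem InBranch.exists_rootPath {x r : V} (h : InBranch par r x) :
    ∃ l, RootPath par x (l ++ [r]) := by
  obtain ⟨hr, l, hl, hm⟩ := h
  obtain ⟨l₁, l₂, rfl, h2⟩ := hl.suffix hm
  cases h2 with
  | root => exact ⟨_, hl⟩
  | step h _ => simp [hr] at h

theorem exists_inBranch {x : V} (h : ∃ l, RootPath par x l) : ∃ r, InBranch par r x := by
  obtain ⟨l, hl⟩ := h
  obtain ⟨l', r, rfl, -⟩ := hl.exists_root
  exact ⟨r, .of_rootPath hl⟩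

theorem InBranch.unique {x r r' : V} (h : InBranch par r x) (h' : InBranch par r' x) : r = r' := by
  obtain ⟨l, hl⟩ := h.exists_rootPath
  obtain ⟨l', hl'⟩ := h'.exists_rootPath
  have := (List.append_inj' (hl.unique hl') rfl).2
  simpa using this

theorem InBranch.self {r : V} (h : par r = none) : InBranch par r r := ⟨h, _, .root h, by simp⟩

theorem InBranch.parent {x y r : V} (h : InBranch par r x) (hy : par x = some y) :
    InBranch par r y := by
  obtain ⟨hr, l, hl, hm⟩ := h
  obtain ⟨l', rfl, h2⟩ := hl.step' hy
  refine ⟨hr, _, h2, ?_⟩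
  rcases List.mem_cons.1 hm with rfl | hm
  · simp [hr] at hy
  · exact hm

theorem InBranch.child {x y r : V} (h : InBranch par r y) (hy : par x = some y) :
    InBranch par r x := by
  obtain ⟨hr, l, hl, hm⟩ := h
  exact ⟨hr, _, .step hy hl, by simp [hm]⟩

theorem InBranch.eq_of_root {x r : V} (h : InBranch par r x) (hx : par x = none) : r = x :=
  h.unique (.self hx)

theorem InBranch.of_mem {x y r : V} {l : List V} (hl : RootPath par x l) (h : InBranch par r x)
    (hy : y ∈ l) : InBranch par r y :=
  hl.closed (S := InBranch par r) h (fun _ _ hw hp => hw.parent hp) y hy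

/-- Labels that do not decrease from a parent to its children. -/
def LabelMono (par : V → Option V) (label : V → ℕ) : Prop :=
  ∀ x y, par x = some y → label y ≤ label x

theorem RootPath.label_le {label : V → ℕ} (hm : LabelMono par label) {x : V} {l : List V}
    (h : RootPath par x l) : ∀ y ∈ l, label y ≤ label x :=
  h.closed (S := fun y => label y ≤ label x) le_rfl fun w y hw hy => (hm w y hy).trans hw

theorem InBranch.label_le {label : V → ℕ} (hm : LabelMono par label) {x r : V}
    (h : InBranch par r x) : label r ≤ label x := by
  obtain ⟨-, l, hl, hr⟩ := h
  exact hl.label_le hm r hr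

theorem mem_of_pair {w y : V} {l : List V} (h : [w, y] <:+: l) : w ∈ l ∧ y ∈ l :=
  ⟨h.subset (by simp), h.subset (by simp)⟩

theorem pair_append_cases {w y : V} {l₁ l₂ : List V} (h : [w, y] <:+: l₁ ++ l₂) :
    [w, y] <:+: l₁ ∨ [w, y] <:+: l₂ ∨ (l₁.getLast? = some w ∧ l₂.head? = some y) := by
  obtain ⟨s, t, hst⟩ := h
  rw [List.append_assoc] at hst
  rcases List.append_eq_append_iff.1 hst with ⟨a, rfl, hb⟩ | ⟨a, rfl, hb⟩
  · rcases a with _ | ⟨a0, _ | ⟨a1, a⟩⟩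
    · right; left
      exact ⟨[], t, by simpa using hb⟩
    · right; right
      simp at hb
      obtain ⟨rfl, rfl⟩ := hb
      simp
    · left
      simp at hb
      exact ⟨s, a, by simp [hb]⟩
  · right; left
    exact ⟨a, t, by simp [hb]⟩

end tree

/-! ### Relinking a list of nodes as an upward path -/

section link

variable {V : Type*} [DecidableEq V] {par : V → Option V}

theorem linkPath_of_notMem {l : List V} {par : V → Option V} {w : V} (h : w ∉ l) :
    linkPath l par w = par w := by
  induction l generalizing par with
  | nil => rfl
  | cons x l ih =>
    cases l with
    | nil => rfl
    | cons y l =>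
      rw [linkPath, ih (by simp_all)]
      simp only [List.mem_cons, not_or] at h
      simp [h.1]

theorem linkPath_rootPath {x : V} {l : List V} {par : V → Option V} (hn : (x :: l).Nodup)
    (hr : par ((x :: l).getLast (by simp)) = none) :
    RootPath (linkPath (x :: l) par) x (x :: l) := by
  induction l generalizing x par with
  | nil => exact .root (by simpa [linkPath] using hr)
  | cons y l ih =>
    rw [List.nodup_cons] at hn
    refine .step ?_ (ih hn.2 ?_)
    · rw [linkPath, linkPath_of_notMem hn.1]
      simp
    · rw [List.getLast_cons (by simp)] at hr
      rw [Function.update_of_ne _ _ _, hr]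
      intro h
      exact hn.1 (h ▸ List.getLast_mem _)

/-- Old pointers remain valid until the walk first meets `l`; from there the relinked path itself
leads to the root. -/
theorem linkPath_tree {l : List V} {x : V} (hl : RootPath (linkPath l par) x l) {w : V}
    {lw : List V} (h : RootPath par w lw) : ∃ l', RootPath (linkPath l par) w l' := by
  induction h with
  | @root w h =>
    by_cases hw : w ∈ l
    · obtain ⟨_, _, -, h2⟩ := hl.suffix hw
      exact ⟨_, h2⟩
    · exact ⟨_, .root ((linkPath_of_notMem hw).trans h)⟩
  | @step w y lw h _ ih =>
    by_cases hw : w ∈ l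
    · obtain ⟨_, _, -, h2⟩ := hl.suffix hw
      exact ⟨_, h2⟩
    · obtain ⟨l', hl'⟩ := ih
      exact ⟨_, .step ((linkPath_of_notMem hw).trans h) hl'⟩

end link

/-! ### Integral flows in the bipartite network -/

section bipartiteFlow

variable {α : Type u} {β : Type v} {E : Finset (α × β)} {c : α → β → ℝ≥0∞}

theorem cap_inl_inr_of_mem {a : α} {b : β} (h : (a, b) ∈ E) :
    (bipartiteNetwork E c).cap (.inl a) (.inr b) = c a b := by
  simp [bipartiteNetwork, h]

theorem cap_inl_inr_of_notMem {a : α} {b : β} (h : (a, b) ∉ E) :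
    (bipartiteNetwork E c).cap (.inl a) (.inr b) = 0 := by
  simp [bipartiteNetwork, h]

@[simp] theorem cap_inl_inl {a a' : α} : (bipartiteNetwork E c).cap (.inl a) (.inl a') = 0 := rfl

@[simp] theorem cap_inr {b : β} {x : α ⊕ β} : (bipartiteNetwork E c).cap (.inr b) x = 0 := rfl

theorem arc_iff (hc : ∀ e ∈ E, 1 ≤ c e.1 e.2) {x y : α ⊕ β} :
    (bipartiteNetwork E c).Arc x y ↔ ∃ a b, x = .inl a ∧ y = .inr b ∧ (a, b) ∈ E := by
  unfold FlowNetwork.Arc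
  rcases x with a | b <;> rcases y with a' | b' <;> simp
  by_cases h : (a, b') ∈ E
  · simpa [cap_inl_inr_of_mem h, h] using one_pos.trans_le (hc _ h)
  · simp [cap_inl_inr_of_notMem h, h]

/-- A flow that is `1` on some edges and `0` elsewhere. -/
def IntFlow (E : Finset (α × β)) (f : α ⊕ β → α ⊕ β → ℝ≥0) : Prop :=
  ∀ i j, f i j = 0 ∨ f i j = 1 ∧ ∃ a b, i = .inl a ∧ j = .inr b ∧ (a, b) ∈ E

/-- A node on the right side that receives flow from the left side. -/
def Touched (f : α ⊕ β → α ⊕ β → ℝ≥0) (b : β) : Prop := ∃ a, f (.inl a) (.inr b) ≠ 0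

/-- The flow `f` with value `t` on the arc from `a` to `b`. -/
def setFlow [DecidableEq α] [DecidableEq β] (f : α ⊕ β → α ⊕ β → ℝ≥0) (a : α) (b : β) (t : ℝ≥0) :
    α ⊕ β → α ⊕ β → ℝ≥0 :=
  fun i j => if i = .inl a ∧ j = .inr b then t else f i j

variable {f : α ⊕ β → α ⊕ β → ℝ≥0}

theorem IntFlow.inr_left (h : IntFlow E f) (b : β) (x : α ⊕ β) : f (.inr b) x = 0 := by
  rcases h (.inr b) x with h | ⟨-, a, b', h', -⟩
  · exact h
  · simp at h'

theorem IntFlow.inl_right (h : IntFlow E f) (a : α) (x : α ⊕ β) : f x (.inl a) = 0 := by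
  rcases h x (.inl a) with h | ⟨-, a, b', -, h, -⟩
  · exact h
  · simp at h

theorem IntFlow.eq_one (h : IntFlow E f) {x y : α ⊕ β} (hf : f x y ≠ 0) : f x y = 1 :=
  ((h x y).resolve_left hf).1

theorem IntFlow.mem (h : IntFlow E f) {a : α} {b : β} (hf : f (.inl a) (.inr b) ≠ 0) :
    (a, b) ∈ E := by
  obtain ⟨-, a', b', h1, h2, h3⟩ := (h _ _).resolve_left hf
  cases h1
  cases h2
  exact h3

theorem residual_inr_inl (f : α ⊕ β → α ⊕ β → ℝ≥0) (a : α) (b : β) :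
    (bipartiteNetwork E c).residual f (.inr b) (.inl a) = f (.inl a) (.inr b) := by
  simp [FlowNetwork.residual]

theorem IntFlow.residual_inl_inr (h : IntFlow E f) (a : α) (b : β) :
    (bipartiteNetwork E c).residual f (.inl a) (.inr b) =
      (bipartiteNetwork E c).cap (.inl a) (.inr b) - f (.inl a) (.inr b) := by
  simp [FlowNetwork.residual, h.inr_left]

theorem IntFlow.residual_pos_iff (h : IntFlow E f) {x y : α ⊕ β} :
    0 < (bipartiteNetwork E c).residual f x y ↔
      ∃ a b, (x = .inl a ∧ y = .inr b ∧ (a, b) ∈ E ∧ (f (.inl a) (.inr b) : ℝ≥0∞) < c a b) ∨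
        (x = .inr b ∧ y = .inl a ∧ f (.inl a) (.inr b) ≠ 0) := by
  rcases x with a | b <;> rcases y with a' | b'
  · simp [FlowNetwork.residual, h.inl_right]
  · rw [h.residual_inl_inr]
    by_cases he : (a, b') ∈ E
    · simp [cap_inl_inr_of_mem he, he]
    · simp [cap_inl_inr_of_notMem he, he]
  · rw [residual_inr_inl]
    simp [pos_iff_ne_zero]
  · simp [FlowNetwork.residual, h.inr_left]

theorem IntFlow.residual_le (h : IntFlow E f) (hc : ∀ e ∈ E, 1 ≤ c e.1 e.2) {a : α} {b : β}
    (he : (a, b) ∈ E) (hr : ¬ 0 < (bipartiteNetwork E c).residual f (.inl a) (.inr b)) :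
    f (.inl a) (.inr b) ≠ 0 := by
  intro h0
  refine hr (h.residual_pos_iff.2 ⟨a, b, .inl ⟨rfl, rfl, he, ?_⟩⟩)
  rw [h0]
  exact (by simp : ((0 : ℝ≥0) : ℝ≥0∞) < 1).trans_le (hc _ he)

open Classical in
theorem card_le_matchingNumber {M : Finset (α × β)} (hM : M ⊆ E) (h : IsMatching M) :
    M.card ≤ matchingNumber E := by
  unfold matchingNumber
  exact Finset.le_sup (f := Finset.card) (Finset.mem_filter.2 ⟨Finset.mem_powerset.2 hM, h⟩)

open Classical in
theorem matchingNumber_le {k : ℕ} (h : ∀ M ⊆ E, IsMatching M → M.card ≤ k) :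
    matchingNumber E ≤ k := by
  unfold matchingNumber
  refine Finset.sup_le fun M hM => ?_
  rw [Finset.mem_filter, Finset.mem_powerset] at hM
  exact h M hM.1 hM.2

theorem matchingNumber_pos (hE : E.Nonempty) : 1 ≤ matchingNumber E := by
  obtain ⟨e, he⟩ := hE
  refine le_trans ?_ (card_le_matchingNumber (M := {e}) (by simpa using he) ?_)
  · simp
  · intro a ha b hb _
    rw [Finset.mem_singleton] at ha hb
    rw [ha, hb]

theorem matchingNumber_le_card : matchingNumber E ≤ E.card :=
  matchingNumber_le fun _ hM _ => Finset.card_le_card hM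

theorem matchingNumber_le_card_image [DecidableEq α] :
    matchingNumber E ≤ (E.image Prod.fst).card := by
  refine matchingNumber_le fun M hM h => ?_
  rw [← Finset.card_image_of_injOn (s := M) (f := Prod.fst)]
  · exact Finset.card_le_card (Finset.image_subset_image hM)
  · exact fun a ha b hb hab => h a ha b hb (.inl hab)

theorem IntFlow.setFlow_one [DecidableEq α] [DecidableEq β] (h : IntFlow E f) {a : α} {b : β} (he : (a, b) ∈ E) :
    IntFlow E (setFlow f a b 1) := by
  intro i j
  unfold setFlow
  split_ifs with hij
  · exact .inr ⟨rfl, a, b, hij.1, hij.2, he⟩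
  · exact h i j

theorem IntFlow.setFlow_zero [DecidableEq α] [DecidableEq β] (h : IntFlow E f) (a : α) (b : β) :
    IntFlow E (setFlow f a b 0) := by
  intro i j
  unfold setFlow
  split_ifs with hij
  · exact .inl rfl
  · exact h i j

section fintype

variable [Fintype α] [Fintype β]

theorem IntFlow.excess_inl (h : IntFlow E f) (a : α) :
    (bipartiteNetwork E c).excess f (.inl a) = 1 - ∑ b, (f (.inl a) (.inr b) : ℝ) := by
  simp [FlowNetwork.excess, bipartiteNetwork, h.inl_right]

theorem IntFlow.excess_inr (h : IntFlow E f) (b : β) :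
    (bipartiteNetwork E c).excess f (.inr b) = ∑ a, (f (.inl a) (.inr b) : ℝ) - 1 := by
  simp [FlowNetwork.excess, bipartiteNetwork, h.inr_left]

theorem IntFlow.excess_int (h : IntFlow E f) (x : α ⊕ β) :
    ∃ k : ℤ, (bipartiteNetwork E c).excess f x = k := by
  have key : ∀ i j, (f i j : ℝ) = ((if f i j = 0 then 0 else 1 : ℤ) : ℝ) := by
    intro i j
    rcases h i j with h | ⟨h, -⟩ <;> simp [h]
  rcases x with a | b
  · refine ⟨1 - ∑ b, if f (.inl a) (.inr b) = 0 then 0 else 1, ?_⟩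
    rw [h.excess_inl, Int.cast_sub, Int.cast_sum, Int.cast_one]
    simp_rw [key]
  · refine ⟨∑ a, (if f (.inl a) (.inr b) = 0 then 0 else 1) - 1, ?_⟩
    rw [h.excess_inr, Int.cast_sub, Int.cast_sum, Int.cast_one]
    simp_rw [key]

theorem IntFlow.one_le_excess (h : IntFlow E f) {x : α ⊕ β}
    (hx : 0 < (bipartiteNetwork E c).excess f x) : 1 ≤ (bipartiteNetwork E c).excess f x := by
  obtain ⟨k, hk⟩ := h.excess_int (c := c) x
  rw [hk] at hx ⊢
  exact_mod_cast hx

theorem IntFlow.eq_zero_of_excess_pos (h : IntFlow E f) {a : α}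
    (ha : 0 < (bipartiteNetwork E c).excess f (.inl a)) (b : β) : f (.inl a) (.inr b) = 0 := by
  by_contra hb
  have h1 := h.eq_one hb
  rw [h.excess_inl] at ha
  have := Finset.single_le_sum (f := fun b => (f (.inl a) (.inr b) : ℝ)) (fun _ _ => by positivity)
    (Finset.mem_univ b)
  simp only [h1, NNReal.coe_one] at this
  linarith

theorem IntFlow.excess_eq_one (h : IntFlow E f) {a : α}
    (ha : 0 < (bipartiteNetwork E c).excess f (.inl a)) :
    (bipartiteNetwork E c).excess f (.inl a) = 1 := by
  rw [h.excess_inl]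
  simp [h.eq_zero_of_excess_pos ha]

/-- The excess of a right node is its inflow minus 1, and the inflow is an integer. The form in
terms of excess shows that pushes preserve touchedness. -/
theorem IntFlow.touched_iff (h : IntFlow E f) {b : β} :
    Touched f b ↔ 0 ≤ (bipartiteNetwork E c).excess f (.inr b) := by
  rw [h.excess_inr]
  constructor
  · rintro ⟨a, ha⟩
    have := Finset.single_le_sum (f := fun a => (f (.inl a) (.inr b) : ℝ))
      (fun _ _ => by positivity) (Finset.mem_univ a)
    simp only [h.eq_one ha, NNReal.coe_one] at this
    linarith
  · intro hs
    by_contra hb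
    simp only [Touched, not_exists, not_not] at hb
    simp [hb] at hs
    linarith

theorem IntFlow.unique (h : IntFlow E f) {a : α} {b b' : β}
    (ha : 0 ≤ (bipartiteNetwork E c).excess f (.inl a)) (hb : f (.inl a) (.inr b) ≠ 0)
    (hb' : f (.inl a) (.inr b') ≠ 0) : b = b' := by
  classical
  by_contra hne
  rw [h.excess_inl] at ha
  have := Finset.sum_le_sum_of_subset_of_nonneg (Finset.subset_univ {b, b'})
    (f := fun b => (f (.inl a) (.inr b) : ℝ)) (fun _ _ _ => by positivity)
  rw [Finset.sum_pair hne, h.eq_one hb, h.eq_one hb', NNReal.coe_one] at this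
  linarith

open Classical in
-- One flow-carrying edge is picked at each touched node. Nonnegative excess allows a left node only
-- one unit of outflow, so these edges form a matching.
theorem IntFlow.card_touched_le (h : IntFlow E f)
    (hl : ∀ a, 0 ≤ (bipartiteNetwork E c).excess f (.inl a)) :
    (Finset.univ.filter (Touched f)).card ≤ matchingNumber E := by
  choose g hg using fun b : {b // Touched f b} => b.2
  refine le_trans ?_ (card_le_matchingNumber
    (M := Finset.univ.image fun b : {b // Touched f b} => (g b, b.1)) ?_ ?_)
  · rw [Finset.card_image_of_injective, Finset.card_univ, Fintype.card_subtype]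
    intro b b' hb
    exact Subtype.ext (Prod.ext_iff.1 hb).2
  · intro e he
    obtain ⟨b, -, rfl⟩ := Finset.mem_image.1 he
    exact h.mem (hg b)
  · intro e he e' he' hee
    obtain ⟨b, -, rfl⟩ := Finset.mem_image.1 he
    obtain ⟨b', -, rfl⟩ := Finset.mem_image.1 he'
    have : b.1 = b'.1 := by
      rcases hee with hee | hee
      · have hee : g b = g b' := hee
        exact h.unique (hl _) (hg b) (hee ▸ hg b')
      · exact hee
    rw [Subtype.ext this]

open Classical in
-- Excess at most 1 on the right means inflow at most 2, so sending each such left node to a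
-- receiving neighbor is at most two-to-one onto touched nodes.
theorem IntFlow.card_matched_le (h : IntFlow E f)
    (hl : ∀ a, 0 ≤ (bipartiteNetwork E c).excess f (.inl a))
    (hr : ∀ b, (bipartiteNetwork E c).excess f (.inr b) ≤ 1) :
    (Finset.univ.filter fun a => ∃ b, f (.inl a) (.inr b) ≠ 0).card ≤ 2 * matchingNumber E := by
  refine le_trans ?_ (Nat.mul_le_mul_left 2 (h.card_touched_le hl))
  rw [← Fintype.card_subtype]
  choose g hg using fun a : {a // ∃ b, f (.inl a) (.inr b) ≠ 0} => a.2
  rw [← Finset.card_univ]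
  refine Finset.card_le_mul_card_image_of_maps_to (f := g) (fun a _ => ?_) 2 fun b _ => ?_
  · simpa using ⟨a.1, hg a⟩
  · rw [← Finset.card_map (Function.Embedding.subtype _)]
    have h1 := hr b
    rw [h.excess_inr] at h1
    have h2 := Finset.sum_le_sum_of_subset_of_nonneg (Finset.subset_univ
      ((Finset.univ.filter fun a => g a = b).map (Function.Embedding.subtype _)))
      (f := fun a => (f (.inl a) (.inr b) : ℝ)) (fun _ _ _ => by positivity)
    rw [Finset.sum_map, Finset.sum_congr rfl (g := fun _ => (1 : ℝ)), Finset.sum_const,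
      nsmul_eq_mul, mul_one] at h2
    · rw [Finset.card_map]
      have : ((Finset.univ.filter fun a => g a = b).card : ℝ) ≤ 2 := by linarith
      exact_mod_cast this
    · intro a ha
      have hab : g a = b := by simpa using ha
      have := h.eq_one (hab ▸ hg a)
      simp [this]

variable [DecidableEq α] [DecidableEq β]

theorem excess_setFlow (f : α ⊕ β → α ⊕ β → ℝ≥0) (a : α) (b : β) (t : ℝ≥0) (x : α ⊕ β) :
    (bipartiteNetwork E c).excess (setFlow f a b t) x =
      (bipartiteNetwork E c).excess f x + (if x = .inr b then (t - f (.inl a) (.inr b) : ℝ) else 0)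
        - (if x = .inl a then (t - f (.inl a) (.inr b) : ℝ) else 0) := by
  have key : ∀ i j, (setFlow f a b t i j : ℝ) =
      f i j + if i = .inl a ∧ j = .inr b then (t - f (.inl a) (.inr b) : ℝ) else 0 := by
    intro i j
    unfold setFlow
    split_ifs with h
    · simp [h.1, h.2]
    · simp
  unfold FlowNetwork.excess
  simp only [key, Finset.sum_add_distrib]
  have h1 : ∑ y : α ⊕ β, (if y = Sum.inl a ∧ x = Sum.inr b then (t - f (.inl a) (.inr b) : ℝ) else 0) =
      if x = .inr b then (t - f (.inl a) (.inr b) : ℝ) else 0 := by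
    by_cases hx : x = .inr b <;> simp [hx]
  have h2 : ∑ y : α ⊕ β, (if x = Sum.inl a ∧ y = Sum.inr b then (t - f (.inl a) (.inr b) : ℝ) else 0) =
      if x = .inl a then (t - f (.inl a) (.inr b) : ℝ) else 0 := by
    by_cases hx : x = .inl a <;> simp [hx]
  rw [h1, h2]
  ring

end fintype

end bipartiteFlow

/-! ### Pushing excess along an upward tree path -/

section setFlow

variable {α : Type u} {β : Type v} [DecidableEq α] [DecidableEq β] {E : Finset (α × β)}
  {c : α → β → ℝ≥0∞} {f : α ⊕ β → α ⊕ β → ℝ≥0}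

theorem residual_setFlow_of_ne {a : α} {b : β} {t : ℝ≥0} {x y : α ⊕ β}
    (h1 : ¬ (x = .inl a ∧ y = .inr b)) (h2 : ¬ (x = .inr b ∧ y = .inl a)) :
    (bipartiteNetwork E c).residual (setFlow f a b t) x y =
      (bipartiteNetwork E c).residual f x y := by
  unfold FlowNetwork.residual setFlow
  rw [if_neg h1, if_neg (fun h => h2 ⟨h.2, h.1⟩)]

theorem pushFlow_zero (x y : α ⊕ β) : pushFlow f x y 0 = f := by
  funext i j
  unfold pushFlow
  split_ifs with h1 h2
  · simp [h1.1, h1.2]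
  · simp [h2.1, h2.2]
  · rfl

end setFlow

section push

variable {α : Type u} {β : Type v} [Fintype α] [Fintype β]

/-- The properties of a normalized tree in the bipartite network other than flow balance, where the
nodes of `X` have a positive upward instead of a positive downward residual capacity. -/
structure PreNormalized (E : Finset (α × β)) (c : α → β → ℝ≥0∞) (f : α ⊕ β → α ⊕ β → ℝ≥0)
    (par : α ⊕ β → Option (α ⊕ β)) (X : List (α ⊕ β)) : Prop where
  int : IntFlow E f
  left : ∀ a, 0 ≤ (bipartiteNetwork E c).excess f (.inl a)
  tree : ∀ x, ∃ l, RootPath par x l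
  edges : ∀ x y, par x = some y →
    (bipartiteNetwork E c).Arc x y ∨ (bipartiteNetwork E c).Arc y x
  flow_tree : ∀ x y, f x y ≠ 0 → par x = some y ∨ par y = some x
  down : ∀ x y, par x = some y → x ∉ X → 0 < (bipartiteNetwork E c).residual f y x
  up : ∀ x y, par x = some y → x ∈ X → 0 < (bipartiteNetwork E c).residual f x y

/-- A normalized tree of the bipartite network with an integral flow. -/
structure Normalized (E : Finset (α × β)) (c : α → β → ℝ≥0∞) (f : α ⊕ β → α ⊕ β → ℝ≥0)
    (par : α ⊕ β → Option (α ⊕ β)) : Prop extends PreNormalized E c f par [] where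
  balanced : ∀ x, par x ≠ none → (bipartiteNetwork E c).excess f x = 0

variable {E : Finset (α × β)} {c : α → β → ℝ≥0∞} {f : α ⊕ β → α ⊕ β → ℝ≥0}
  {par : α ⊕ β → Option (α ⊕ β)} {X X' : List (α ⊕ β)}

theorem PreNormalized.neighbor_inl (h : PreNormalized E c f par X) (hc : ∀ e ∈ E, 1 ≤ c e.1 e.2)
    {a : α} {y : α ⊕ β} (hy : par (.inl a) = some y ∨ par y = some (.inl a)) :
    ∃ b, y = .inr b ∧ (a, b) ∈ E := by
  have h1 : (bipartiteNetwork E c).Arc (.inl a) y ∨ (bipartiteNetwork E c).Arc y (.inl a) := by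
    rcases hy with hy | hy
    · exact h.edges _ _ hy
    · exact (h.edges _ _ hy).symm
  simp only [arc_iff hc] at h1
  rcases h1 with ⟨a', b, h1, h2, h3⟩ | ⟨a', b, h1, h2, h3⟩
  · cases h1
    exact ⟨b, h2, h3⟩
  · cases h2

theorem PreNormalized.neighbor_inr (h : PreNormalized E c f par X) (hc : ∀ e ∈ E, 1 ≤ c e.1 e.2)
    {b : β} {y : α ⊕ β} (hy : par (.inr b) = some y ∨ par y = some (.inr b)) :
    ∃ a, y = .inl a ∧ (a, b) ∈ E := by
  have h1 : (bipartiteNetwork E c).Arc (.inr b) y ∨ (bipartiteNetwork E c).Arc y (.inr b) := by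
    rcases hy with hy | hy
    · exact h.edges _ _ hy
    · exact (h.edges _ _ hy).symm
  simp only [arc_iff hc] at h1
  rcases h1 with ⟨a', b', h1, h2, h3⟩ | ⟨a', b', h1, h2, h3⟩
  · cases h1
  · cases h2
    exact ⟨a', h1, h3⟩

theorem PreNormalized.no_two_cycle (h : PreNormalized E c f par X) {x y : α ⊕ β}
    (hy : par x = some y) : par y ≠ some x :=
  (h.tree x).elim fun _ hl => hl.no_two_cycle hy

theorem PreNormalized.congr_list (h : PreNormalized E c f par X)
    (hX : ∀ x, par x ≠ none → (x ∈ X ↔ x ∈ X')) : PreNormalized E c f par X' where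
  int := h.int
  left := h.left
  tree := h.tree
  edges := h.edges
  flow_tree := h.flow_tree
  down x y hy hx := h.down x y hy (by rwa [hX x (by simp [hy])])
  up x y hy hx := h.up x y hy (by rwa [hX x (by simp [hy])])

variable [DecidableEq α] [DecidableEq β]

/-- An edge without flow may leave the tree, since out-of-tree arcs are then still at their lower
bound. -/
theorem PreNormalized.cut (h : PreNormalized E c f par X) {z y : α ⊕ β} (hy : par z = some y)
    (h1 : f z y = 0) (h2 : f y z = 0) : PreNormalized E c f (Function.update par z none) X where
  int := h.int
  left := h.left
  tree x := (h.tree x).elim fun _ hl => hl.cut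
  edges i j hij := by
    by_cases hi : i = z
    · simp [hi] at hij
    · exact h.edges i j (by simpa [hi] using hij)
  flow_tree i j hij := by
    have hi : par i = some j → i ≠ z := by
      rintro hp rfl
      rw [hy] at hp
      cases hp
      exact hij h1
    have hj : par j = some i → j ≠ z := by
      rintro hp rfl
      rw [hy] at hp
      cases hp
      exact hij h2
    rcases h.flow_tree i j hij with hp | hp
    · exact .inl (by rw [Function.update_of_ne (hi hp), hp])
    · exact .inr (by rw [Function.update_of_ne (hj hp), hp])
  down i j hij := by
    by_cases hi : i = z
    · simp [hi] at hij
    · exact h.down i j (by simpa [hi] using hij)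
  up i j hij := by
    by_cases hi : i = z
    · simp [hi] at hij
    · exact h.up i j (by simpa [hi] using hij)

/-- Changing the flow on the tree edge between `z` and its parent `y`. -/
theorem PreNormalized.setFlow (h : PreNormalized E c f par X) {a : α} {b : β} {t : ℝ≥0}
    {z y : α ⊕ β} (hy : par z = some y)
    (hzy : (z = .inl a ∧ y = .inr b) ∨ (z = .inr b ∧ y = .inl a))
    (hint : IntFlow E (setFlow f a b t))
    (hleft : 0 ≤ (bipartiteNetwork E c).excess (setFlow f a b t) (.inl a))
    (hdown : 0 < (bipartiteNetwork E c).residual (Pseudoflow.setFlow f a b t) y z)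
    (hX : ∀ x, x ∈ X' ↔ x ∈ X ∧ x ≠ z) :
    PreNormalized E c (Pseudoflow.setFlow f a b t) par X' := by
  have hres : ∀ x w, par x = some w → x ≠ z →
      (bipartiteNetwork E c).residual (Pseudoflow.setFlow f a b t) x w =
        (bipartiteNetwork E c).residual f x w ∧
      (bipartiteNetwork E c).residual (Pseudoflow.setFlow f a b t) w x =
        (bipartiteNetwork E c).residual f w x := by
    intro x w hx hxz
    have h2 := h.no_two_cycle hy
    constructor <;> apply residual_setFlow_of_ne <;> rintro ⟨rfl, rfl⟩ <;>
      rcases hzy with ⟨rfl, rfl⟩ | ⟨rfl, rfl⟩ <;> simp_all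
  refine ⟨hint, fun a' => ?_, h.tree, h.edges, fun i j hij => ?_, fun i j hij hi => ?_,
    fun i j hij hi => ?_⟩
  · by_cases ha : a' = a
    · exact ha ▸ hleft
    · rw [excess_setFlow]
      simpa [ha] using h.left a'
  · by_cases he : i = .inl a ∧ j = .inr b
    · rcases hzy with ⟨rfl, rfl⟩ | ⟨rfl, rfl⟩
      · left; rw [he.1, he.2, hy]
      · right; rw [he.1, he.2, hy]
    · refine h.flow_tree i j ?_
      unfold Pseudoflow.setFlow at hij
      rwa [if_neg he] at hij
  · by_cases hz : i = z
    · subst hz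
      rw [hy] at hij
      cases hij
      exact hdown
    · rw [(hres i j hij hz).2]
      exact h.down i j hij fun hiX => hi ((hX i).2 ⟨hiX, hz⟩)
  · obtain ⟨hi1, hz⟩ := (hX i).1 hi
    rw [(hres i j hij hz).1]
    exact h.up i j hij hi1

/-- The effect of pushing from a node with positive excess to its parent, if the edge is not
saturated: exactly one unit is sent. -/
theorem PreNormalized.push (h : PreNormalized E c f par X) (hc : ∀ e ∈ E, 1 ≤ c e.1 e.2)
    {z y : α ⊕ β} (hy : par z = some y) (hz : 0 < (bipartiteNetwork E c).excess f z)
    (hr : 0 < (bipartiteNetwork E c).residual f z y) (hX : ∀ x, x ∈ X' ↔ x ∈ X ∧ x ≠ z)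
    {f' : α ⊕ β → α ⊕ β → ℝ≥0} {par' : α ⊕ β → Option (α ⊕ β)}
    (hf' : f' = pushFlow f z y ((bipartiteNetwork E c).pushAmount f z y))
    (hpar' : par' = if 1 < (bipartiteNetwork E c).excess f z then Function.update par z none
      else par) :
    PreNormalized E c f' par' X' ∧
    (∀ w, (bipartiteNetwork E c).excess f' w = (bipartiteNetwork E c).excess f w
      - (if w = z then 1 else 0) + if w = y then 1 else 0) ∧
    (∀ i j, 0 < (bipartiteNetwork E c).residual f' i j →
      0 < (bipartiteNetwork E c).residual f i j ∨ i = y ∧ j = z) ∧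
    (1 < (bipartiteNetwork E c).excess f z → (bipartiteNetwork E c).residual f' z y = 0) := by
  have hz1 := h.int.one_le_excess hz
  rcases z with a | b
  -- A left node with positive excess has excess exactly 1 and no outflow, and the capacity is at
  -- least 1: the whole unit passes and no cut occurs.
  · obtain ⟨b, rfl, he⟩ := h.neighbor_inl hc (.inl hy)
    have hz2 := h.int.excess_eq_one hz
    have h0 := h.int.eq_zero_of_excess_pos hz b
    have hf : f' = Pseudoflow.setFlow f a b 1 := by
      have ham : (bipartiteNetwork E c).pushAmount f (.inl a) (.inr b) = 1 := by
        unfold FlowNetwork.pushAmount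
        rw [h.int.residual_inl_inr, hz2, h0, cap_inl_inr_of_mem he]
        simp [hc _ he]
      rw [hf', ham]
      funext i j
      unfold pushFlow Pseudoflow.setFlow
      split_ifs with h1 h2
      · simp [h0, h.int.inr_left]
      · simp [h2.1, h2.2, h.int.inr_left]
      · rfl
    have hex : ∀ w, (bipartiteNetwork E c).excess f' w = (bipartiteNetwork E c).excess f w
      - (if w = .inl a then 1 else 0) + if w = .inr b then 1 else 0 := by
      intro w
      rw [hf, excess_setFlow, h0]
      simp only [NNReal.coe_one, NNReal.coe_zero, sub_zero]
      ring
    refine ⟨?_, hex, ?_, ?_⟩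
    · rw [hpar', if_neg (by rw [hz2]; simp), hf]
      refine h.setFlow hy (.inl ⟨rfl, rfl⟩) (h.int.setFlow_one he) ?_ ?_ hX
      · rw [← hf, hex, hz2]
        simp
      · rw [residual_inr_inl]
        simp [Pseudoflow.setFlow]
    · intro i j hij
      by_cases hji : i = .inr b ∧ j = .inl a
      · exact .inr hji
      · left
        by_cases hij2 : i = .inl a ∧ j = .inr b
        · rwa [hij2.1, hij2.2]
        · rwa [hf, residual_setFlow_of_ne hij2 hji] at hij
    · rw [hz2]
      simp
  -- From a right node the residual capacity is the flow on the edge, which is 1. Sending the unit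
  -- empties the edge, so a node with surplus excess can be cut.
  · obtain ⟨a, rfl, he⟩ := h.neighbor_inr hc (.inl hy)
    rw [residual_inr_inl] at hr
    have h1 := h.int.eq_one (x := .inl a) (y := .inr b) (by simpa [pos_iff_ne_zero] using hr)
    have hf : f' = Pseudoflow.setFlow f a b 0 := by
      have ham : (bipartiteNetwork E c).pushAmount f (.inr b) (.inl a) = 1 := by
        unfold FlowNetwork.pushAmount
        rw [residual_inr_inl, h1, min_eq_right]
        · simp
        · simpa using hz1
      rw [hf', ham]
      funext i j
      unfold pushFlow Pseudoflow.setFlow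
      split_ifs with h1 h2 h3
      · simp [h1.1, h1.2] at h2
      · simp [*, h.int.inr_left]
      · simp [*]
      · rfl
    have hex : ∀ w, (bipartiteNetwork E c).excess f' w = (bipartiteNetwork E c).excess f w
      - (if w = .inr b then 1 else 0) + if w = .inl a then 1 else 0 := by
      intro w
      rw [hf, excess_setFlow, h1]
      simp only [NNReal.coe_one, NNReal.coe_zero]
      split_ifs <;> ring
    have h0 : f' (.inl a) (.inr b) = 0 := by simp [hf, Pseudoflow.setFlow]
    have hpre : PreNormalized E c f' par X' := by
      rw [hf]
      refine h.setFlow hy (.inr ⟨rfl, rfl⟩) (h.int.setFlow_zero a b) ?_ ?_ hX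
      · rw [← hf, hex]
        have := h.left a
        simp
        linarith
      · rw [← hf, (hf ▸ h.int.setFlow_zero a b : IntFlow E f').residual_inl_inr, h0,
          cap_inl_inr_of_mem he]
        simpa using one_pos.trans_le (hc _ he)
    refine ⟨?_, hex, ?_, ?_⟩
    · rw [hpar']
      split_ifs
      · exact hpre.cut hy (hpre.int.inr_left _ _) h0
      · exact hpre
    · intro i j hij
      by_cases hji : i = .inl a ∧ j = .inr b
      · exact .inr hji
      · left
        by_cases hij2 : i = .inr b ∧ j = .inl a
        · rw [hij2.1, hij2.2, residual_inr_inl, h1]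
          simp
        · rwa [hf, residual_setFlow_of_ne hji hij2] at hij
    · intro _
      rw [residual_inr_inl, h0]
      simp

/-- Only right nodes get stuck, namely at edges without flow: a left node with excess has an empty
edge of capacity at least 1. -/
theorem PreNormalized.stuck (h : PreNormalized E c f par X) (hc : ∀ e ∈ E, 1 ≤ c e.1 e.2)
    {z y : α ⊕ β} (hy : par z = some y) (hz : 0 < (bipartiteNetwork E c).excess f z)
    (hr : (bipartiteNetwork E c).residual f z y = 0) :
    (bipartiteNetwork E c).pushAmount f z y = 0 ∧
    PreNormalized E c f (Function.update par z none) X := by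
  refine ⟨by simp [FlowNetwork.pushAmount, hr], ?_⟩
  rcases z with a | b
  · obtain ⟨b, rfl, he⟩ := h.neighbor_inl hc (.inl hy)
    exact absurd (h.int.eq_zero_of_excess_pos hz b) (h.int.residual_le hc he (by simp [hr]))
  · obtain ⟨a, rfl, he⟩ := h.neighbor_inr hc (.inl hy)
    rw [residual_inr_inl] at hr
    exact h.cut hy (h.int.inr_left _ _) (by simpa using hr)

theorem pushAlong_eq_self {l : List (α ⊕ β)}
    (h : ∀ w ∈ l.dropLast, (bipartiteNetwork E c).excess f w ≤ 0) :
    (bipartiteNetwork E c).pushAlong l (f, par) = (f, par) := by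
  induction l with
  | nil => rfl
  | cons x l ih =>
    cases l with
    | nil => rfl
    | cons y l =>
      have hx := h x (by simp)
      have ham : (bipartiteNetwork E c).pushAmount f x y = 0 := by
        unfold FlowNetwork.pushAmount
        rw [ENNReal.ofReal_eq_zero.2 hx]
        simp
      rw [FlowNetwork.pushAlong]
      simp only [ham, pushFlow_zero]
      rw [if_neg (not_lt.2 hx)]
      exact ih fun w hw => h w (by simp [hw])

/-- The outcome of pushing the excess of `z` along an upward path: one unit moves from `z` to `v`. -/
structure PushSpec (E : Finset (α × β)) (c : α → β → ℝ≥0∞) (f : α ⊕ β → α ⊕ β → ℝ≥0)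
    (par : α ⊕ β → Option (α ⊕ β)) (path : List (α ⊕ β)) (z v : α ⊕ β)
    (f' : α ⊕ β → α ⊕ β → ℝ≥0) (par' : α ⊕ β → Option (α ⊕ β)) : Prop where
  normalized : Normalized E c f' par'
  excess : ∀ w, (bipartiteNetwork E c).excess f' w = (bipartiteNetwork E c).excess f w
    - (if w = z then 1 else 0) + if w = v then 1 else 0
  parent : ∀ w, par' w = if w = v ∨ (w = z ∧ 1 < (bipartiteNetwork E c).excess f z) then none
    else par w
  halt : par v ≠ none → (bipartiteNetwork E c).excess f' v = 1
  halt_residual : ∀ y, par v = some y → (bipartiteNetwork E c).residual f' v y = 0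
  cut_residual : ∀ y, par z = some y → 1 < (bipartiteNetwork E c).excess f z →
    (bipartiteNetwork E c).residual f' z y = 0
  residual : ∀ i j, 0 < (bipartiteNetwork E c).residual f' i j →
    0 < (bipartiteNetwork E c).residual f i j ∨ par j = some i
  chain : ∃ l₁ l₂, path = l₁ ++ v :: l₂ ∧
    (l₁ ++ [v]).IsChain fun i j => 0 < (bipartiteNetwork E c).residual f i j

set_option maxHeartbeats 400000 in
-- Induction along the path. `X` is the part of the reversed from-path still ahead, where upward
-- residuals are positive. Only the starting root can have excess above 1; each later non-root node
-- is balanced before the unit arrives, so it holds exactly 1 and either passes it on or becomes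
-- `v`. After a halt the rest of the path has no excess to push.
theorem pushAlong_spec (hc : ∀ e ∈ E, 1 ≤ c e.1 e.2) {rest : List (α ⊕ β)} {z : α ⊕ β}
    (h : PreNormalized E c f par X) (hp : RootPath par z (z :: rest)) (hX : X <+: z :: rest)
    (hbal : ∀ w, w ≠ z → par w ≠ none → (bipartiteNetwork E c).excess f w = 0)
    (hz : par z ≠ none → 0 < (bipartiteNetwork E c).excess f z)
    (hz1 : X = [] → par z ≠ none → (bipartiteNetwork E c).excess f z = 1) :
    ∃ v, (par v ≠ none → v ∉ X) ∧ PushSpec E c f par (z :: rest) z v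
      ((bipartiteNetwork E c).pushAlong (z :: rest) (f, par)).1
      ((bipartiteNetwork E c).pushAlong (z :: rest) (f, par)).2 := by
  induction rest generalizing z f par X with
  | nil =>
    have hr : par z = none := by
      cases hp with
      | root h => exact h
      | step h h' => exact absurd rfl h'.ne_nil
    refine ⟨z, fun h => absurd hr h, ⟨h.congr_list ?_, ?_⟩, ?_, ?_, ?_, ?_, ?_, ?_, [], [], rfl, ?_⟩
    · intro x hx
      simp only [List.not_mem_nil, iff_false]
      intro hxX
      have := hX.subset hxX
      simp only [List.mem_singleton] at this
      exact hx (this ▸ hr)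
    · exact fun x hx => hbal x (fun hxz => hx (hxz ▸ hr)) hx
    · intro w
      simp [FlowNetwork.pushAlong]
    · intro w
      by_cases hw : w = z <;> simp [FlowNetwork.pushAlong, hw, hr]
    · simp [hr]
    · simp [hr]
    · simp [hr]
    · intro i j hij
      exact .inl hij
    · simp
  | cons y rest ih =>
    obtain ⟨hy, hp'⟩ := hp.tail
    have hzpos := hz (by simp [hy])
    have hnd := List.nodup_cons.1 hp.nodup
    by_cases hr : 0 < (bipartiteNetwork E c).residual f z y
    · obtain ⟨f1, hf1⟩ : ∃ f1, f1 = pushFlow f z y ((bipartiteNetwork E c).pushAmount f z y) :=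
        ⟨_, rfl⟩
      obtain ⟨par1, hpar1⟩ : ∃ par1, par1 = if 1 < (bipartiteNetwork E c).excess f z then
        Function.update par z none else par := ⟨_, rfl⟩
      have hX' : ∀ x, x ∈ X.tail ↔ x ∈ X ∧ x ≠ z := by
        intro x
        rcases X with _ | ⟨x0, X⟩
        · simp
        · obtain ⟨rfl, hX1⟩ := List.cons_prefix_cons.1 hX
          simp only [List.tail_cons, List.mem_cons]
          constructor
          · intro hx
            refine ⟨.inr hx, ?_⟩
            rintro rfl
            exact hnd.1 (hX1.subset hx)
          · rintro ⟨h1 | h1, h2⟩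
            · exact absurd h1 h2
            · exact h1
      obtain ⟨h1, hex, hres, hcut⟩ := h.push hc hy hzpos hr hX' hf1 hpar1
      have hoff : ∀ w, w ≠ z → par1 w = par w := by
        intro w hw
        rw [hpar1]
        split_ifs <;> simp [hw]
      have hyz : y ≠ z := by
        rintro rfl
        simp at hnd
      have hey : par1 y ≠ none → (bipartiteNetwork E c).excess f1 y = 1 := by
        intro hy1
        rw [hex, hbal y hyz (hoff y hyz ▸ hy1)]
        simp [hyz]
      have heq : (bipartiteNetwork E c).pushAlong (z :: y :: rest) (f, par) =
          (bipartiteNetwork E c).pushAlong (y :: rest) (f1, par1) := by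
        rw [FlowNetwork.pushAlong]
        simp only [← hf1]
        congr 2
        rw [hpar1, hex]
        simp [Ne.symm hyz]
      obtain ⟨v, hv, hs⟩ := ih (X := X.tail) h1
        (hp'.congr fun w hw => hoff w (fun hwz => hnd.1 (hwz ▸ hw))) (by
          rcases X with _ | ⟨x0, X⟩
          · simp
          · exact (List.cons_prefix_cons.1 hX).2) (by
          intro w hw hw1
          by_cases hwz : w = z
          · subst hwz
            rw [hex, if_pos rfl, if_neg hw]
            by_cases h2 : 1 < (bipartiteNetwork E c).excess f w
            · rw [hpar1, if_pos h2] at hw1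
              simp at hw1
            · have := h.int.one_le_excess hzpos
              linarith
          · rw [hex, hbal w hwz (hoff w hwz ▸ hw1)]
            simp [hw, hwz]) (fun hy1 => by rw [hey hy1]; simp) (fun _ hy1 => hey hy1)
      rw [heq]
      obtain ⟨l₁, l₂, hl, hch⟩ := hs.chain
      have hvm : v ∈ y :: rest := by simp [hl]
      have hvz : v ≠ z := fun hvz => hnd.1 (hvz ▸ hvm)
      refine ⟨v, fun hvX => ?_, hs.normalized, ?_, ?_, ?_, ?_, ?_, ?_, z :: l₁, l₂, by simp [hl], ?_⟩
      · exact fun hX1 => hv (hoff v hvz ▸ hvX) ((hX' v).2 ⟨hX1, hvz⟩)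
      · intro w
        rw [hs.excess, hex]
        ring
      · intro w
        rw [hs.parent]
        by_cases hwz : w = z
        · subst hwz
          simp only [Ne.symm hvz, Ne.symm hyz, false_or, false_and, if_false, true_and]
          rw [hpar1]
          split_ifs <;> simp
        · rw [hoff w hwz]
          by_cases hwv : w = v
          · simp [hwv]
          · simp only [hwv, hwz, false_or, false_and, if_false]
            split_ifs with h2
            · by_contra hne
              obtain ⟨rfl, h2⟩ := h2
              rw [hey (by rw [hoff w hwz]; exact Ne.symm hne)] at h2
              simp at h2
            · rfl
      · rw [← hoff v hvz]
        exact hs.halt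
      · rw [← hoff v hvz]
        exact hs.halt_residual
      · intro y' hy' h2
        rw [hy] at hy'
        cases hy'
        by_contra hne
        rcases hs.residual _ _ (pos_iff_ne_zero.2 hne) with h3 | h3
        · rw [hcut h2] at h3
          exact absurd h3 (lt_irrefl _)
        · rw [hoff y hyz] at h3
          exact h.no_two_cycle hy h3
      · intro i j hij
        rcases hs.residual i j hij with h3 | h3
        · rcases hres i j h3 with h4 | ⟨rfl, rfl⟩
          · exact .inl h4
          · exact .inr hy
        · right
          by_cases hj : j = z
          · subst hj
            rw [hpar1] at h3
            split_ifs at h3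
            · simp at h3
            · exact h3
          · rwa [hoff j hj] at h3
      · have : ∃ l₃, l₁ ++ [v] = y :: l₃ := by
          rcases l₁ with _ | ⟨w, l₁⟩
          · exact ⟨[], by simp at hl; simp [hl.1]⟩
          · exact ⟨l₁ ++ [v], by simp at hl; simp [hl.1]⟩
        obtain ⟨l₃, h3⟩ := this
        have hz3 : z ∉ y :: l₃ := by
          rw [← h3]
          intro hz3
          apply hnd.1
          rw [hl]
          simp at hz3 ⊢
          tauto
        rw [List.cons_append, h3, List.isChain_cons_cons]
        rw [h3] at hch
        refine ⟨hr, hch.imp_of_mem_imp fun i j hi hj hij => ?_⟩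
        rcases hres i j hij with h4 | ⟨rfl, rfl⟩
        · exact h4
        · exact absurd hj hz3
    · have hr0 : (bipartiteNetwork E c).residual f z y = 0 := by
        simpa [pos_iff_ne_zero] using hr
      obtain ⟨ham, hcut⟩ := h.stuck hc hy hzpos hr0
      -- Upward residuals are positive on `X`, so the unit cannot get stuck before the reversed part
      -- has been left.
      have hXe : X = [] := by
        rcases X with _ | ⟨x0, X⟩
        · rfl
        · obtain ⟨rfl, -⟩ := List.cons_prefix_cons.1 hX
          exact absurd (h.up x0 y hy (by simp)) hr
      subst hXe
      have hez := hz1 rfl (by simp [hy])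
      have heq : (bipartiteNetwork E c).pushAlong (z :: y :: rest) (f, par) =
          (f, Function.update par z none) := by
        rw [FlowNetwork.pushAlong]
        simp only [ham, pushFlow_zero]
        rw [if_pos hzpos]
        refine pushAlong_eq_self fun w hw => ?_
        have hwz : w ≠ z := fun hwz => hnd.1 (hwz ▸ List.dropLast_subset _ hw)
        refine (hbal w hwz ?_).le
        exact hp'.parent_ne_none hw
      rw [heq]
      refine ⟨z, by simp, ⟨hcut, ?_⟩, ?_, ?_, ?_, ?_, ?_, ?_, [], y :: rest, rfl, by simp⟩
      · intro x hx
        by_cases hxz : x = z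
        · simp [hxz] at hx
        · exact hbal x hxz (by simpa [hxz] using hx)
      · intro w
        simp
      · intro w
        by_cases hwz : w = z <;> simp [hwz]
      · exact fun _ => hez
      · intro y' hy'
        rw [hy] at hy'
        cases hy'
        exact hr0
      · intro y' hy' h2
        rw [hez] at h2
        simp at h2
      · exact fun i j hij => .inl hij

end push

/-! ### Mergers -/

section link

variable {V : Type*} [DecidableEq V] {par : V → Option V}

/-- The parent pointers after the paths `p` and `q` of `x` and `y` have been joined by `(x, y)`. -/
structure LinkSpec (par : V → Option V) (x y : V) (p q : List V) (r : V) (par' : V → Option V) :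
    Prop where
  path : RootPath par' r (p.reverse ++ q)
  off : ∀ w, w ∉ p → par' w = par w
  parent_x : par' x = some y
  reverse : ∀ w z, w ∈ p → par w = some z → par' z = some w
  mem : ∀ w z, w ∈ p → par' w = some z → w = x ∧ z = y ∨ z ∈ p ∧ par z = some w

/-- The nodes of `q` are relinked to the parents they already had, so the pointers change only on
`p`, where they are reversed and `x` is attached to `y`. -/
theorem linkPath_spec {x y r : V} {p q : List V} (hp : RootPath par x p) (hq : RootPath par y q)
    (hpq : p.Disjoint q) (hr : InBranch par r x) :
    LinkSpec par x y p q r (linkPath (p.reverse ++ q) par) := by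
  obtain ⟨l, hl⟩ := hr.exists_rootPath
  obtain rfl := hp.unique hl
  obtain ⟨q', rq, hq', hrq⟩ := hq.exists_root
  have hnd : ((l ++ [r]).reverse ++ q).Nodup :=
    (List.nodup_reverse.2 hp.nodup).append hq.nodup (by
      intro w hw
      exact hpq (List.mem_reverse.1 hw))
  have hpath : RootPath (linkPath ((l ++ [r]).reverse ++ q) par) r ((l ++ [r]).reverse ++ q) := by
    have : (l ++ [r]).reverse ++ q = r :: (l.reverse ++ q) := by simp
    rw [this] at hnd ⊢
    refine linkPath_rootPath hnd ?_
    simpa [hq'] using hrq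
  have hx : (l ++ [r]).reverse.getLast? = some x := by
    obtain ⟨l', hl'⟩ := hp.exists_cons
    simp [hl']
  have hy : q.head? = some y := by
    obtain ⟨q'', hq''⟩ := hq.exists_cons
    simp [hq'']
  have hxy : [x, y] <:+: (l ++ [r]).reverse ++ q := by
    obtain ⟨l', hl'⟩ := hp.exists_cons
    obtain ⟨q'', hq''⟩ := hq.exists_cons
    exact ⟨l'.reverse, q'', by simp [hl', hq'']⟩
  refine ⟨hpath, fun w hw => ?_, hpath.parent_of_pair hxy, fun w z hw hz => ?_, fun w z hw hz => ?_⟩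
  · by_cases hwq : w ∈ q
    · by_cases hwn : par w = none
      · have h1 : w = rq := by
          by_contra hne
          refine hq.parent_ne_none ?_ hwn
          rw [hq'] at hwq ⊢
          simpa [hne] using hwq
        obtain ⟨l', r', h2, h3⟩ := hpath.exists_root
        rw [hq', ← List.append_assoc] at h2
        have h4 := (List.append_inj' h2 rfl).2
        simp only [List.cons.injEq, and_true] at h4
        rw [hwn, h1, h4]
        exact h3
      · obtain ⟨z, hz⟩ := Option.ne_none_iff_exists'.1 hwn
        rw [hz]
        exact hpath.parent_of_pair ((hq.pair_of_mem hwq hz).trans (List.suffix_append _ _).isInfix)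
    · exact linkPath_of_notMem (by rw [List.mem_append, List.mem_reverse]; tauto)
  · refine hpath.parent_of_pair (List.IsInfix.trans ?_ (List.prefix_append _ _).isInfix)
    simpa using List.reverse_infix.2 (hp.pair_of_mem hw hz)
  · have h1 := hpath.pair_of_mem (w := w)
      (by rw [List.mem_append, List.mem_reverse]; exact .inl hw) hz
    rcases pair_append_cases h1 with h2 | h2 | h2
    · right
      have h3 : [z, w] <:+: l ++ [r] := by simpa using List.reverse_infix.2 h2
      exact ⟨(mem_of_pair h3).1, hp.parent_of_pair h3⟩
    · exact absurd (mem_of_pair h2).1 (hpq hw)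
    · left
      rw [hx, hy] at h2
      exact ⟨(Option.some.inj h2.1).symm, (Option.some.inj h2.2).symm⟩

end link

section merger

variable {α : Type u} {β : Type v} [Fintype α] [Fintype β] {E : Finset (α × β)} {c : α → β → ℝ≥0∞} {f : α ⊕ β → α ⊕ β → ℝ≥0}
  {par : α ⊕ β → Option (α ⊕ β)}

/-- Reversal turns the positive downward residuals along `p` into upward ones; at `x` the upward
residual is that of the merger arc. -/
theorem Normalized.preNormalized_link (h : Normalized E c f par) {x y r : α ⊕ β}
    {p q : List (α ⊕ β)} {par' : α ⊕ β → Option (α ⊕ β)} (hp : RootPath par x p)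
    (hl : LinkSpec par x y p q r par') (htree : ∀ w, ∃ l, RootPath par' w l)
    (hxy : 0 < (bipartiteNetwork E c).residual f x y) :
    PreNormalized E c f par' p.reverse where
  int := h.int
  left := h.left
  tree := htree
  edges i j hij := by
    by_cases hi : i ∈ p
    · rcases hl.mem i j hi hij with ⟨rfl, rfl⟩ | ⟨-, h1⟩
      -- A positive residual comes from a capacity or from flow on the reverse arc; flow lies on
      -- tree edges, which are arcs of the network.
      · unfold FlowNetwork.residual at hxy
        unfold FlowNetwork.Arc
        by_contra hne
        simp only [not_or, not_lt, nonpos_iff_eq_zero] at hne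
        have h0 : f j i = 0 := by
          by_contra hf
          obtain ⟨-, a, b, rfl, rfl, -⟩ := (h.int j i).resolve_left hf
          have := h.int.eq_one hf
          rcases h.flow_tree _ _ hf with h1 | h1 <;>
            have := h.edges _ _ h1 <;> simp_all [FlowNetwork.Arc]
        simp [hne.1, h0] at hxy
      · exact (h.edges _ _ h1).symm
    · exact h.edges i j (hl.off i hi ▸ hij)
  flow_tree i j hij := by
    have key : ∀ i j, par i = some j → par' i = some j ∨ par' j = some i := by
      intro i j hij
      by_cases hi : i ∈ p
      · exact .inr (hl.reverse i j hi hij)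
      · exact .inl ((hl.off i hi).trans hij)
    rcases h.flow_tree i j hij with h1 | h1
    · exact key i j h1
    · exact (key j i h1).symm
  down i j hij hi := by
    rw [List.mem_reverse] at hi
    exact h.down i j (hl.off i hi ▸ hij) (by simp)
  up i j hij hi := by
    rw [List.mem_reverse] at hi
    rcases hl.mem i j hi hij with ⟨rfl, rfl⟩ | ⟨-, h1⟩
    · exact hxy
    · exact h.down _ _ h1 (by simp)

variable [DecidableEq α] [DecidableEq β]

/-- The outcome of a merger over `(x, y)`, where `p` and `q` are the paths from `x` and `y` to their
roots and `r` is the root of `x`: one unit of excess moves from `r` to a node `v` of `q`. -/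
structure MergeSpec (E : Finset (α × β)) (c : α → β → ℝ≥0∞) (f : α ⊕ β → α ⊕ β → ℝ≥0)
    (par : α ⊕ β → Option (α ⊕ β)) (x y : α ⊕ β) (p q : List (α ⊕ β)) (r v : α ⊕ β)
    (f' : α ⊕ β → α ⊕ β → ℝ≥0) (par' : α ⊕ β → Option (α ⊕ β)) : Prop where
  normalized : Normalized E c f' par'
  excess : ∀ w, (bipartiteNetwork E c).excess f' w = (bipartiteNetwork E c).excess f w
    - (if w = r then 1 else 0) + if w = v then 1 else 0
  mem : v ∈ q
  root : par r = none
  root_mem : r ∈ p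
  parent_v : par' v = none
  parent_off : ∀ w, w ∉ p → w ≠ v → par' w = par w
  parent_mem : ∀ w, w ∈ p → par' w = none ∧ w = r ∧ 1 < (bipartiteNetwork E c).excess f r ∨
    w = x ∧ par' w = some y ∨ ∃ z ∈ p, par z = some w ∧ par' w = some z
  parent_x : par' x = some y ∨ (bipartiteNetwork E c).residual f' x y = 0 ∧
    1 < (bipartiteNetwork E c).excess f r
  halt : par v ≠ none → (bipartiteNetwork E c).excess f' v = 1
  halt_residual : ∀ z, par v = some z → (bipartiteNetwork E c).residual f' v z = 0
  residual : ∀ i j, 0 < (bipartiteNetwork E c).residual f' i j →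
    0 < (bipartiteNetwork E c).residual f i j ∨ j ∉ p ∧ par j = some i ∨ j = x ∧ i = y ∨
      i ∈ p ∧ j ∈ p
  chain : ∃ l₁ l₂, q = l₁ ++ v :: l₂ ∧
    (l₁ ++ [v]).IsChain fun i j => 0 < (bipartiteNetwork E c).residual f i j

theorem Normalized.merge (h : Normalized E c f par) (hc : ∀ e ∈ E, 1 ≤ c e.1 e.2) {x y r : α ⊕ β}
    {p q : List (α ⊕ β)} (hp : RootPath par x p) (hq : RootPath par y q) (hpq : p.Disjoint q)
    (hr : InBranch par r x) (hr0 : 0 < (bipartiteNetwork E c).excess f r)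
    (hxy : 0 < (bipartiteNetwork E c).residual f x y) :
    ∃ v, MergeSpec E c f par x y p q r v
      ((bipartiteNetwork E c).merge (p.reverse ++ q) f par).1
      ((bipartiteNetwork E c).merge (p.reverse ++ q) f par).2 := by
  have hl := linkPath_spec hp hq hpq hr
  have hrp : r ∈ p := by
    obtain ⟨l, hl⟩ := hr.exists_rootPath
    rw [hp.unique hl]
    simp
  have hpre := h.preNormalized_link hp hl
    (fun w => (h.tree w).elim fun _ hw => linkPath_tree hl.path hw) hxy
  obtain ⟨l, hl'⟩ := hl.path.exists_cons
  unfold FlowNetwork.merge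
  generalize linkPath (p.reverse ++ q) par = par1 at hl hpre
  have hpath := hl.path
  have hpre1 : p.reverse <+: r :: l := hl' ▸ List.prefix_append _ _
  rw [hl'] at hpath ⊢
  obtain ⟨v, hv, hs⟩ := pushAlong_spec hc hpre hpath hpre1 (by
    intro w hwr hw
    by_contra hne
    have hwn : par w = none := by
      by_contra hn
      exact hne (h.balanced w hn)
    by_cases hwp : w ∈ p
    · obtain ⟨l, hl⟩ := hr.exists_rootPath
      have := hp.unique hl
      subst this
      have hw' : w ∈ l := by simpa [hwr] using hwp
      exact hp.parent_ne_none (w := w) (by simpa using hw') hwn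
    · exact hw ((hl.off w hwp).trans hwn)) (fun _ => hr0)
    (fun hn => absurd (List.reverse_eq_nil_iff.1 hn) hp.ne_nil)
  generalize ((bipartiteNetwork E c).pushAlong (r :: l) (f, par1)).1 = f' at hs
  generalize ((bipartiteNetwork E c).pushAlong (r :: l) (f, par1)).2 = par' at hs
  obtain ⟨l₁, l₂, hl1, hch⟩ := hs.chain
  have hvpath : v ∈ p.reverse ++ q := by rw [hl', hl1]; simp
  have hpne : ∀ w ∈ p, par1 w ≠ none := by
    intro w hw
    have hq0 := hq.ne_nil
    have hpth := hl.path
    obtain ⟨q', rq, hq', -⟩ := hq.exists_root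
    refine hpth.parent_ne_none ?_
    rw [hq', ← List.append_assoc, List.dropLast_concat]
    simp [hw]
  -- Every node of `p` has a parent in the relinked tree and a positive upward residual, so the unit
  -- cannot stop on `p`.
  have hvp : v ∉ p := fun hvp => hv (hpne v hvp) (List.mem_reverse.2 hvp)
  have hvq : v ∈ q := by
    simpa [hvp] using hvpath
  have hoffv : par1 v = par v := hl.off v hvp
  refine ⟨v, hs.normalized, hs.excess, hvq, hr.1, hrp, ?_, ?_, ?_, ?_, ?_, ?_, ?_, ?_⟩
  · simp [hs.parent]
  · intro w hw hwv
    rw [hs.parent, if_neg, hl.off w hw]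
    rintro (h1 | ⟨rfl, -⟩)
    · exact hwv h1
    · exact hw hrp
  · intro w hw
    by_cases h1 : w = r ∧ 1 < (bipartiteNetwork E c).excess f r
    · left
      exact ⟨by rw [hs.parent, if_pos (.inr h1)], h1⟩
    · right
      have h2 : par' w = par1 w := by
        rw [hs.parent, if_neg]
        rintro (rfl | h3)
        · exact hvp hw
        · exact h1 h3
      obtain ⟨z, hz⟩ := Option.ne_none_iff_exists'.1 (hpne w hw)
      rcases hl.mem w z hw hz with ⟨rfl, rfl⟩ | h3
      · exact .inl ⟨rfl, h2.trans hz⟩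
      · exact .inr ⟨z, h3.1, h3.2, h2.trans hz⟩
  · by_cases h1 : x = r ∧ 1 < (bipartiteNetwork E c).excess f r
    · right
      refine ⟨?_, h1.2⟩
      rw [h1.1]
      exact hs.cut_residual y (h1.1 ▸ hl.parent_x) h1.2
    · left
      rw [hs.parent, if_neg, hl.parent_x]
      rintro (rfl | h3)
      · exact hvp hp.mem_self
      · exact h1 h3
  · rw [← hoffv]
    exact hs.halt
  · rw [← hoffv]
    exact hs.halt_residual
  · intro i j hij
    rcases hs.residual i j hij with h1 | h1
    · exact .inl h1
    · right
      by_cases hj : j ∈ p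
      · rcases hl.mem j i hj h1 with h2 | h2
        · exact .inr (.inl h2)
        · exact .inr (.inr ⟨h2.1, hj⟩)
      · exact .inl ⟨hj, hl.off j hj ▸ h1⟩
  · rw [← hl'] at hl1
    obtain ⟨l₃, rfl⟩ : ∃ l₃, l₁ = p.reverse ++ l₃ := by
      rcases List.append_eq_append_iff.1 hl1 with ⟨a, ha, -⟩ | ⟨a, ha, hb⟩
      · exact ⟨a, ha⟩
      · rcases a with _ | ⟨a0, a⟩
        · exact ⟨[], by simpa using ha.symm⟩
        · obtain ⟨rfl, -⟩ := List.cons.inj hb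
          exact absurd (List.mem_reverse.1 (ha ▸ by simp)) hvp
    refine ⟨l₃, l₂, by simpa using hl1, ?_⟩
    rw [List.append_assoc] at hch
    exact hch.right_of_append

/-- Only `r` loses excess, and it drops by 1 from at least 1, so nonnegative excesses stay
nonnegative. -/
theorem MergeSpec.touched {x y r v : α ⊕ β} {p q : List (α ⊕ β)} {f' : α ⊕ β → α ⊕ β → ℝ≥0}
    {par' : α ⊕ β → Option (α ⊕ β)} (h : MergeSpec E c f par x y p q r v f' par')
    (hf : IntFlow E f) (hr : 0 < (bipartiteNetwork E c).excess f r) {b : β} (hb : Touched f b) :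
    Touched f' b := by
  rw [h.normalized.int.touched_iff (c := c), h.excess]
  rw [hf.touched_iff (c := c)] at hb
  have := hf.one_le_excess hr
  split_ifs with h1 h2 h2
  · rw [h1]; linarith
  · rw [h1]; linarith
  · linarith
  · linarith

end merger

/-! ### Invariants of both variants -/

section invariant

variable {α : Type u} {β : Type v} [Fintype α] [Fintype β] {E : Finset (α × β)}
  {c : α → β → ℝ≥0∞} {adj : α ⊕ β → List (α ⊕ β)} {var : Variant} {s s' : State (α ⊕ β)}

/-- The selected root is still selectable, and the search is at a node of its label. -/
def Searching (N : FlowNetwork (α ⊕ β)) (var : Variant) (s : State (α ⊕ β)) (x r : α ⊕ β) : Prop :=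
  s.Selectable N var r ∧ InBranch s.parent r x ∧ s.label x = s.label r ∧
    (s.label r = 1 ∨ ∃ y, s.label y + 1 = s.label r)

/-- Properties of all reachable states. -/
structure Inv (E : Finset (α × β)) (c : α → β → ℝ≥0∞) (adj : α ⊕ β → List (α ⊕ β))
    (var : Variant) (s : State (α ⊕ β)) : Prop where
  normalized : Normalized E c s.flow s.parent
  label_pos : ∀ x, 1 ≤ s.label x
  label_le : ∀ x, s.label x ≤ (bipartiteNetwork E c).numNodes
  mono : LabelMono s.parent s.label
  touched : ∀ b, 1 < s.label (.inr b) → Touched s.flow b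
  ptr_le : ∀ x, s.ptr x ≤ (adj x).length
  cur : ∀ x, s.cur = some x → ∃ r, Searching (bipartiteNetwork E c) var s x r

/-- The root has nonnegative excess by assumption, and every other node of the branch is balanced.
-/
theorem Normalized.touched_of_inBranch {f : α ⊕ β → α ⊕ β → ℝ≥0} {par : α ⊕ β → Option (α ⊕ β)}
    (h : Normalized E c f par) {r : α ⊕ β} {b : β} (hr : InBranch par r (.inr b))
    (he : 0 ≤ (bipartiteNetwork E c).excess f r) : Touched f b := by
  rw [h.int.touched_iff (c := c)]
  by_cases hb : par (.inr b) = none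
  · rwa [← hr.eq_of_root hb]
  · exact (h.balanced _ hb).ge

theorem normalized_init : Normalized E c (State.init (α ⊕ β)).flow (State.init (α ⊕ β)).parent := by
  have hint : IntFlow E (State.init (α ⊕ β)).flow := fun _ _ => .inl rfl
  refine ⟨⟨hint, fun a => ?_, fun x => ⟨_, .root rfl⟩, ?_, ?_, ?_, ?_⟩, ?_⟩
  · rw [hint.excess_inl]
    simp [State.init]
  all_goals simp [State.init]

theorem Searching.label_lt {N : FlowNetwork (α ⊕ β)} {x r : α ⊕ β} (h : Searching N var s x r) :
    s.label x < N.numNodes := by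
  rw [h.2.2.1]
  exact h.1.1.2.2

theorem Searching.label_parent {N : FlowNetwork (α ⊕ β)} {x r z : α ⊕ β}
    (h : Searching N var s x r) (hm : LabelMono s.parent s.label) (hz : s.parent x = some z) :
    s.label z = s.label x :=
  le_antisymm (hm _ _ hz) (h.2.2.1 ▸ (h.2.1.parent hz).label_le hm)

theorem Searching.label_path {N : FlowNetwork (α ⊕ β)} {x r : α ⊕ β} {p : List (α ⊕ β)}
    (h : Searching N var s x r) (hm : LabelMono s.parent s.label) (hp : RootPath s.parent x p) :
    ∀ w ∈ p, s.label w = s.label x := fun w hw =>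
  le_antisymm (hp.label_le hm w hw) (h.2.2.1 ▸ (h.2.1.of_mem hp hw).label_le hm)

theorem inv_init : Inv E c adj var (State.init (α ⊕ β)) where
  normalized := normalized_init
  label_pos := fun _ => le_rfl
  label_le := fun _ => by simp [State.init, FlowNetwork.numNodes]
  mono := fun _ _ _ => le_rfl
  touched := by simp [State.init]
  ptr_le := by simp [State.init]
  cur := by simp [State.init]

theorem selectable_congr {N : FlowNetwork (α ⊕ β)} {t : State (α ⊕ β)} (hf : t.flow = s.flow)
    (hp : t.parent = s.parent) (hl : ∀ x, s.parent x = none → t.label x = s.label x) {r : α ⊕ β}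
    (h : s.Selectable N var r) : t.Selectable N var r := by
  have ha : ∀ x, t.Active N x ↔ s.Active N x := by
    intro x
    unfold State.Active
    rw [hf, hp]
    constructor
    · rintro ⟨h1, h2, h3⟩
      exact ⟨h1, h2, hl x h1 ▸ h3⟩
    · rintro ⟨h1, h2, h3⟩
      exact ⟨h1, h2, (hl x h1).symm ▸ h3⟩
  refine ⟨(ha r).2 h.1, fun y hy => ?_⟩
  have h1 := h.2 y ((ha y).1 hy)
  rw [hl r h.1.1, hl y ((ha y).1 hy).1]
  exact h1

theorem Normalized.isNormalizedTree {f : α ⊕ β → α ⊕ β → ℝ≥0} {par : α ⊕ β → Option (α ⊕ β)}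
    (h : Normalized E c f par) : (bipartiteNetwork E c).IsNormalizedTree f par where
  tree := h.tree
  edges := h.edges
  root_of_unbalanced x hx := by
    by_contra hn
    exact hx (h.balanced x hn)
  out_of_tree i j _ h1 h2 := by
    left
    by_contra hf
    exact (h.flow_tree i j hf).elim h1 h2
  downward x y hy := h.down x y hy (by simp)

/-- Tree edges join the two sides, so the path alternates. The extra summand for a right starting
node makes the induction close. -/
theorem PreNormalized.length_le {f : α ⊕ β → α ⊕ β → ℝ≥0} {par : α ⊕ β → Option (α ⊕ β)}
    {X : List (α ⊕ β)} (h : PreNormalized E c f par X) (hc : ∀ e ∈ E, 1 ≤ c e.1 e.2) {x : α ⊕ β}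
    {l : List (α ⊕ β)} (hl : RootPath par x l) :
    l.length + (if x.isRight then 1 else 0) ≤ 2 * (l.filterMap Sum.getRight?).length + 1 := by
  induction hl with
  | @root x hx => rcases x with a | b <;> simp
  | @step x y l hxy hl ih =>
    rcases x with a | b
    · obtain ⟨b, rfl, -⟩ := h.neighbor_inl hc (.inl hxy)
      rw [List.filterMap_cons_none rfl]
      simp at ih ⊢
      omega
    · obtain ⟨a, rfl, -⟩ := h.neighbor_inr hc (.inl hxy)
      rw [List.filterMap_cons_some (f := Sum.getRight?) (b := b) rfl]
      simp at ih ⊢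
      omega

/-- All right nodes on the path, except possibly its root, are balanced and hence touched, which
leaves at most κ+1 right nodes. -/
theorem Normalized.depth_le {f : α ⊕ β → α ⊕ β → ℝ≥0} {par : α ⊕ β → Option (α ⊕ β)}
    (h : Normalized E c f par) (hc : ∀ e ∈ E, 1 ≤ c e.1 e.2) {x : α ⊕ β}
    {l : List (α ⊕ β)} (hl : RootPath par x l) : l.length ≤ 2 * matchingNumber E + 3 := by
  classical
  have h1 := h.length_le hc hl
  obtain ⟨l', r, hlr, -⟩ := hl.exists_root
  have h2 : (l'.filterMap Sum.getRight?).length ≤ matchingNumber E := by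
    refine le_trans ?_ (h.int.card_touched_le h.left)
    rw [← List.toFinset_card_of_nodup]
    · refine Finset.card_le_card fun b hb => ?_
      simp only [List.mem_toFinset, List.mem_filterMap, Sum.getRight?_eq_some_iff,
        exists_eq_right] at hb
      refine Finset.mem_filter.2 ⟨Finset.mem_univ _, ?_⟩
      rw [h.int.touched_iff (c := c), h.balanced]
      refine hl.parent_ne_none ?_
      rw [hlr, List.dropLast_concat]
      exact hb
    · refine List.Nodup.filterMap ?_ ?_
      · intro x y b hx hy
        simp only [Option.mem_def, Sum.getRight?_eq_some_iff] at hx hy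
        rw [hx, hy]
      · have := hl.nodup
        rw [hlr, List.nodup_append] at this
        exact this.1
  have h3 : (l.filterMap Sum.getRight?).length ≤ (l'.filterMap Sum.getRight?).length + 1 := by
    rw [hlr, List.filterMap_append, List.length_append]
    have := List.length_filterMap_le Sum.getRight? [r]
    simp only [List.length_singleton] at this
    omega
  omega

variable [DecidableEq α] [DecidableEq β]

theorem Inv.merge (h : Inv E c adj var s) (hc : ∀ e ∈ E, 1 ≤ c e.1 e.2) {x y r : α ⊕ β}
    {p q : List (α ⊕ β)} (hs : Searching (bipartiteNetwork E c) var s x r)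
    (hm : s.IsMergerArc (bipartiteNetwork E c) x y) (hp : RootPath s.parent x p)
    (hq : RootPath s.parent y q) :
    ∃ v, MergeSpec E c s.flow s.parent x y p q r v
      ((bipartiteNetwork E c).merge (p.reverse ++ q) s.flow s.parent).1
      ((bipartiteNetwork E c).merge (p.reverse ++ q) s.flow s.parent).2 := by
  -- The paths are disjoint because labels on `p` equal that of `x`, while those on `q` are at most
  -- the smaller label of `y`.
  refine h.normalized.merge hc hp hq (fun w hw hwq => ?_) hs.2.1 hs.1.1.2.1 hm.1
  have h1 := hs.label_path h.mono hp w hw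
  have h2 := hq.label_le h.mono w hwq
  have := hm.2
  omega

/-- Labels are constant along the reversed path and do not increase from `x` to its new parent `y`;
other pointers are kept or removed. -/
theorem MergeSpec.labelMono {f f' : α ⊕ β → α ⊕ β → ℝ≥0} {par par' : α ⊕ β → Option (α ⊕ β)}
    {label : α ⊕ β → ℕ} {x y r v : α ⊕ β} {p q : List (α ⊕ β)}
    (hs : MergeSpec E c f par x y p q r v f' par') (hmono : LabelMono par label)
    (hxy : label y ≤ label x) (hp : ∀ w ∈ p, label w = label x) : LabelMono par' label := by
  intro w z hz
  by_cases hw : w ∈ p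
  · rcases hs.parent_mem w hw with h1 | ⟨rfl, h2⟩ | ⟨z', h1, -, h2⟩
    · simp [h1.1] at hz
    · rw [h2] at hz
      cases hz
      exact hxy
    · rw [h2] at hz
      cases hz
      rw [hp w hw, hp z h1]
  · by_cases hv : w = v
    · rw [hv, hs.parent_v] at hz
      simp at hz
    · exact hmono w z (hs.parent_off w hw hv ▸ hz)

theorem Inv.step (h : Inv E c adj var s) (hc : ∀ e ∈ E, 1 ≤ c e.1 e.2)
    (hstep : Step (bipartiteNetwork E c) adj var s s') : Inv E c adj var s' := by
  cases hstep with
  | @select x hcur hx hgap =>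
    exact ⟨h.normalized, h.label_pos, h.label_le, h.mono, h.touched, h.ptr_le, by
      rintro x' ⟨⟩
      exact ⟨x, hx, .self hx.1.1, rfl, hgap⟩⟩
  | @gap x hcur hx hne hgap =>
    have hbr : ∀ y, y ∈ s.branch x ↔ InBranch s.parent x y := by simp [State.branch]
    refine ⟨h.normalized, fun y => ?_, fun y => ?_, fun y z hz => ?_, fun b hb => ?_, h.ptr_le, ?_⟩
    · dsimp only
      split_ifs
      · simp [FlowNetwork.numNodes]
      · exact h.label_pos y
    · dsimp only
      split_ifs
      · exact le_rfl
      · exact h.label_le y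
    · dsimp only at hz ⊢
      have : y ∈ s.branch x ↔ z ∈ s.branch x := by
        rw [hbr, hbr]
        exact ⟨fun h => h.parent hz, fun h => h.child hz⟩
      simp only [this]
      split_ifs
      · exact le_rfl
      · exact h.mono y z hz
    · dsimp only at hb ⊢
      split_ifs at hb with h1
      · exact h.normalized.touched_of_inBranch ((hbr _).1 h1) hx.1.2.1.le
      · exact h.touched b hb
    · intro y hy
      dsimp only at hy
      simp [hcur] at hy
  | @scanMiss x y hcur hl hy hm =>
    refine ⟨h.normalized, h.label_pos, h.label_le, h.mono, h.touched, fun z => ?_, h.cur⟩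
    dsimp only
    by_cases hz : z = x
    · subst hz
      have := (List.getElem?_eq_some_iff.1 hy).1
      simpa using this
    · simpa [hz] using h.ptr_le z
  | @scanMerge x y p q hcur hl hy hm hp hq =>
    obtain ⟨r, hr⟩ := h.cur x hcur
    obtain ⟨v, hv⟩ := h.merge hc hr hm hp hq
    refine ⟨hv.normalized, h.label_pos, h.label_le,
      hv.labelMono h.mono (Nat.le.intro hm.2) (hr.label_path h.mono hp),
      fun b hb => hv.touched h.normalized.int hr.1.1.2.1 (h.touched b hb), fun z => ?_, by simp⟩
    dsimp only
    by_cases hz : z = x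
    · subst hz
      have := (List.getElem?_eq_some_iff.1 hy).1
      simpa using this
    · simpa [hz] using h.ptr_le z
  | @descend x y hcur hy hl =>
    refine ⟨h.normalized, h.label_pos, h.label_le, h.mono, h.touched, h.ptr_le, ?_⟩
    rintro y' ⟨⟩
    obtain ⟨r, h1, h2, h3, h4⟩ := h.cur x hcur
    exact ⟨r, h1, h2.child hy, hl.trans h3, h4⟩
  | @relabel x hcur hptr hch =>
    obtain ⟨r, hr⟩ := h.cur x hcur
    have hlt := hr.label_lt
    refine ⟨h.normalized, fun z => ?_, fun z => ?_, fun z w hz => ?_, fun b hb => ?_, fun z => ?_, ?_⟩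
    · by_cases hz : z = x
      · simp [hz]
      · simpa [hz] using h.label_pos z
    · by_cases hz : z = x
      · simpa [hz] using hlt
      · simpa [hz] using h.label_le z
    · dsimp only at hz ⊢
      have h1 := h.mono z w hz
      by_cases hwx : w = x
      · subst hwx
        by_cases hzw : z = w
        · simp [hzw]
        · simpa [hzw] using hch z hz
      · by_cases hzx : z = x
        · subst hzx
          simp only [Function.update_of_ne hwx, Function.update_self]
          omega
        · simpa [hwx, hzx] using h1
    -- The relabeled node belongs to a branch whose root has positive excess, so if it is a right
    -- node it is touched.
    · dsimp only at hb ⊢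
      by_cases hbx : Sum.inr b = x
      · exact h.normalized.touched_of_inBranch (hbx ▸ hr.2.1) hr.1.1.2.1.le
      · exact h.touched b (by simpa [hbx] using hb)
    · by_cases hz : z = x
      · simp [hz]
      · simpa [hz] using h.ptr_le z
    · intro z hz
      dsimp only at hz
      have hzx : z ≠ x := by
        rintro rfl
        exact h.normalized.no_two_cycle hz hz
      have hrx : r ≠ x := by
        rintro rfl
        simp [hr.1.1.1] at hz
      refine ⟨r, ?_, hr.2.1.parent hz, ?_, ?_⟩
      · refine selectable_congr (s := s) ?_ ?_ (fun w hw => ?_) hr.1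
        · rfl
        · rfl
        dsimp only
        rw [Function.update_of_ne]
        rintro rfl
        simp [hw] at hz
      · dsimp only
        rw [Function.update_of_ne hzx, Function.update_of_ne hrx, hr.label_parent h.mono hz]
        exact hr.2.2.1
      · dsimp only
        rw [Function.update_of_ne hrx]
        refine hr.2.2.2.imp_right fun ⟨y, hy⟩ => ⟨y, ?_⟩
        rw [Function.update_of_ne, hy]
        rintro rfl
        have := hr.2.2.1
        omega

theorem Inv.of_reachable (hc : ∀ e ∈ E, 1 ≤ c e.1 e.2)
    (h : Reachable (bipartiteNetwork E c) adj var s) : Inv E c adj var s := by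
  induction h with
  | refl => exact inv_init
  | tail _ hstep ih => exact ih.step hc hstep

end invariant

/-! ### Counting operations -/

section counting

variable {α : Type u} {β : Type v} [Fintype α] [Fintype β] {E : Finset (α × β)}
  {c : α → β → ℝ≥0∞} {adj : α ⊕ β → List (α ⊕ β)} {var : Variant} {s s' : State (α ⊕ β)} {D : ℕ}

/-- All labels other than the number of nodes are at most `D`. -/
def LabelBound (E : Finset (α × β)) (c : α → β → ℝ≥0∞) (D : ℕ) (s : State (α ⊕ β)) : Prop :=
  ∀ x, s.label x ≤ D ∨ s.label x = (bipartiteNetwork E c).numNodes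

/-- An upper bound for the number of scans, where at most `B x` arcs are scanned per label of `x`. -/
def scanPotential (D : ℕ) (B : α ⊕ β → ℕ) (s : State (α ⊕ β)) : ℕ :=
  ∑ x, (min (s.label x) (D + 1) * B x + s.ptr x)

/-- The number of relabelings of single nodes. -/
def relabelPotential (D : ℕ) (s : State (α ⊕ β)) : ℕ :=
  ∑ x, (min (s.label x) (D + 1) - 1)

open Classical in
/-- The sum of the labels of the active roots. -/
noncomputable def activePotential (N : FlowNetwork (α ⊕ β)) (s : State (α ⊕ β)) : ℕ :=
  ∑ x, if s.Active N x then s.label x else 0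

open Classical in
/-- The nodes of the branches whose roots have the largest label. -/
noncomputable def finished (N : FlowNetwork (α ⊕ β)) (s : State (α ⊕ β)) : Finset (α ⊕ β) :=
  Finset.univ.filter fun y => ∃ r, InBranch s.parent r y ∧ s.label r = N.numNodes

theorem mem_finished {N : FlowNetwork (α ⊕ β)} {y : α ⊕ β} :
    y ∈ finished N s ↔ ∃ r, InBranch s.parent r y ∧ s.label r = N.numNodes := by
  simp [finished]

theorem sum_update_le {g g' : α ⊕ β → ℕ} {x : α ⊕ β} {k : ℕ} (h : ∀ y, y ≠ x → g y ≤ g' y)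
    (hx : g x + k ≤ g' x) : ∑ y, g y + k ≤ ∑ y, g' y := by
  classical
  rw [← Finset.add_sum_erase _ _ (Finset.mem_univ x),
    ← Finset.add_sum_erase _ g' (Finset.mem_univ x)]
  have := Finset.sum_le_sum (s := Finset.univ.erase x) fun y hy => h y (Finset.ne_of_mem_erase hy)
  omega

theorem scanPotential_mono {B B' : α ⊕ β → ℕ} (hl : ∀ x, s.label x ≤ s'.label x)
    (hB : ∀ x, B x ≤ B' x) (hp : s.ptr = s'.ptr) :
    scanPotential D B s ≤ scanPotential D B' s' := by
  refine Finset.sum_le_sum fun x _ => ?_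
  rw [hp]
  exact Nat.add_le_add_right (Nat.mul_le_mul (min_le_min_right _ (hl x)) (hB x)) _

/-- At most `D + 1` counted labels per node, plus one more pass for the current pointer. -/
theorem scanPotential_le {B : α ⊕ β → ℕ} (hp : ∀ x, s.ptr x ≤ B x) :
    scanPotential D B s ≤ (D + 2) * ∑ x, B x := by
  rw [Finset.mul_sum]
  refine Finset.sum_le_sum fun x _ => ?_
  have := Nat.mul_le_mul_right (B x) (min_le_right (s.label x) (D + 1))
  have := hp x
  linarith

/-- Untouched right nodes still have label 1 and contribute nothing, which leaves n₁+κ nodes. -/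
theorem Inv.relabelPotential_le (h : Inv E c adj var s) :
    relabelPotential D s ≤ (Fintype.card α + matchingNumber E) * D := by
  classical
  unfold relabelPotential
  rw [Fintype.sum_sum_type, add_mul]
  refine Nat.add_le_add ?_ ?_
  · rw [← smul_eq_mul, ← Finset.card_univ, ← Finset.sum_const]
    exact Finset.sum_le_sum fun x _ => by omega
  · refine le_trans ?_ (Nat.mul_le_mul_right D (h.normalized.int.card_touched_le h.normalized.left))
    rw [← smul_eq_mul, ← Finset.sum_const, Finset.sum_filter]
    refine Finset.sum_le_sum fun b _ => ?_
    split_ifs with hb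
    · omega
    · have := mt (h.touched b) hb
      omega

theorem Inv.card_finished_le (h : Inv E c adj var s) :
    (finished (bipartiteNetwork E c) s).card ≤ Fintype.card α + matchingNumber E := by
  classical
  refine le_trans ?_
    (Nat.add_le_add_left (h.normalized.int.card_touched_le h.normalized.left) _)
  rw [← Finset.card_univ, ← Finset.card_disjSum]
  refine Finset.card_le_card fun y hy => ?_
  obtain ⟨r, hr, hl⟩ := mem_finished.1 hy
  rcases y with a | b
  · simp
  · have h1 := hr.label_le h.mono
    simp only [Finset.inr_mem_disjSum, Finset.mem_filter, Finset.mem_univ, true_and]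
    refine h.touched b (lt_of_lt_of_le ?_ h1)
    rw [hl]
    simp [FlowNetwork.numNodes]

theorem LabelBound.le_of_lt (h : LabelBound E c D s) {x : α ⊕ β}
    (hx : s.label x < (bipartiteNetwork E c).numNodes) : s.label x ≤ D :=
  (h x).resolve_right hx.ne

theorem relabelPotential_mono (hl : ∀ x, s.label x ≤ s'.label x) :
    relabelPotential D s ≤ relabelPotential D s' :=
  Finset.sum_le_sum fun x _ => Nat.sub_le_sub_right (min_le_min_right _ (hl x)) 1

theorem activePotential_mono {N : FlowNetwork (α ⊕ β)}
    (h : ∀ x, s.Active N x → s'.Active N x ∧ s.label x ≤ s'.label x) :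
    activePotential N s ≤ activePotential N s' := by
  refine Finset.sum_le_sum fun x _ => ?_
  split_ifs with h1 h2
  · exact (h x h1).2
  · exact absurd (h x h1).1 h2
  · omega
  · omega

theorem finished_mono {N : FlowNetwork (α ⊕ β)} (hp : s'.parent = s.parent)
    (hl : ∀ x, s.label x = N.numNodes → s'.label x = N.numNodes) :
    (finished N s).card ≤ (finished N s').card := by
  refine Finset.card_le_card fun y hy => ?_
  obtain ⟨r, hr, h⟩ := mem_finished.1 hy
  exact mem_finished.2 ⟨r, hp ▸ hr, hl r h⟩

variable [DecidableEq α] [DecidableEq β]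

theorem Inv.label_mono (h : Inv E c adj var s)
    (hstep : Step (bipartiteNetwork E c) adj var s s') (x : α ⊕ β) : s.label x ≤ s'.label x := by
  cases hstep with
  | gap =>
    dsimp only
    split_ifs
    · exact h.label_le x
    · exact le_rfl
  | @relabel y =>
    dsimp only
    by_cases hx : x = y
    · simp [hx]
    · simp [hx]
  | _ => exact le_rfl

theorem Inv.touched_mono (h : Inv E c adj var s) (hc : ∀ e ∈ E, 1 ≤ c e.1 e.2)
    (hstep : Step (bipartiteNetwork E c) adj var s s') {b : β} (hb : Touched s.flow b) :
    Touched s'.flow b := by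
  cases hstep with
  | scanMerge hcur hl hy hm hp hq =>
    obtain ⟨r, hr⟩ := h.cur _ hcur
    obtain ⟨v, hv⟩ := h.merge hc hr hm hp hq
    exact hv.touched h.normalized.int hr.1.1.2.1 hb
  | _ => exact hb

/-- A scan advances one pointer; a relabeling resets a pointer of size at most `B x` but adds that
much through the label. `B` may grow to `B'`, as the bound used later depends on the touched nodes
of the state. -/
theorem Inv.scans_step (h : Inv E c adj var s) (hD : LabelBound E c D s) {B B' : α ⊕ β → ℕ}
    (hptrB : ∀ x, s.ptr x ≤ B x) (hB : ∀ x, B x ≤ B' x)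
    (hstep : Step (bipartiteNetwork E c) adj var s s')
    (hs : s.scans ≤ scanPotential D B s) : s'.scans ≤ scanPotential D B' s' := by
  have hl := h.label_mono hstep
  have key : ∀ t : State (α ⊕ β), (∀ x, s.label x ≤ t.label x) → s.ptr = t.ptr →
      t.scans = s.scans → t.scans ≤ scanPotential D B' t := fun t h1 h2 h3 =>
    h3 ▸ hs.trans (scanPotential_mono h1 hB h2)
  have key' : ∀ (t : State (α ⊕ β)) x, (∀ x, s.label x ≤ t.label x) →
      t.ptr = Function.update s.ptr x (s.ptr x + 1) →
      t.scans = s.scans + 1 → t.scans ≤ scanPotential D B' t := by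
    intro t x h1 h2 h3
    rw [h3]
    refine (Nat.add_le_add_right hs 1).trans (sum_update_le (x := x) (fun y hy => ?_) ?_)
    · rw [h2, Function.update_of_ne hy]
      exact Nat.add_le_add_right (Nat.mul_le_mul (min_le_min_right _ (h1 y)) (hB y)) _
    · rw [h2, Function.update_self, add_assoc]
      exact Nat.add_le_add_right (Nat.mul_le_mul (min_le_min_right _ (h1 x)) (hB x)) _
  cases hstep with
  | select => exact key _ hl rfl rfl
  | gap => exact key _ hl rfl rfl
  | descend => exact key _ hl rfl rfl
  | scanMiss => exact key' _ _ hl rfl rfl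
  | scanMerge => exact key' _ _ hl rfl rfl
  | @relabel x hcur hptr hch =>
    obtain ⟨r, hr⟩ := h.cur x hcur
    -- The old label is at most `D`, so the cap `D + 1` does not swallow the increment.
    have hx := hD.le_of_lt hr.label_lt
    refine hs.trans (sum_update_le (x := x) (k := 0) (fun y hy => ?_) ?_)
    · dsimp only
      rw [Function.update_of_ne hy, Function.update_of_ne hy]
      exact Nat.add_le_add_right (Nat.mul_le_mul_left _ (hB y)) _
    · dsimp only
      rw [Function.update_self, Function.update_self, min_eq_left (by omega),
        min_eq_left (by omega)]
      have h1 := Nat.mul_le_mul_left (s.label x + 1) (hB x)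
      have h2 := hptrB x
      linarith

/-- The bound for the work, where `P` bounds the depth, and `K` and `J` are the weights of the active
potential and of the scans. -/
structure WorkBound (E : Finset (α × β)) (c : α → β → ℝ≥0∞) (P K J C D : ℕ)
    (s : State (α ⊕ β)) : Prop where
  none : s.cur = none → s.work + K * activePotential (bipartiteNetwork E c) s + P + 1 ≤
    J * s.scans + (3 + K) * relabelPotential D s + (finished (bipartiteNetwork E c) s).card + C
  some : ∀ x p, s.cur = some x → RootPath s.parent x p →
    s.work + K * activePotential (bipartiteNetwork E c) s + P ≤
      J * s.scans + (3 + K) * relabelPotential D s + (finished (bipartiteNetwork E c) s).card + C +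
        p.length

/-- With excess at most 1 the old root becomes inactive, and at most one new active root arises,
namely `v`, whose label is smaller. -/
theorem MergeSpec.activePotential_lt {f' : α ⊕ β → α ⊕ β → ℝ≥0}
    {par' : α ⊕ β → Option (α ⊕ β)} {x y r v : α ⊕ β} {p q : List (α ⊕ β)}
    (hs : MergeSpec E c s.flow s.parent x y p q r v f' par') (hn : Normalized E c s.flow s.parent)
    (hr : s.Active (bipartiteNetwork E c) r) (he : (bipartiteNetwork E c).excess s.flow r ≤ 1)
    (hv : s.label v < s.label r) {t : State (α ⊕ β)} (hf : t.flow = f')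
    (hl : t.label = s.label) :
    activePotential (bipartiteNetwork E c) t + 1 ≤ activePotential (bipartiteNetwork E c) s := by
  classical
  have hrv : r ≠ v := by
    rintro rfl
    exact lt_irrefl _ hv
  have hact : ∀ w, w ≠ v → t.Active (bipartiteNetwork E c) w →
      s.Active (bipartiteNetwork E c) w ∧ w ≠ r := by
    rintro w hw ⟨h1, h2, h3⟩
    rw [hf, hs.excess, if_neg hw] at h2
    have hwr : w ≠ r := by
      rintro rfl
      simp at h2
      linarith
    rw [if_neg hwr] at h2
    simp only [sub_zero, add_zero] at h2
    refine ⟨⟨?_, h2, hl ▸ h3⟩, hwr⟩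
    by_contra hne
    rw [hn.balanced w hne] at h2
    exact lt_irrefl _ h2
  unfold activePotential
  rw [← Finset.add_sum_erase _ _ (Finset.mem_univ r),
    ← Finset.add_sum_erase (a := r) _ (fun w => if s.Active (bipartiteNetwork E c) w then s.label w
      else 0) (Finset.mem_univ r), if_pos hr, if_neg]
  · have hv' : v ∈ Finset.univ.erase r := Finset.mem_erase.2 ⟨hrv.symm, Finset.mem_univ _⟩
    rw [← Finset.add_sum_erase _ _ hv',
      ← Finset.add_sum_erase _ (fun w => if s.Active (bipartiteNetwork E c) w then s.label w
      else 0) hv']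
    have h1 : ∑ w ∈ (Finset.univ.erase r).erase v,
        (if t.Active (bipartiteNetwork E c) w then t.label w else 0) ≤
        ∑ w ∈ (Finset.univ.erase r).erase v,
        (if s.Active (bipartiteNetwork E c) w then s.label w else 0) := by
      refine Finset.sum_le_sum fun w hw => ?_
      rw [hl]
      split_ifs with h1 h2
      · exact le_rfl
      · exact absurd (hact w (Finset.ne_of_mem_erase hw) h1).1 h2
      · omega
      · omega
    have h2 : (if t.Active (bipartiteNetwork E c) v then t.label v else 0) ≤ s.label v := by
      rw [hl]
      split_ifs <;> omega
    omega
  · exact fun h => (hact r hrv h).2 rfl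

/-- Nodes in finished branches have label at least n, whereas those of `p` and the node `v` have
smaller labels, so the merger leaves these branches intact. -/
theorem Inv.finished_merge (h : Inv E c adj var s) {f' : α ⊕ β → α ⊕ β → ℝ≥0}
    {par' : α ⊕ β → Option (α ⊕ β)} {x y r v : α ⊕ β} {p q : List (α ⊕ β)}
    (hr : Searching (bipartiteNetwork E c) var s x r)
    (hp : RootPath s.parent x p)
    (hs : MergeSpec E c s.flow s.parent x y p q r v f' par')
    (hv : s.label v < s.label x) {t : State (α ⊕ β)} (ht : t.parent = par')
    (hl : t.label = s.label) :
    (finished (bipartiteNetwork E c) s).card ≤ (finished (bipartiteNetwork E c) t).card := by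
  refine Finset.card_le_card fun w hw => ?_
  obtain ⟨r', hr', hn⟩ := mem_finished.1 hw
  refine mem_finished.2 ⟨r', ?_, hl ▸ hn⟩
  obtain ⟨l, hl'⟩ := hr'.exists_rootPath
  refine .of_rootPath (l := l) (hl'.congr fun z hz => ?_)
  rw [ht]
  have h1 := (hr'.of_mem hl' hz).label_le h.mono
  have h2 := hr.label_lt
  refine hs.parent_off z (fun hzp => ?_) ?_
  · have := hr.label_path h.mono hp z hzp
    omega
  · rintro rfl
    omega

/-- The length of the search path serves as credit for descents. A relabeling pays for itself, the
credit lost in moving up and, at a root, the `K` by which the weighted active potential may rise: `3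
+ K` in total. A merger consumes at most `3 * P + 2`: two paths, the forfeited search credit and two
single units. It is paid by its scan through `J` or by the drop of the active potential through `K`.
-/
theorem Inv.work_step (h : Inv E c adj var s) (hc : ∀ e ∈ E, 1 ≤ c e.1 e.2)
    (hD : LabelBound E c D s) {P K J C : ℕ} (hP : ∀ x l, RootPath s.parent x l → l.length ≤ P)
    (hKJ : K = 0 ∧ 3 * P + 2 ≤ J ∨ 3 * P + 2 ≤ K ∧ 1 ≤ J ∧
      ∀ x, (bipartiteNetwork E c).excess s.flow x ≤ 1)
    (hstep : Step (bipartiteNetwork E c) adj var s s')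
    (hw : WorkBound E c P K J C D s) : WorkBound E c P K J C D s' := by
  have hmono := h.label_mono hstep
  have hR := relabelPotential_mono (D := D) hmono
  have hR' := Nat.mul_le_mul_left (3 + K) hR
  cases hstep with
  | @select x hcur hx hgap =>
    have h1 := hw.none hcur
    refine ⟨by simp, fun x' p _ _ => ?_⟩
    change s.work + 1 + K * activePotential (bipartiteNetwork E c) s + P ≤ J * s.scans +
      (3 + K) * relabelPotential D s + (finished (bipartiteNetwork E c) s).card + C + p.length
    omega
  | @gap x hcur hx hne hgap =>
    have h1 := hw.none hcur
    have hbr : ∀ y, y ∈ s.branch x ↔ InBranch s.parent x y := by simp [State.branch]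
    refine ⟨fun _ => ?_, fun x' p hx' _ => by simp [hcur] at hx'⟩
    generalize hs' : (State.mk _ _ _ _ _ _ _ : State (α ⊕ β)) = t at hR' ⊢
    have ht1 : t.work = s.work + (s.branch x).card := by rw [← hs']
    have ht2 : t.scans = s.scans := by rw [← hs']
    have ht3 : t.parent = s.parent := by rw [← hs']
    have ht4 : t.flow = s.flow := by rw [← hs']
    have ht5 : ∀ y, y ∈ s.branch x → t.label y = (bipartiteNetwork E c).numNodes := by
      intro y hy
      rw [← hs']
      dsimp only
      rw [if_pos hy]
    have ht6 : ∀ y, y ∉ s.branch x → t.label y = s.label y := by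
      intro y hy
      rw [← hs']
      dsimp only
      rw [if_neg hy]
    have hact : activePotential (bipartiteNetwork E c) t ≤
        activePotential (bipartiteNetwork E c) s := by
      refine activePotential_mono fun y hy => ?_
      obtain ⟨hy1, hy2, hy3⟩ := hy
      by_cases hyb : y ∈ s.branch x
      · rw [ht5 y hyb] at hy3
        exact absurd hy3 (lt_irrefl _)
      · rw [ht6 y hyb] at hy3
        exact ⟨⟨ht3 ▸ hy1, ht4 ▸ hy2, hy3⟩, (ht6 y hyb).le⟩
    -- The root of the relabeled branch had a label below n, so all its nodes are newly finished and
    -- pay for the gap relabeling.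
    have hfin : (finished (bipartiteNetwork E c) s).card + (s.branch x).card ≤
        (finished (bipartiteNetwork E c) t).card := by
      rw [← Finset.card_union_of_disjoint]
      · refine Finset.card_le_card fun y hy => ?_
        rw [mem_finished, ht3]
        rcases Finset.mem_union.1 hy with hy | hy
        · obtain ⟨r, hr, hrl⟩ := mem_finished.1 hy
          refine ⟨r, hr, ?_⟩
          by_cases hrb : r ∈ s.branch x
          · exact ht5 r hrb
          · rw [ht6 r hrb, hrl]
        · exact ⟨x, (hbr y).1 hy, ht5 x ((hbr x).2 (.self hx.1.1))⟩
      · rw [Finset.disjoint_left]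
        intro y hy hyb
        obtain ⟨r, hr, hrl⟩ := mem_finished.1 hy
        obtain rfl := hr.unique ((hbr y).1 hyb)
        have := hx.1.2.2
        omega
    have := Nat.mul_le_mul_left K hact
    rw [ht1, ht2]
    omega
  | @scanMiss x y hcur hl hy hm =>
    refine ⟨by simp [hcur], fun x' p hx' hp => ?_⟩
    have h1 := hw.some x' p hx' hp
    change s.work + 1 + K * activePotential (bipartiteNetwork E c) s + P ≤ J * (s.scans + 1) +
      (3 + K) * relabelPotential D s + (finished (bipartiteNetwork E c) s).card + C + p.length
    rw [mul_add]
    omega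
  | @scanMerge x y p q hcur hl hy hm hp hq =>
    refine ⟨fun _ => ?_, by simp⟩
    obtain ⟨r, hr⟩ := h.cur x hcur
    obtain ⟨v, hv⟩ := h.merge hc hr hm hp hq
    have h1 := hw.some x p hcur hp
    have h2 := hP _ _ hp
    have h3 := hP _ _ hq
    have hvl : s.label v < s.label x := by
      have := hq.label_le h.mono v hv.mem
      have := hm.2
      omega
    generalize hs' : (State.mk _ _ _ _ _ _ _ : State (α ⊕ β)) = t at hR' ⊢
    have ht1 : t.work = s.work + 1 + (p.reverse ++ q).length := by rw [← hs']
    have ht2 : t.scans = s.scans + 1 := by rw [← hs']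
    have ht3 := h.finished_merge hr hp hv hvl (t := t) (by rw [← hs']) (by rw [← hs'])
    have ht4 : (bipartiteNetwork E c).excess s.flow r ≤ 1 →
        activePotential (bipartiteNetwork E c) t + 1 ≤ activePotential (bipartiteNetwork E c) s :=
      fun he => hv.activePotential_lt h.normalized hr.1.1 he (hr.2.2.1 ▸ hvl) (by rw [← hs'])
        (by rw [← hs'])
    rw [ht1, ht2, List.length_append, List.length_reverse, mul_add]
    rcases hKJ with ⟨rfl, hJ⟩ | ⟨hK, hJ, he⟩
    · simp only [zero_mul, add_zero, mul_one] at *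
      omega
    · have := Nat.mul_le_mul_left K (ht4 (he r))
      rw [mul_add] at this
      omega
  | @descend x y hcur hy hl =>
    refine ⟨by simp, fun x' p hx' hp => ?_⟩
    cases hx'
    obtain ⟨p', rfl, hp'⟩ := RootPath.step' hp hy
    have h1 := hw.some x p' hcur hp'
    change s.work + 1 + K * activePotential (bipartiteNetwork E c) s + P ≤ J * s.scans +
      (3 + K) * relabelPotential D s + (finished (bipartiteNetwork E c) s).card + C +
        (p'.length + 1)
    omega
  | @relabel x hcur hptr hch =>
    obtain ⟨r, hr⟩ := h.cur x hcur
    have hx := hD.le_of_lt hr.label_lt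
    have hx1 := h.label_pos x
    have hxn := hr.label_lt
    have hwx := fun p => hw.some x p hcur
    generalize hs' : (State.mk _ _ _ _ _ _ _ : State (α ⊕ β)) = t
    have ht1 : t.work = s.work + 1 := by rw [← hs']
    have ht2 : t.scans = s.scans := by rw [← hs']
    have ht3 : t.parent = s.parent := by rw [← hs']
    have ht4 : t.flow = s.flow := by rw [← hs']
    have ht5 : t.cur = s.parent x := by rw [← hs']
    have ht6 : t.label = Function.update s.label x (s.label x + 1) := by rw [← hs']
    have hRt : relabelPotential D s + 1 ≤ relabelPotential D t := by
      refine sum_update_le (x := x) (fun y hy => ?_) ?_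
      · rw [ht6, Function.update_of_ne hy]
      · rw [ht6, Function.update_self, min_eq_left (by omega), min_eq_left (by omega)]
        omega
    have hft : (finished (bipartiteNetwork E c) s).card ≤
        (finished (bipartiteNetwork E c) t).card := by
      refine finished_mono ht3 fun y hy => ?_
      rw [ht6, Function.update_of_ne, hy]
      rintro rfl
      omega
    have hact : ∀ y, y ≠ x → t.Active (bipartiteNetwork E c) y →
        s.Active (bipartiteNetwork E c) y ∧ t.label y = s.label y := by
      rintro y hy ⟨h1, h2, h3⟩
      rw [ht6, Function.update_of_ne hy] at h3 ⊢
      exact ⟨⟨ht3 ▸ h1, ht4 ▸ h2, h3⟩, rfl⟩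
    have hRt' := Nat.mul_le_mul_left (3 + K) hRt
    rw [mul_add] at hRt'
    refine ⟨fun hn => ?_, fun z p hz hp => ?_⟩
    · have hxr : s.parent x = none := ht5 ▸ hn
      have hrx := hr.2.1.eq_of_root hxr
      have h1 := hwx [x] (.root hxr)
      have hat : activePotential (bipartiteNetwork E c) t ≤
          activePotential (bipartiteNetwork E c) s + 1 := by
        classical
        unfold activePotential
        rw [← Finset.add_sum_erase _ _ (Finset.mem_univ x),
          ← Finset.add_sum_erase (a := x) _ (fun w => if s.Active (bipartiteNetwork E c) w
            then s.label w else 0) (Finset.mem_univ x)]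
        have h0 : (if s.Active (bipartiteNetwork E c) x then s.label x else 0) = s.label x :=
          if_pos (by rw [← hrx]; exact hr.1.1)
        have h1 : ∑ w ∈ Finset.univ.erase x,
            (if t.Active (bipartiteNetwork E c) w then t.label w else 0) ≤
            ∑ w ∈ Finset.univ.erase x,
            (if s.Active (bipartiteNetwork E c) w then s.label w else 0) := by
          refine Finset.sum_le_sum fun w hw => ?_
          split_ifs with h1 h2
          · exact (hact w (Finset.ne_of_mem_erase hw) h1).2.le
          · exact absurd (hact w (Finset.ne_of_mem_erase hw) h1).1 h2
          · omega
          · omega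
        have h2 : (if t.Active (bipartiteNetwork E c) x then t.label x else 0) ≤
            s.label x + 1 := by
          split_ifs
          · rw [ht6, Function.update_self]
          · omega
        omega
      have := Nat.mul_le_mul_left K hat
      rw [mul_add] at this
      rw [ht1, ht2]
      simp only [List.length_singleton] at h1
      omega
    · rw [ht3] at hp
      rw [ht5] at hz
      have h1 := hwx (x :: p) (.step hz hp)
      have hat : activePotential (bipartiteNetwork E c) t ≤
          activePotential (bipartiteNetwork E c) s := by
        refine activePotential_mono fun y hy => ?_
        have hyx : y ≠ x := by
          rintro rfl
          have := hy.1
          rw [ht3, hz] at this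
          simp at this
        exact ⟨(hact y hyx hy).1, (hact y hyx hy).2.le⟩
      have := Nat.mul_le_mul_left K hat
      rw [ht1, ht2]
      simp only [List.length_cons] at h1
      omega

end counting

/-! ### The highest-label variant -/

section highest

variable {α : Type u} {β : Type v} [Fintype α] [Fintype β] {E : Finset (α × β)}
  {c : α → β → ℝ≥0∞} {adj : α ⊕ β → List (α ⊕ β)} {var : Variant} {s s' : State (α ⊕ β)}

/-- Distinct labels need distinct nodes. Label 1 is left out because untouched nodes may carry it.
-/
theorem le_card_of_labels {V : Type*} {label : V → ℕ} {T : Finset V} {k : ℕ}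
    (h : ∀ j, 2 ≤ j → j < k → ∃ y ∈ T, label y = j) : k ≤ T.card + 2 := by
  have h1 : Finset.Ico 2 k ⊆ T.image label := by
    intro j hj
    rw [Finset.mem_Ico] at hj
    obtain ⟨y, hy, hl⟩ := h j hj.1 hj.2
    exact Finset.mem_image.2 ⟨y, hy, hl⟩
  have h2 := (Finset.card_le_card h1).trans Finset.card_image_le
  rw [Nat.card_Ico] at h2
  omega

variable [DecidableEq α]

/-- Invariants of the highest-label variant. -/
structure HighInv (E : Finset (α × β)) (c : α → β → ℝ≥0∞) (s : State (α ⊕ β)) : Prop where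
  occupied : ∀ r, s.Active (bipartiteNetwork E c) r → ∀ j, 1 ≤ j → j + 1 < s.label r →
    ∃ y, s.label y = j
  isolated : ∀ a a', a ∉ E.image Prod.fst → a' ∉ E.image Prod.fst → 1 < s.label (.inl a) →
    s.label (.inl a) < (bipartiteNetwork E c).numNodes → 1 < s.label (.inl a') →
    s.label (.inl a') < (bipartiteNetwork E c).numNodes → a = a'
  bound : LabelBound E c ((E.image Prod.fst).card + matchingNumber E + 4) s

theorem Inv.isolated_root (h : Inv E c adj var s) (hc : ∀ e ∈ E, 1 ≤ c e.1 e.2) {a : α}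
    (ha : a ∉ E.image Prod.fst) : s.parent (.inl a) = none := by
  by_contra hne
  obtain ⟨y, hy⟩ := Option.ne_none_iff_exists'.1 hne
  obtain ⟨b, -, he⟩ := h.normalized.neighbor_inl hc (.inl hy)
  exact ha (Finset.mem_image.2 ⟨_, he, rfl⟩)

/-- A left node without edges can never get rid of its unit nor acquire a parent. -/
theorem Inv.isolated_active (h : Inv E c adj var s) (hc : ∀ e ∈ E, 1 ≤ c e.1 e.2) {a : α}
    (ha : a ∉ E.image Prod.fst) (hl : s.label (.inl a) < (bipartiteNetwork E c).numNodes) :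
    s.Active (bipartiteNetwork E c) (.inl a) := by
  refine ⟨h.isolated_root hc ha, ?_, hl⟩
  rw [h.normalized.int.excess_inl]
  have : ∀ b, s.flow (.inl a) (.inr b) = 0 := by
    intro b
    by_contra hne
    exact ha (Finset.mem_image.2 ⟨_, h.normalized.int.mem hne, rfl⟩)
  simp [this]

theorem highInv_init : HighInv E c (State.init (α ⊕ β)) where
  occupied r _ j hj hl := by simp [State.init] at hl
  isolated a a' _ _ h := by simp [State.init] at h
  bound x := .inl (by simp [State.init])

variable [DecidableEq β]

theorem MergeSpec.active_of_ne {f' : α ⊕ β → α ⊕ β → ℝ≥0}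
    {par' : α ⊕ β → Option (α ⊕ β)} {x y r v w : α ⊕ β} {p q : List (α ⊕ β)}
    (hs : MergeSpec E c s.flow s.parent x y p q r v f' par') (hn : Normalized E c s.flow s.parent)
    (hw : w ≠ v) (he : 0 < (bipartiteNetwork E c).excess f' w)
    (hl : s.label w < (bipartiteNetwork E c).numNodes) : s.Active (bipartiteNetwork E c) w := by
  have h2 : 0 < (bipartiteNetwork E c).excess s.flow w := by
    rw [hs.excess, if_neg hw] at he
    split_ifs at he <;> linarith
  refine ⟨?_, h2, hl⟩
  by_contra hne
  rw [hn.balanced w hne] at h2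
  exact lt_irrefl _ h2

/-- The selected root bounds all active labels. A search starts only if the label just below is
present, so at a relabeling all smaller labels are occupied. Gap relabeling removes only labels at
least that of its root, which is maximal among active ones. -/
theorem HighInv.step (hh : HighInv E c s) (h : Inv E c adj .highest s)
    (hc : ∀ e ∈ E, 1 ≤ c e.1 e.2)
    (hstep : Step (bipartiteNetwork E c) adj .highest s s') : HighInv E c s' := by
  cases hstep with
  | select => exact ⟨hh.occupied, hh.isolated, hh.bound⟩
  | scanMiss => exact ⟨hh.occupied, hh.isolated, hh.bound⟩
  | descend => exact ⟨hh.occupied, hh.isolated, hh.bound⟩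
  | @gap x hcur hx hne hgap =>
    have hbr : ∀ y, y ∈ s.branch x ↔ InBranch s.parent x y := by simp [State.branch]
    generalize hs' : (State.mk _ _ _ _ _ _ _ : State (α ⊕ β)) = t
    have ht3 : t.parent = s.parent := by rw [← hs']
    have ht4 : t.flow = s.flow := by rw [← hs']
    have ht5 : ∀ y, t.label y = (bipartiteNetwork E c).numNodes ∨
        y ∉ s.branch x ∧ t.label y = s.label y := by
      intro y
      rw [← hs']
      dsimp only
      split_ifs with hy
      · exact .inl rfl
      · exact .inr ⟨hy, rfl⟩
    have ht6 : ∀ y, y ∉ s.branch x → t.label y = s.label y := by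
      intro y hy
      rw [← hs']
      dsimp only
      rw [if_neg hy]
    refine ⟨fun r hr j hj hjr => ?_, fun a a' ha ha' h1 h2 h3 h4 => ?_, fun y => ?_⟩
    · obtain ⟨hr1, hr2, hr3⟩ := hr
      have hrl := ((ht5 r).resolve_left hr3.ne).2
      rw [hrl] at hr3 hjr
      have hr' : s.Active (bipartiteNetwork E c) r := ⟨ht3 ▸ hr1, ht4 ▸ hr2, hr3⟩
      obtain ⟨y, hy⟩ := hh.occupied r hr' j hj hjr
      have hrx : s.label r ≤ s.label x := hx.2 r hr'
      refine ⟨y, ?_⟩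
      rw [ht6 y, hy]
      intro hyb
      have := ((hbr y).1 hyb).label_le h.mono
      omega
    · rw [((ht5 _).resolve_left h2.ne).2] at h1 h2
      rw [((ht5 _).resolve_left h4.ne).2] at h3 h4
      exact hh.isolated a a' ha ha' h1 h2 h3 h4
    · rcases ht5 y with h1 | ⟨-, h1⟩
      · exact .inr h1
      · rw [h1]
        exact hh.bound y
  | @scanMerge x y p q hcur hl hy hm hp hq =>
    obtain ⟨r, hr⟩ := h.cur x hcur
    obtain ⟨v, hv⟩ := h.merge hc hr hm hp hq
    refine ⟨fun w hw j hj hjw => ?_, hh.isolated, hh.bound⟩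
    obtain ⟨-, hw2, hw3⟩ := hw
    have hwr : s.label w ≤ s.label r := by
      by_cases hwv : w = v
      · have h1 := hq.label_le h.mono v hv.mem
        have := hm.2
        have := hr.2.2.1
        rw [hwv]
        omega
      · exact hr.1.2 w (hv.active_of_ne h.normalized hwv hw2 hw3)
    exact hh.occupied r hr.1.1 j hj (lt_of_lt_of_le hjw hwr)
  | @relabel x hcur hptr hch =>
    obtain ⟨r, hr⟩ := h.cur x hcur
    have hxr := hr.2.2.1
    have hxn := hr.label_lt
    have hocc : ∀ j, 1 ≤ j → j < s.label x → ∃ y, s.label y = j := by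
      intro j hj hjx
      by_cases hj1 : j + 1 = s.label x
      · rcases hr.2.2.2 with h1 | ⟨y, h1⟩
        · omega
        · exact ⟨y, by omega⟩
      · exact hh.occupied r hr.1.1 j hj (by omega)
    have hmax : ∀ w, s.Active (bipartiteNetwork E c) w → s.label w ≤ s.label x := by
      intro w hw
      rw [hxr]
      exact hr.1.2 w hw
    refine ⟨fun w hw j hj hjw => ?_, fun a a' ha ha' h1 h2 h3 h4 => ?_, fun y => ?_⟩
    · have hjx : j < s.label x := by
        dsimp only at hjw
        by_cases hwx : w = x
        · rw [hwx, Function.update_self] at hjw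
          omega
        · obtain ⟨hw1, hw2, hw3⟩ := hw
          dsimp only at hw1 hw2 hw3
          rw [Function.update_of_ne hwx] at hjw hw3
          have := hmax w ⟨hw1, hw2, hw3⟩
          omega
      obtain ⟨y, hy⟩ := hocc j hj hjx
      refine ⟨y, ?_⟩
      dsimp only
      rw [Function.update_of_ne, hy]
      rintro rfl
      omega
    -- Isolated nodes below n are active, so when `x` is processed another one with label above 1
    -- has at most the label of `x`. Then both were already strictly between 1 and n, contradicting
    -- uniqueness.
    · have key : ∀ a a', a ∉ E.image Prod.fst → a' ∉ E.image Prod.fst → x = .inl a → a' ≠ a →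
          1 < s.label (.inl a') → s.label (.inl a') < (bipartiteNetwork E c).numNodes → False := by
        rintro a a' ha ha' rfl hne h1 h2
        have h3 := hmax _ (h.isolated_active hc ha' h2)
        exact hne (hh.isolated a' a ha' ha h1 h2 (by omega) hxn)
      dsimp only at h1 h2 h3 h4
      by_contra hne
      by_cases hax : Sum.inl a = x
      · have hne' : (Sum.inl a' : α ⊕ β) ≠ x := by
          rw [← hax]
          simpa using Ne.symm hne
        rw [Function.update_of_ne hne'] at h3 h4
        exact key a a' ha ha' hax.symm (Ne.symm hne) h3 h4
      · rw [Function.update_of_ne hax] at h1 h2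
        by_cases hax' : Sum.inl a' = x
        · exact key a' a ha' ha hax'.symm hne h1 h2
        · rw [Function.update_of_ne hax'] at h3 h4
          exact hne (hh.isolated a a' ha ha' h1 h2 h3 h4)
    · dsimp only
      by_cases hyx : y = x
      · left
        rw [hyx, Function.update_self]
        classical
        let I := Finset.univ.filter fun a => a ∉ E.image Prod.fst ∧ 1 < s.label (.inl a) ∧
          s.label (.inl a) < (bipartiteNetwork E c).numNodes
        have hI : I.card ≤ 1 := by
          refine Finset.card_le_one.2 fun a ha a' ha' => ?_
          simp only [I, Finset.mem_filter, Finset.mem_univ, true_and] at ha ha'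
          exact hh.isolated a a' ha.1 ha'.1 ha.2.1 ha.2.2 ha'.2.1 ha'.2.2
        -- Labels from 2 on sit on n' left nodes with edges, at most one isolated one and κ touched
        -- right nodes; hence the old label is at most n'+κ+3.
        have h1 := le_card_of_labels (label := s.label) (k := s.label x)
          (T := (E.image Prod.fst ∪ I).disjSum (Finset.univ.filter (Touched s.flow))) (by
            intro j hj hjx
            obtain ⟨z, hz⟩ := hocc j (by omega) hjx
            refine ⟨z, ?_, hz⟩
            rcases z with a | b
            · rw [Finset.inl_mem_disjSum, Finset.mem_union]
              by_cases ha : a ∈ E.image Prod.fst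
              · exact .inl ha
              · right
                simp only [I, Finset.mem_filter, Finset.mem_univ, true_and]
                exact ⟨ha, by omega, by omega⟩
            · simp only [Finset.inr_mem_disjSum, Finset.mem_filter, Finset.mem_univ, true_and]
              exact h.touched b (by omega))
        rw [Finset.card_disjSum] at h1
        have h2 := Finset.card_union_le (E.image Prod.fst) I
        have h3 := h.normalized.int.card_touched_le h.normalized.left
        omega
      · rw [Function.update_of_ne hyx]
        exact hh.bound y

theorem HighInv.of_reachable (hc : ∀ e ∈ E, 1 ≤ c e.1 e.2)
    (h : Reachable (bipartiteNetwork E c) adj .highest s) : HighInv E c s := by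
  induction h with
  | refl => exact highInv_init
  | tail hreach hstep ih => exact ih.step (.of_reachable hc hreach) hc hstep

end highest

/-! ### The lowest-label variant -/

section lowest

variable {α : Type u} {β : Type v} [Fintype α] [Fintype β] {E : Finset (α × β)}
  {c : α → β → ℝ≥0∞} {adj : α ⊕ β → List (α ⊕ β)} {s s' : State (α ⊕ β)} {B g : ℕ}

/-- No label below an occupied one is missing. -/
structure GapFree (B : ℕ) (s : State (α ⊕ β)) : Prop where
  occupied : ∀ x j, 1 ≤ j → j < s.label x → ∃ y, s.label y = j
  bound : ∀ x, s.label x ≤ B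

/-- The label `g` is missing, and all active roots have larger labels. -/
structure Gapped (E : Finset (α × β)) (c : α → β → ℝ≥0∞) (B g : ℕ) (s : State (α ⊕ β)) :
    Prop where
  pos : 1 ≤ g
  ne : ∀ x, s.label x ≠ g
  active : ∀ r, s.Active (bipartiteNetwork E c) r → g < s.label r
  cold : ∀ x r, InBranch s.parent r x → (bipartiteNetwork E c).excess s.flow r ≤ 0 →
    s.label x ≤ B
  bound : LabelBound E c (B + 2) s

/-- Invariants of the lowest-label variant. -/
structure LowInv (E : Finset (α × β)) (c : α → β → ℝ≥0∞) (adj : α ⊕ β → List (α ⊕ β))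
    (s : State (α ⊕ β)) : Prop where
  excess_le : ∀ x, (bipartiteNetwork E c).excess s.flow x ≤ 1
  valid : ∀ x y, 0 < (bipartiteNetwork E c).residual s.flow x y →
    s.label x < (bipartiteNetwork E c).numNodes → s.label x ≤ s.label y + 1
  scanned : ∀ x i y, i < s.ptr x → (adj x)[i]? = some y →
    s.label x < (bipartiteNetwork E c).numNodes →
    0 < (bipartiteNetwork E c).residual s.flow x y →
    s.label x ≤ s.label y ∨ s.parent x = some y
  ptr_touched : ∀ a i b, i < s.ptr (.inl a) → (adj (.inl a))[i]? = some (.inr b) →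
    Touched s.flow b
  phase : GapFree (3 * matchingNumber E + 3) s ∨
    ∃ g, Gapped E c (3 * matchingNumber E + 3) g s

theorem lowInv_init : LowInv E c adj (State.init (α ⊕ β)) where
  excess_le x := by
    have hn := normalized_init (E := E) (c := c)
    rcases x with a | b
    · rw [hn.int.excess_inl]
      simp [State.init]
    · rw [hn.int.excess_inr]
      simp [State.init]
  valid x y _ _ := by simp [State.init]
  scanned x i y hi := by simp [State.init] at hi
  ptr_touched x i y hi := by simp [State.init] at hi
  phase := .inl ⟨fun x j hj hjx => by simp [State.init] at hjx; omega, fun x => by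
    simp [State.init]⟩

/-- Labels only rise, and only to n, where the claims on residual arcs are void. The relabeled
branch has positive excess at its root, so the bound on the other branches is unaffected. -/
theorem LowInv.gap (hl : LowInv E c adj s) (h : Inv E c adj .lowest s) {x : α ⊕ β}
    (hx : s.Selectable (bipartiteNetwork E c) .lowest x) (hne : s.label x ≠ 1)
    (hgap : ∀ y, s.label y + 1 ≠ s.label x) {t : State (α ⊕ β)} (hp : t.parent = s.parent)
    (hf : t.flow = s.flow) (hptr : t.ptr = s.ptr) (hlt : ∀ y,
      InBranch s.parent x y ∧ t.label y = (bipartiteNetwork E c).numNodes ∨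
        t.label y = s.label y) : LowInv E c adj t := by
  have hge : ∀ y, s.label y ≤ t.label y := by
    intro y
    rcases hlt y with h1 | h1
    · exact h1.2 ▸ h.label_le y
    · exact h1.ge
  have hlo : ∀ y, t.label y < (bipartiteNetwork E c).numNodes → t.label y = s.label y :=
    fun y hy => (hlt y).resolve_left fun h1 => hy.ne h1.2
  refine ⟨fun y => hf ▸ hl.excess_le y, fun y z hyz hy => ?_, fun y i z hi hz hy hyz => ?_,
    fun a i b hi => ?_, ?_⟩
  · have heq := hlo y hy
    rw [heq] at hy ⊢
    rw [hf] at hyz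
    exact (hl.valid y z hyz hy).trans (Nat.add_le_add_right (hge z) 1)
  · have heq := hlo y hy
    rw [heq] at hy ⊢
    rw [hf] at hyz
    rw [hptr] at hi
    rw [hp]
    exact (hl.scanned y i z hi hz hy hyz).imp_left fun h1 => h1.trans (hge z)
  · rw [hptr] at hi
    rw [hf]
    exact hl.ptr_touched a i b hi
  · right
    rcases hl.phase with h1 | ⟨g, h1⟩
    -- As long as no label is skipped, gap relabeling cannot happen.
    · have h2 := h.label_pos x
      obtain ⟨y, hy⟩ := h1.occupied x (s.label x - 1) (by omega) (by omega)
      exact absurd (by omega) (hgap y)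
    · have hgn : g < (bipartiteNetwork E c).numNodes := (h1.active x hx.1).trans hx.1.2.2
      refine ⟨g, h1.pos, fun y => ?_, fun r hr => ?_, fun y r hr he => ?_, fun y => ?_⟩
      · rcases hlt y with h2 | h2
        · rw [h2.2]
          exact hgn.ne'
        · rw [h2]
          exact h1.ne y
      · obtain ⟨hr1, hr2, hr3⟩ := hr
        have heq := hlo r hr3
        rw [heq] at hr3 ⊢
        exact h1.active r ⟨hp ▸ hr1, hf ▸ hr2, hr3⟩
      · rw [hp] at hr
        rw [hf] at he
        rcases hlt y with h2 | h2
        · rw [hr.unique h2.1] at he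
          exact absurd hx.1.2.1 (not_lt.2 he)
        · rw [h2]
          exact h1.cold y r hr he
      · rcases hlt y with h2 | h2
        · exact .inr h2.2
        · rw [h2]
          exact h1.bound y

theorem LowInv.labelBound (hl : LowInv E c adj s) :
    LabelBound E c (3 * matchingNumber E + 5) s := by
  rcases hl.phase with h1 | ⟨g, h1⟩
  · exact fun x => .inl ((h1.bound x).trans (by omega))
  · exact h1.bound

theorem Searching.active_of_excess {x r w : α ⊕ β} (h : Inv E c adj .lowest s)
    (hr : Searching (bipartiteNetwork E c) .lowest s x r)
    (hw : 0 < (bipartiteNetwork E c).excess s.flow w) : s.label x ≤ s.label w := by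
  by_contra hlt
  rw [not_le] at hlt
  have hwn : s.parent w = none := by
    by_contra hne
    rw [h.normalized.balanced w hne] at hw
    exact lt_irrefl _ hw
  have h1 := hr.1.2 w ⟨hwn, hw, hlt.trans hr.label_lt⟩
  have h2 := hr.2.2.1
  dsimp only at h1
  omega

variable [DecidableEq α] [DecidableEq β]

/-- The unit stops at a node `v` above the gap that ends with positive excess. Hence no node passes
from a branch with positive excess to one without. -/
theorem Gapped.merge (hg : Gapped E c B g s) (hl : LowInv E c adj s) (h : Inv E c adj .lowest s)
    {x y r v : α ⊕ β} {p q : List (α ⊕ β)} (hr : Searching (bipartiteNetwork E c) .lowest s x r)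
    (hm : s.IsMergerArc (bipartiteNetwork E c) x y) (hp : RootPath s.parent x p)
    (hq : RootPath s.parent y q) {t : State (α ⊕ β)}
    (hv : MergeSpec E c s.flow s.parent x y p q r v t.flow t.parent) (ht : t.label = s.label) :
    Gapped E c B g t := by
  have hlv : ∀ w ∈ q, s.label w < (bipartiteNetwork E c).numNodes := by
    intro w hw
    have := hq.label_le h.mono w hw
    have := hm.2
    have := hr.label_lt
    omega
  have hvg : g < s.label v := by
    obtain ⟨l₁, l₂, hl1, hch⟩ := hv.chain
    -- The label of `y` is one below that of an active root, hence at least `g`, and `g` is missing.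
    have hy : g < s.label y := by
      have h1 := hg.active r hr.1.1
      have h2 := hr.2.2.1
      have h3 := hm.2
      have h4 := hg.ne y
      omega
    -- Along residual arcs labels drop by at most 1 per step, so a walk starting above `g` cannot
    -- jump over the missing label.
    have key : ∀ (l : List (α ⊕ β)) (z : α ⊕ β), g < s.label z → (∀ w ∈ z :: l, w ∈ q) →
        (z :: l).IsChain (fun i j => 0 < (bipartiteNetwork E c).residual s.flow i j) →
        ∀ w ∈ z :: l, g < s.label w := by
      intro l
      induction l with
      | nil =>
        intro z hz _ _ w hw
        rwa [List.mem_singleton.1 hw]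
      | cons z' l ih =>
        intro z hz hlq hch w hw
        rw [List.isChain_cons_cons] at hch
        rcases List.mem_cons.1 hw with rfl | hw
        · exact hz
        · refine ih z' ?_ (fun w hw => hlq w (List.mem_cons_of_mem _ hw)) hch.2 w hw
          have h1 := hl.valid z z' hch.1 (hlv z (hlq z (by simp)))
          have h2 := hg.ne z'
          omega
    obtain ⟨l₃, h3⟩ : ∃ l₃, l₁ ++ [v] = y :: l₃ := by
      obtain ⟨q', rfl⟩ := hq.exists_cons
      rcases l₁ with _ | ⟨w, l₁⟩
      · exact ⟨[], by simp at hl1; simp [hl1.1]⟩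
      · exact ⟨l₁ ++ [v], by simp at hl1; simp [hl1.1]⟩
    rw [h3] at hch
    refine key l₃ y hy (fun w hw => ?_) hch v (by rw [← h3]; simp)
    rw [← h3] at hw
    rw [hl1]
    simp at hw ⊢
    tauto
  -- If `v` was a root, it is a left node or a touched right node, so its old excess was
  -- nonnegative; otherwise it halted the unit and holds exactly 1.
  have hve : 0 < (bipartiteNetwork E c).excess t.flow v := by
    by_cases hvn : s.parent v = none
    · have hrv : v ≠ r := by
        rintro rfl
        have := hq.label_le h.mono v hv.mem
        have := hm.2
        have := hr.2.2.1
        omega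
      rw [hv.excess, if_neg hrv, if_pos rfl]
      have : 0 ≤ (bipartiteNetwork E c).excess s.flow v := by
        rcases v with a | b
        · exact h.normalized.left a
        · rw [← h.normalized.int.touched_iff]
          exact h.touched b (lt_of_le_of_lt hg.pos hvg)
      linarith
    · rw [hv.halt hvn]
      exact one_pos
  have her : (bipartiteNetwork E c).excess s.flow r ≤ 1 := hl.excess_le r
  refine ⟨hg.pos, fun w => ht ▸ hg.ne w, fun w hw => ?_, fun w r' hr' he => ?_, fun w => ?_⟩
  · rw [ht]
    by_cases hwv : w = v
    · rwa [hwv]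
    · exact hg.active w (hv.active_of_ne h.normalized hwv hw.2.1 (ht ▸ hw.2.2))
  · rw [ht]
    obtain ⟨r₀, hr₀⟩ := exists_inBranch (h.normalized.tree w)
    refine hg.cold w r₀ hr₀ ?_
    by_contra hpos
    rw [not_le] at hpos
    obtain ⟨hrn', l, hlw, hrl⟩ := hr'
    -- Following the new pointers from a node of an old branch with positive excess, one stays in
    -- such branches or on nodes whose old path runs through `v`. Either way the new root has
    -- positive excess.
    have hS := hlw.closed (S := fun u => (∃ ρ, InBranch s.parent ρ u ∧
      0 < (bipartiteNetwork E c).excess s.flow ρ) ∨ ∃ l, RootPath s.parent u l ∧ v ∈ l)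
      (.inl ⟨r₀, hr₀, hpos⟩) (by
        intro u z hu hz
        by_cases hup : u ∈ p
        · rcases hv.parent_mem u hup with h1 | ⟨rfl, h1⟩ | ⟨z', hz', -, h1⟩
          · rw [h1.1] at hz
            simp at hz
          · rw [h1] at hz
            cases hz
            exact .inr ⟨q, hq, hv.mem⟩
          · rw [h1] at hz
            cases hz
            exact .inl ⟨r, hr.2.1.of_mem hp hz', hr.1.1.2.1⟩
        · by_cases huv : u = v
          · rw [huv, hv.parent_v] at hz
            simp at hz
          · rw [hv.parent_off u hup huv] at hz
            rcases hu with ⟨ρ, hρ, h1⟩ | ⟨l, hl, h1⟩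
            · exact .inl ⟨ρ, hρ.parent hz, h1⟩
            · obtain ⟨l', rfl, h2⟩ := hl.step' hz
              refine .inr ⟨l', h2, ?_⟩
              exact (List.mem_cons.1 h1).resolve_left (Ne.symm huv))
    have hrv : r' ≠ v := by
      rintro rfl
      exact absurd hve (not_lt.2 he)
    have hrp : r' ∉ p := by
      intro hrp
      rcases hv.parent_mem r' hrp with h1 | ⟨-, h1⟩ | ⟨z', -, -, h1⟩
      · linarith [h1.2.2]
      · rw [h1] at hrn'
        simp at hrn'
      · rw [h1] at hrn'
        simp at hrn'
    have hrn : s.parent r' = none := by rw [← hv.parent_off r' hrp hrv, hrn']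
    rcases hS r' hrl with ⟨ρ, hρ, h1⟩ | ⟨l', hl', h1⟩
    · rw [hρ.eq_of_root hrn] at h1
      rw [hv.excess, if_neg, if_neg hrv] at he
      · linarith
      · rintro rfl
        exact hrp hv.root_mem
    · rw [hl'.unique (.root hrn), List.mem_singleton] at h1
      exact hrv h1.symm
  · rw [ht]
    exact hg.bound w

/-- New residual arcs never descend in the labels: they run down tree edges, inside the equally
labeled path `p`, or back over the merger arc. The to-branch has no positive excess at its root, so
excess 1 is not exceeded. -/
theorem LowInv.merge (hl : LowInv E c adj s) (h : Inv E c adj .lowest s)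
    {x y r v : α ⊕ β} {p q : List (α ⊕ β)} (hr : Searching (bipartiteNetwork E c) .lowest s x r)
    (hy : (adj x)[s.ptr x]? = some y)
    (hm : s.IsMergerArc (bipartiteNetwork E c) x y) (hp : RootPath s.parent x p)
    (hq : RootPath s.parent y q) {t : State (α ⊕ β)}
    (hv : MergeSpec E c s.flow s.parent x y p q r v t.flow t.parent) (ht : t.label = s.label)
    (hptr : t.ptr = Function.update s.ptr x (s.ptr x + 1)) : LowInv E c adj t := by
  have hlp := hr.label_path h.mono hp
  have her := hl.excess_le r
  have hres : ∀ i j, 0 < (bipartiteNetwork E c).residual t.flow i j →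
      0 < (bipartiteNetwork E c).residual s.flow i j ∨ s.label i ≤ s.label j := by
    intro i j hij
    rcases hv.residual i j hij with h1 | ⟨-, h1⟩ | ⟨rfl, rfl⟩ | ⟨h1, h2⟩
    · exact .inl h1
    · exact .inr (h.mono _ _ h1)
    · exact .inr (Nat.le.intro hm.2)
    · exact .inr (by rw [hlp i h1, hlp j h2])
  -- Excess above 1 never occurs here, so the old root is not cut and `x` keeps its new parent.
  have hpx : t.parent x = some y := by
    rcases hv.parent_x with h1 | h1
    · exact h1
    · linarith [h1.2]
  refine ⟨fun w => ?_, fun i j hij hi => ?_, fun w i z hi hz hw hwz => ?_, fun a i b hi hb => ?_, ?_⟩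
  · by_cases hw : w = v
    · subst hw
      by_cases hwn : s.parent w = none
      · have hwr : w ≠ r ∧ s.label w < s.label r := by
          have h1 : s.label w < s.label r := by
            have := hq.label_le h.mono w hv.mem
            have := hm.2
            have := hr.2.2.1
            omega
          refine ⟨?_, h1⟩
          rintro rfl
          exact lt_irrefl _ h1
        have : (bipartiteNetwork E c).excess s.flow w ≤ 0 := by
          by_contra hpos
          have h1 := hr.1.2 w ⟨hwn, not_le.1 hpos, hwr.2.trans hr.1.1.2.2⟩
          dsimp only at h1
          omega
        rw [hv.excess, if_neg hwr.1, if_pos rfl]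
        linarith
      · exact (hv.halt hwn).le
    · rw [hv.excess, if_neg hw]
      have := hl.excess_le w
      split_ifs <;> linarith
  · rw [ht] at hi ⊢
    rcases hres i j hij with h1 | h1
    · exact hl.valid i j h1 hi
    · omega
  · rw [ht] at hw ⊢
    rcases hres w z hwz with h1 | h1
    swap
    · exact .inl h1
    by_cases hnew : w = x ∧ i = s.ptr x
    · obtain ⟨rfl, rfl⟩ := hnew
      rw [hy] at hz
      cases hz
      exact .inr hpx
    · have hi' : i < s.ptr w := by
        rw [hptr] at hi
        by_cases hwx : w = x
        · subst hwx
          rw [Function.update_self] at hi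
          simp only [true_and] at hnew
          omega
        · rwa [Function.update_of_ne hwx] at hi
      rcases hl.scanned w i z hi' hz hw h1 with h2 | h2
      · exact .inl h2
      · by_cases hwp : w ∈ p
        · left
          obtain ⟨_, l₂, -, h3⟩ := hp.suffix hwp
          have hzp := (mem_of_pair (hp.pair_of_mem hwp h2)).2
          rw [hlp w hwp, hlp z hzp]
        -- If `v` is cut from its parent, the arc to that parent has lost its residual capacity, so
        -- the scanned arc is no exception.
        · by_cases hwv : w = v
          · rw [hwv] at h2 hwz
            rw [hv.halt_residual z h2] at hwz
            exact absurd hwz (lt_irrefl _)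
          · right
            rw [hv.parent_off w hwp hwv, h2]
  · by_cases hnew : Sum.inl a = x ∧ i = s.ptr x
    · obtain ⟨rfl, rfl⟩ := hnew
      rw [hy] at hb
      cases hb
      have h1 := hv.normalized.down _ _ hpx (by simp)
      rw [residual_inr_inl] at h1
      exact ⟨a, by simpa [pos_iff_ne_zero] using h1⟩
    · have hi' : i < s.ptr (.inl a) := by
        rw [hptr] at hi
        by_cases hwx : Sum.inl a = x
        · subst hwx
          rw [Function.update_self] at hi
          simp only [true_and] at hnew
          omega
        · rwa [Function.update_of_ne hwx] at hi
      exact hv.touched h.normalized.int hr.1.1.2.1 (hl.ptr_touched a i b hi' hb)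
  · rcases hl.phase with h1 | ⟨g, h1⟩
    · left
      exact ⟨fun w => ht ▸ h1.occupied w, fun w => ht ▸ h1.bound w⟩
    · exact .inr ⟨g, h1.merge hl h hr hm hp hq hv ht⟩

/-- With its list exhausted, every residual arc from `x` leads to a label at least as large or to
its parent, which has the same label during the search. Raising the label by 1 therefore keeps the
labeling valid. -/
theorem LowInv.relabel (hl : LowInv E c adj s) (h : Inv E c adj .lowest s)
    (hadj : (bipartiteNetwork E c).IsAdjacencyLists adj) {x r : α ⊕ β}
    (hr : Searching (bipartiteNetwork E c) .lowest s x r)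
    (hptr : s.label x = 1 ∨ (adj x).length ≤ s.ptr x) {t : State (α ⊕ β)}
    (hf : t.flow = s.flow) (hp : t.parent = s.parent)
    (hlab : t.label = Function.update s.label x (s.label x + 1))
    (htp : t.ptr = Function.update s.ptr x 0) : LowInv E c adj t := by
  have hxn := hr.label_lt
  have hrx := hr.2.2.1
  have hx : t.label x = s.label x + 1 := by rw [hlab, Function.update_self]
  have hne : ∀ y, y ≠ x → t.label y = s.label y := fun y hy => by
    rw [hlab, Function.update_of_ne hy]
  have hge : ∀ y, s.label y ≤ t.label y := by
    intro y
    by_cases hy : y = x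
    · rw [hy, hx]
      omega
    · exact (hne y hy).ge
  have hactive : ∀ w, w ≠ x → t.Active (bipartiteNetwork E c) w →
      s.Active (bipartiteNetwork E c) w := by
    rintro w hw ⟨h1, h2, h3⟩
    exact ⟨hp ▸ h1, hf ▸ h2, hne w hw ▸ h3⟩
  refine ⟨fun w => hf ▸ hl.excess_le w, fun i j hij hi => ?_, fun w i z hi hz hw hwz => ?_,
    fun a i b hi hb => ?_, ?_⟩
  · rw [hf] at hij
    by_cases hix : i = x
    · subst hix
      rw [hx]
      refine Nat.add_le_add_right (le_trans ?_ (hge j)) 1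
      rcases hptr with h1 | h1
      · rw [h1]
        exact h.label_pos j
      · have hmem : j ∈ adj i := by
          rw [(hadj i).2 j]
          unfold FlowNetwork.Arc
          by_contra hno
          simp only [not_or, not_lt, nonpos_iff_eq_zero] at hno
          obtain ⟨a, b, ⟨rfl, rfl, he, h2⟩ | ⟨rfl, rfl, h2⟩⟩ :=
            h.normalized.int.residual_pos_iff.1 hij
          · rw [cap_inl_inr_of_mem he] at hno
            rw [hno.1] at h2
            simp at h2
          · rcases h.normalized.flow_tree _ _ h2 with h3 | h3 <;>
              have := h.normalized.edges _ _ h3 <;>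
              simp [FlowNetwork.Arc, hno.2] at this
        obtain ⟨k, hk⟩ := List.mem_iff_getElem?.1 hmem
        have hk' := (List.getElem?_eq_some_iff.1 hk).1
        rcases hl.scanned i k j (by omega) hk hxn hij with h2 | h2
        · exact h2
        · exact (hr.label_parent h.mono h2).ge
    · rw [hne i hix] at hi ⊢
      exact (hl.valid i j hij hi).trans (Nat.add_le_add_right (hge j) 1)
  · by_cases hwx : w = x
    · rw [htp, hwx, Function.update_self] at hi
      omega
    · rw [htp, Function.update_of_ne hwx] at hi
      rw [hne w hwx] at hw ⊢
      rw [hf] at hwz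
      rw [hp]
      exact (hl.scanned w i z hi hz hw hwz).imp_left fun h1 => h1.trans (hge z)
  · by_cases hwx : Sum.inl a = x
    · rw [htp, hwx, Function.update_self] at hi
      omega
    · rw [htp, Function.update_of_ne hwx] at hi
      rw [hf]
      exact hl.ptr_touched a i b hi hb
  · rcases hl.phase with h1 | ⟨g, h1⟩
    -- Below the lowest active label a left node must carry flow: at most 2κ of those, plus κ
    -- touched right nodes, so the old label is at most 3κ+2.
    · have hxB : s.label x + 1 ≤ 3 * matchingNumber E + 3 := by
        classical
        have h2 := le_card_of_labels (label := s.label) (k := s.label x)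
          (T := (Finset.univ.filter fun a => ∃ b, s.flow (.inl a) (.inr b) ≠ 0).disjSum
            (Finset.univ.filter (Touched s.flow))) (by
            intro j hj hjx
            obtain ⟨z, hz⟩ := h1.occupied x j (by omega) hjx
            refine ⟨z, ?_, hz⟩
            rcases z with a | b
            · simp only [Finset.inl_mem_disjSum, Finset.mem_filter, Finset.mem_univ, true_and]
              by_contra hno
              simp only [ne_eq, not_exists, not_not] at hno
              have h3 : 0 < (bipartiteNetwork E c).excess s.flow (.inl a) := by
                rw [h.normalized.int.excess_inl]
                simp [hno]
              have := hr.active_of_excess h h3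
              omega
            · simp only [Finset.inr_mem_disjSum, Finset.mem_filter, Finset.mem_univ, true_and]
              exact h.touched b (by omega))
        rw [Finset.card_disjSum] at h2
        have h3 := h.normalized.int.card_touched_le h.normalized.left
        have h4 := h.normalized.int.card_matched_le h.normalized.left
          fun b => hl.excess_le (.inr b)
        omega
      have hB : ∀ y, t.label y ≤ 3 * matchingNumber E + 3 := by
        intro y
        by_cases hy : y = x
        · rw [hy, hx]
          exact hxB
        · rw [hne y hy]
          exact h1.bound y
      -- If `x` was the only node of its label, that label becomes the permanent gap; active roots
      -- were at or above it and are now strictly above.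
      by_cases hocc : ∃ z, z ≠ x ∧ s.label z = s.label x
      · left
        obtain ⟨z, hzx, hz⟩ := hocc
        refine ⟨fun y j hj hjy => ?_, hB⟩
        by_cases hjx : j = s.label x
        · exact ⟨z, by rw [hne z hzx, hz, hjx]⟩
        · have : ∃ w, s.label w = j := by
            by_cases hy : y = x
            · rw [hy, hx] at hjy
              exact h1.occupied x j hj (by omega)
            · rw [hne y hy] at hjy
              exact h1.occupied y j hj hjy
          obtain ⟨w, hw⟩ := this
          refine ⟨w, ?_⟩
          rw [hne w, hw]
          rintro rfl
          exact hjx hw.symm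
      · right
        simp only [not_exists, not_and] at hocc
        refine ⟨s.label x, h.label_pos x, fun y => ?_, fun w hw => ?_, fun y _ _ _ => hB y,
          fun y => .inl ((hB y).trans (Nat.le_add_right _ _))⟩
        · by_cases hy : y = x
          · rw [hy, hx]
            omega
          · rw [hne y hy]
            exact hocc y hy
        · by_cases hwx : w = x
          · rw [hwx, hx]
            omega
          · have h2 := hr.active_of_excess h (hactive w hwx hw).2.1
            have h3 := hocc w hwx
            rw [hne w hwx]
            omega
    · right
      have hgx : g < s.label x := hrx ▸ h1.active r hr.1.1
      refine ⟨g, h1.pos, fun y => ?_, fun w hw => ?_, fun y ρ hρ he => ?_, fun y => ?_⟩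
      · by_cases hy : y = x
        · rw [hy, hx]
          omega
        · rw [hne y hy]
          exact h1.ne y
      · by_cases hwx : w = x
        · rw [hwx, hx]
          omega
        · rw [hne w hwx]
          exact h1.active w (hactive w hwx hw)
      · rw [hp] at hρ
        rw [hf] at he
        rw [hne y]
        · exact h1.cold y ρ hρ he
        · rintro rfl
          rw [hρ.unique hr.2.1] at he
          exact absurd hr.1.1.2.1 (not_lt.2 he)
      · by_cases hy : y = x
        · left
          rw [hy, hx]
          -- A node just below the lowest active label lies in a branch without positive excess, so
          -- its label is at most `B`, and the new label of `x` at most `B + 2`.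
          rcases hr.2.2.2 with h2 | ⟨z, hz⟩
          · omega
          · obtain ⟨ρ, hρ⟩ := exists_inBranch (h.normalized.tree z)
            have h3 := h1.cold z ρ hρ (by
              by_contra hpos
              have := hr.active_of_excess h (not_le.1 hpos)
              have := hρ.label_le h.mono
              omega)
            omega
        · rw [hne y hy]
          exact h1.bound y

theorem LowInv.step (hl : LowInv E c adj s) (h : Inv E c adj .lowest s)
    (hc : ∀ e ∈ E, 1 ≤ c e.1 e.2) (hadj : (bipartiteNetwork E c).IsAdjacencyLists adj)
    (hstep : Step (bipartiteNetwork E c) adj .lowest s s') : LowInv E c adj s' := by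
  have key : ∀ t : State (α ⊕ β), t.flow = s.flow → t.parent = s.parent → t.label = s.label →
      GapFree (3 * matchingNumber E + 3) t ∨ ∃ g, Gapped E c (3 * matchingNumber E + 3) g t := by
    intro t hf hp ht
    refine hl.phase.imp (fun h1 => ⟨ht ▸ h1.occupied, ht ▸ h1.bound⟩) ?_
    rintro ⟨g, h1⟩
    refine ⟨g, h1.pos, ht ▸ h1.ne, fun r hr => ?_, fun y r hr he => ?_, fun y => ?_⟩
    · rw [ht]
      exact h1.active r ⟨hp ▸ hr.1, hf ▸ hr.2.1, ht ▸ hr.2.2⟩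
    · rw [ht]
      exact h1.cold y r (hp ▸ hr) (hf ▸ he)
    · rw [ht]
      exact h1.bound y
  cases hstep with
  | select => exact ⟨hl.excess_le, hl.valid, hl.scanned, hl.ptr_touched, key _ rfl rfl rfl⟩
  | descend => exact ⟨hl.excess_le, hl.valid, hl.scanned, hl.ptr_touched, key _ rfl rfl rfl⟩
  | @gap x hcur hx hne hgap =>
    have hbr : ∀ y, y ∈ s.branch x ↔ InBranch s.parent x y := by simp [State.branch]
    refine hl.gap h hx hne hgap rfl rfl rfl fun y => ?_
    dsimp only
    split_ifs with h1
    · exact .inl ⟨(hbr y).1 h1, rfl⟩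
    · exact .inr rfl
  | @scanMiss x y hcur hlx hy hm =>
    obtain ⟨r, hr⟩ := h.cur x hcur
    have hle : 0 < (bipartiteNetwork E c).residual s.flow x y → s.label x ≤ s.label y := by
      intro hres
      have h1 := hl.valid x y hres hr.label_lt
      have h2 : s.label y + 1 ≠ s.label x := fun h2 => hm ⟨hres, h2⟩
      omega
    refine ⟨hl.excess_le, hl.valid, fun w i z hi hz hw hwz => ?_, fun a i b hi hb => ?_,
      key _ rfl rfl rfl⟩
    · dsimp only at *
      by_cases hnew : w = x ∧ i = s.ptr x
      · obtain ⟨rfl, rfl⟩ := hnew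
        rw [hy] at hz
        cases hz
        exact .inl (hle hwz)
      · refine hl.scanned w i z ?_ hz hw hwz
        by_cases hwx : w = x
        · subst hwx
          rw [Function.update_self] at hi
          simp only [true_and] at hnew
          omega
        · rwa [Function.update_of_ne hwx] at hi
    · dsimp only at *
      by_cases hnew : Sum.inl a = x ∧ i = s.ptr x
      · obtain ⟨rfl, rfl⟩ := hnew
        rw [hy] at hb
        cases hb
        -- A scanned neighbor `b` is touched in either case: a residual arc without merger forces
        -- its label above 1, and a non-residual edge carries flow.
        by_cases hres : 0 < (bipartiteNetwork E c).residual s.flow (.inl a) (.inr b)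
        · exact h.touched b (hlx.trans_le (hle hres))
        · have hab : (a, b) ∈ E := by
            have := ((hadj (.inl a)).2 (.inr b)).1 (List.mem_of_getElem? hy)
            simp only [arc_iff hc] at this
            rcases this with ⟨a', b', h1, h2, h3⟩ | ⟨a', b', h1, h2, h3⟩
            · cases h1
              cases h2
              exact h3
            · cases h1
          exact ⟨a, h.normalized.int.residual_le hc hab hres⟩
      · refine hl.ptr_touched a i b ?_ hb
        by_cases hwx : Sum.inl a = x
        · subst hwx
          rw [Function.update_self] at hi
          simp only [true_and] at hnew
          omega
        · rwa [Function.update_of_ne hwx] at hi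
  | @scanMerge x y p q hcur hlx hy hm hp hq =>
    obtain ⟨r, hr⟩ := h.cur x hcur
    obtain ⟨v, hv⟩ := h.merge hc hr hm hp hq
    refine hl.merge h hr hy hm hp hq (v := v) ?_ rfl rfl
    exact hv
  | @relabel x hcur hptr hch =>
    obtain ⟨r, hr⟩ := h.cur x hcur
    exact hl.relabel h hadj hr hptr rfl rfl rfl rfl

theorem LowInv.of_reachable (hc : ∀ e ∈ E, 1 ≤ c e.1 e.2)
    (hadj : (bipartiteNetwork E c).IsAdjacencyLists adj)
    (h : Reachable (bipartiteNetwork E c) adj .lowest s) : LowInv E c adj s := by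
  induction h with
  | refl => exact lowInv_init
  | tail hreach hstep ih => exact ih.step (.of_reachable hc hreach) hc hadj hstep

end lowest

/-! ### The complexity bounds -/

/-! ### Sizes of the adjacency lists -/

section adjacency

variable {α : Type u} {β : Type v} [Fintype α] {E : Finset (α × β)} {c : α → β → ℝ≥0∞}
  {adj : α ⊕ β → List (α ⊕ β)}

theorem length_adj_inr_le (hc : ∀ e ∈ E, 1 ≤ c e.1 e.2)
    (hadj : (bipartiteNetwork E c).IsAdjacencyLists adj) (b : β) :
    (adj (.inr b)).length ≤ Fintype.card α := by
  classical
  rw [← List.toFinset_card_of_nodup (hadj _).1, ← Finset.card_univ,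
    ← Finset.card_map (Function.Embedding.inl : α ↪ α ⊕ β)]
  refine Finset.card_le_card fun y hy => ?_
  rw [List.mem_toFinset, (hadj _).2] at hy
  simp only [arc_iff hc] at hy
  rcases hy with ⟨a', b', h1, h2, h3⟩ | ⟨a', b', h1, h2, h3⟩
  · cases h1
  · simp [h1]

end adjacency

section bounds

variable {α : Type u} {β : Type v} [Fintype α] [Fintype β] {E : Finset (α × β)}
  {c : α → β → ℝ≥0∞} {adj : α ⊕ β → List (α ⊕ β)} {var : Variant} {s : State (α ⊕ β)} {D : ℕ}

open Classical in
/-- A bound for the number of scans per label in the lowest-label variant. -/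
noncomputable def scanBound (E : Finset (α × β)) (s : State (α ⊕ β)) : α ⊕ β → ℕ :=
  Sum.elim (fun _ => matchingNumber E) fun b => if Touched s.flow b then Fintype.card α else 0

theorem Inv.sum_scanBound_le (h : Inv E c adj var s) :
    ∑ x, scanBound E s x ≤ 2 * (Fintype.card α * matchingNumber E) := by
  classical
  rw [Fintype.sum_sum_type]
  simp only [scanBound, Sum.elim_inl, Sum.elim_inr]
  rw [Finset.sum_const, ← Finset.sum_filter, Finset.sum_const, smul_eq_mul, smul_eq_mul,
    Finset.card_univ]
  have := Nat.mul_le_mul_right (Fintype.card α)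
    (h.normalized.int.card_touched_le h.normalized.left)
  linarith

variable [DecidableEq α] [DecidableEq β]

/-- Double counting: each edge appears in the lists of its two endpoints only. -/
theorem sum_length_adj_le (hc : ∀ e ∈ E, 1 ≤ c e.1 e.2)
    (hadj : (bipartiteNetwork E c).IsAdjacencyLists adj) :
    ∑ x, (adj x).length ≤ 2 * E.card := by
  have h1 : ∀ x, (adj x).length ≤ (E.filter fun e => Sum.inl e.1 = x ∨ Sum.inr e.2 = x).card := by
    intro x
    rw [← List.toFinset_card_of_nodup (hadj x).1]
    refine le_trans (Finset.card_le_card (t := (E.filter fun e => Sum.inl e.1 = x ∨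
      Sum.inr e.2 = x).image fun e => if Sum.inl e.1 = x then Sum.inr e.2 else Sum.inl e.1)
      fun y hy => ?_) Finset.card_image_le
    rw [List.mem_toFinset, (hadj _).2] at hy
    simp only [arc_iff hc] at hy
    rw [Finset.mem_image]
    rcases hy with ⟨a, b, rfl, rfl, he⟩ | ⟨a, b, rfl, rfl, he⟩
    · exact ⟨(a, b), Finset.mem_filter.2 ⟨he, by simp⟩, by simp⟩
    · exact ⟨(a, b), Finset.mem_filter.2 ⟨he, by simp⟩, by simp⟩
  refine (Finset.sum_le_sum fun x _ => h1 x).trans ?_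
  have h2 : ∀ x, (E.filter fun e => Sum.inl e.1 = x ∨ Sum.inr e.2 = x).card =
      ∑ e ∈ E, if Sum.inl e.1 = x ∨ Sum.inr e.2 = x then 1 else 0 := fun x => by
    rw [Finset.card_filter]
  simp_rw [h2]
  rw [Finset.sum_comm, mul_comm, ← smul_eq_mul, ← Finset.sum_const]
  refine Finset.sum_le_sum fun e _ => ?_
  rw [← Finset.card_filter]
  refine (Finset.card_le_card (t := {Sum.inl e.1, Sum.inr e.2}) fun x hx => ?_).trans
    Finset.card_le_two
  rw [Finset.mem_filter] at hx
  simp only [Finset.mem_insert, Finset.mem_singleton]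
  exact hx.2.imp Eq.symm Eq.symm

theorem scans_le_of_labelBound (hc : ∀ e ∈ E, 1 ≤ c e.1 e.2)
    (hadj : (bipartiteNetwork E c).IsAdjacencyLists adj)
    (hD : ∀ t, Reachable (bipartiteNetwork E c) adj var t → LabelBound E c D t)
    (h : Reachable (bipartiteNetwork E c) adj var s) : s.scans ≤ (D + 2) * (2 * E.card) := by
  refine le_trans ?_ ((scanPotential_le (D := D) (Inv.of_reachable hc h).ptr_le).trans
    (Nat.mul_le_mul_left _ (sum_length_adj_le hc hadj)))
  induction h with
  | refl => exact Nat.zero_le _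
  | tail hreach hstep ih =>
    exact (Inv.of_reachable hc hreach).scans_step (hD _ hreach)
      (Inv.of_reachable hc hreach).ptr_le (fun _ => le_rfl) hstep ih

theorem touched_of_ptr_pos (hc : ∀ e ∈ E, 1 ≤ c e.1 e.2)
    (h : Reachable (bipartiteNetwork E c) adj var s) {b : β} (hb : 0 < s.ptr (.inr b)) :
    Touched s.flow b := by
  induction h with
  | refl => simp [State.init] at hb
  | @tail t t' hreach hstep ih =>
    have hi := Inv.of_reachable hc hreach
    refine hi.touched_mono hc hstep ?_
    have key : ∀ x, 1 < t.label x → 0 < Function.update t.ptr x (t.ptr x + 1) (.inr b) →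
        Touched t.flow b := by
      intro x hx hbx
      by_cases hxb : Sum.inr b = x
      · exact hi.touched b (hxb ▸ hx)
      · exact ih (by rwa [Function.update_of_ne hxb] at hbx)
    cases hstep with
    | select => exact ih hb
    | gap => exact ih hb
    | descend => exact ih hb
    | scanMiss hcur hl => exact key _ hl hb
    | scanMerge hcur hl => exact key _ hl hb
    | @relabel x =>
      dsimp only at hb
      by_cases hxb : Sum.inr b = x
      · simp [hxb] at hb
      · exact ih (by rwa [Function.update_of_ne hxb] at hb)

/-- All neighbors a left pointer has passed are distinct touched nodes. A right pointer moves only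
at a label above 1, hence at a touched node, and such a node has at most n₁ neighbors. -/
theorem ptr_le_scanBound (hc : ∀ e ∈ E, 1 ≤ c e.1 e.2)
    (hadj : (bipartiteNetwork E c).IsAdjacencyLists adj)
    (h : Reachable (bipartiteNetwork E c) adj .lowest s) (x : α ⊕ β) :
    s.ptr x ≤ scanBound E s x := by
  classical
  have hi := Inv.of_reachable hc h
  have hl := LowInv.of_reachable hc hadj h
  rcases x with a | b
  · refine le_trans ?_ (hi.normalized.int.card_touched_le hi.normalized.left)
    have h1 : s.ptr (.inl a) = ((adj (.inl a)).take (s.ptr (.inl a))).length := by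
      rw [List.length_take, min_eq_left (hi.ptr_le _)]
    rw [h1, ← List.toFinset_card_of_nodup ((hadj _).1.sublist (List.take_sublist _ _)),
      ← Finset.card_map (Function.Embedding.inr : β ↪ α ⊕ β)]
    refine Finset.card_le_card fun y hy => ?_
    rw [List.mem_toFinset] at hy
    have hy2 := List.mem_of_mem_take hy
    rw [(hadj _).2] at hy2
    simp only [arc_iff hc] at hy2
    rcases hy2 with ⟨a', b, h2, rfl, h3⟩ | ⟨a', b, h2, h4, h3⟩
    · obtain ⟨i, hi', hib⟩ := List.mem_iff_getElem.1 hy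
      rw [List.length_take] at hi'
      rw [List.getElem_take] at hib
      have := hl.ptr_touched a i b (by omega) (List.getElem?_eq_some_iff.2 ⟨by omega, hib⟩)
      simpa using this
    · cases h4
  · simp only [scanBound, Sum.elim_inr]
    split_ifs with hb
    · exact (hi.ptr_le _).trans (length_adj_inr_le hc hadj b)
    · by_contra hpos
      exact hb (touched_of_ptr_pos hc h (by omega))

theorem scans_le_lowest (hc : ∀ e ∈ E, 1 ≤ c e.1 e.2)
    (hadj : (bipartiteNetwork E c).IsAdjacencyLists adj)
    (h : Reachable (bipartiteNetwork E c) adj .lowest s) :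
    s.scans ≤ (3 * matchingNumber E + 7) * (2 * (Fintype.card α * matchingNumber E)) := by
  refine le_trans ?_ ((scanPotential_le (D := 3 * matchingNumber E + 5)
    (ptr_le_scanBound hc hadj h)).trans
    (Nat.mul_le_mul_left _ (Inv.of_reachable hc h).sum_scanBound_le))
  induction h with
  | refl => exact Nat.zero_le _
  | tail hreach hstep ih =>
    have hi := Inv.of_reachable hc hreach
    refine hi.scans_step (LowInv.of_reachable hc hadj hreach).labelBound
      (ptr_le_scanBound hc hadj hreach) (fun x => ?_) hstep ih
    rcases x with a | b
    · exact le_rfl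
    · simp only [scanBound, Sum.elim_inr]
      split_ifs with h1 h2
      · exact le_rfl
      · exact absurd (hi.touched_mono hc hstep h1) h2
      · exact Nat.zero_le _
      · exact le_rfl

/-- The depth bound 2κ+3 serves as `P`. Initially exactly the left nodes can be active, with label
1, which explains the additive terms `K * n₁` and `P + 1`. -/
theorem work_le (hc : ∀ e ∈ E, 1 ≤ c e.1 e.2) {K J : ℕ}
    (hD : ∀ t, Reachable (bipartiteNetwork E c) adj var t → LabelBound E c D t)
    (hKJ : K = 0 ∧ 3 * (2 * matchingNumber E + 3) + 2 ≤ J ∨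
      3 * (2 * matchingNumber E + 3) + 2 ≤ K ∧ 1 ≤ J ∧
      ∀ t, Reachable (bipartiteNetwork E c) adj var t →
        ∀ x, (bipartiteNetwork E c).excess t.flow x ≤ 1)
    (h : Reachable (bipartiteNetwork E c) adj var s) :
    s.work ≤ J * s.scans + (3 + K) * ((Fintype.card α + matchingNumber E) * D) +
      (Fintype.card α + matchingNumber E) + (K * Fintype.card α + 2 * matchingNumber E + 4) := by
  have hw : WorkBound E c (2 * matchingNumber E + 3) K J
      (K * Fintype.card α + 2 * matchingNumber E + 4) D s := by
    induction h with
    | refl =>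
      refine ⟨fun _ => ?_, by simp [State.init]⟩
      have h1 : activePotential (bipartiteNetwork E c) (State.init (α ⊕ β)) ≤ Fintype.card α := by
        classical
        unfold activePotential
        rw [Fintype.sum_sum_type]
        have hb : ∀ b : β, ¬ (State.init (α ⊕ β)).Active (bipartiteNetwork E c) (.inr b) := by
          rintro b ⟨-, h1, -⟩
          rw [(normalized_init (E := E) (c := c)).int.excess_inr] at h1
          simp [State.init] at h1
          linarith
        simp only [hb, if_false, Finset.sum_const_zero, add_zero]
        rw [← Finset.card_univ, Finset.card_eq_sum_ones]
        refine Finset.sum_le_sum fun a _ => ?_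
        split_ifs
        · exact le_rfl
        · exact Nat.zero_le _
      have h2 := Nat.mul_le_mul_left K h1
      change 0 + _ + _ + _ ≤ _
      omega
    | tail hreach hstep ih =>
      have hi := Inv.of_reachable hc hreach
      exact hi.work_step hc (hD _ hreach) (fun x l hl => hi.normalized.depth_le hc hl)
        (hKJ.imp_right fun h1 => ⟨h1.1, h1.2.1, h1.2.2 _ hreach⟩) hstep ih
  have hi := Inv.of_reachable hc h
  have h1 := Nat.mul_le_mul_left (3 + K) (hi.relabelPotential_le (D := D))
  have h2 := hi.card_finished_le
  rcases hcur : s.cur with _ | x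
  · have := hw.none hcur
    omega
  · obtain ⟨p, hp⟩ := hi.normalized.tree x
    have h3 := hw.some x p hcur hp
    have h4 := hi.normalized.depth_le hc hp
    omega

end bounds

end Pseudoflow

/-! ### Assembling the constants -/

theorem mainTheorem7 :
    ∃ C : ℕ, ∀ (α : Type u) (β : Type v) [Fintype α] [Fintype β] [DecidableEq α] [DecidableEq β]
      (E : Finset (α × β)) (c : α → β → ℝ≥0∞) (adj : α ⊕ β → List (α ⊕ β)),
      E.Nonempty → (∀ e ∈ E, 1 ≤ c e.1 e.2) →
      (bipartiteNetwork E c).IsAdjacencyLists adj →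
      (∀ s : State (α ⊕ β), Reachable (bipartiteNetwork E c) adj Variant.lowest s →
        s.scans ≤ C * min (matchingNumber E * E.card) (Fintype.card α ^ 2 * matchingNumber E) ∧
        ((bipartiteNetwork E c).IsNormalizedTree s.flow s.parent ∧
          ∀ x l, RootPath s.parent x l → l.length ≤ C * matchingNumber E) ∧
        s.work ≤ C * (min (matchingNumber E * E.card) (Fintype.card α ^ 2 * matchingNumber E)
          + Fintype.card α * matchingNumber E ^ 2)) ∧
      (∀ s : State (α ⊕ β), Reachable (bipartiteNetwork E c) adj Variant.highest s →
        ((bipartiteNetwork E c).IsNormalizedTree s.flow s.parent ∧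
          ∀ x l, RootPath s.parent x l → l.length ≤ C * matchingNumber E) ∧
        s.work ≤ C * (matchingNumber E * Fintype.card α * E.card)) := by
  -- A generous constant: the computations below need 20 for the scans, 345 and 452 for the work;
  -- the depth needs 5.
  refine ⟨1000, fun α β _ _ _ _ E c adj hE hc hadj => ?_⟩
  have hk := matchingNumber_pos hE
  have hkm := matchingNumber_le_card (E := E)
  have hkn := matchingNumber_le_card_image (E := E)
  have hnm : (E.image Prod.fst).card ≤ E.card := Finset.card_image_le
  have hnn : (E.image Prod.fst).card ≤ Fintype.card α := Finset.card_le_univ _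
  generalize hκ : matchingNumber E = κ at *
  generalize hm : E.card = m at *
  generalize hn : Fintype.card α = n at *
  generalize hn' : (E.image Prod.fst).card = n' at *
  have hdepth : ∀ (var : Variant) (s : State (α ⊕ β)),
      Reachable (bipartiteNetwork E c) adj var s →
      (bipartiteNetwork E c).IsNormalizedTree s.flow s.parent ∧
        ∀ x l, RootPath s.parent x l → l.length ≤ 1000 * κ := by
    intro var s h
    have hi := Inv.of_reachable hc h
    refine ⟨hi.normalized.isNormalizedTree, fun x l hl => ?_⟩
    have := hi.normalized.depth_le hc hl
    omega
  refine ⟨fun s h => ?_, fun s h => ?_⟩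
  · have h1 := scans_le_of_labelBound hc hadj
      (fun t ht => (LowInv.of_reachable hc hadj ht).labelBound) h
    have h2 := scans_le_lowest hc hadj h
    -- Mergers are charged to the active potential, so scans enter the work with weight 1 only.
    have h3 := work_le (K := 3 * (2 * κ + 3) + 2) (J := 1) hc
      (fun t ht => (LowInv.of_reachable hc hadj ht).labelBound)
      (.inr ⟨by rw [hκ], le_rfl, fun t ht => (LowInv.of_reachable hc hadj ht).excess_le⟩) h
    rw [hκ, hm] at h1
    rw [hκ, hn] at h2 h3
    have hscans : s.scans ≤ 20 * min (κ * m) (n ^ 2 * κ) := by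
      rcases min_choice (κ * m) (n ^ 2 * κ) with h4 | h4 <;> rw [h4]
      · calc s.scans ≤ (3 * κ + 5 + 2) * (2 * m) := h1
          _ ≤ (10 * κ) * (2 * m) := Nat.mul_le_mul_right _ (by omega)
          _ = 20 * (κ * m) := by ring
      · calc s.scans ≤ (3 * κ + 7) * (2 * (n * κ)) := h2
          _ ≤ (10 * n) * (2 * (n * κ)) := Nat.mul_le_mul_right _ (by omega)
          _ = 20 * (n ^ 2 * κ) := by ring
    refine ⟨hscans.trans (Nat.mul_le_mul_right _ (by norm_num)), hdepth _ s h, ?_⟩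
    have h4 : (3 + (3 * (2 * κ + 3) + 2)) * ((n + κ) * (3 * κ + 5)) ≤
        (20 * κ) * ((2 * n) * (8 * κ)) :=
      Nat.mul_le_mul (by omega) (Nat.mul_le_mul (by omega) (by omega))
    have h5 : (3 * (2 * κ + 3) + 2) * n ≤ (17 * κ) * n := Nat.mul_le_mul_right _ (by omega)
    have h6 : 1 * (κ * n) ≤ κ * (κ * n) := Nat.mul_le_mul_right _ hk
    have h7 : 1 * n ≤ κ * n := Nat.mul_le_mul_right _ hk
    calc s.work ≤ 20 * min (κ * m) (n ^ 2 * κ) + (20 * κ) * ((2 * n) * (8 * κ)) + 25 * (κ * n) := by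
          linarith
      _ ≤ 20 * min (κ * m) (n ^ 2 * κ) + 320 * (n * κ ^ 2) + 25 * (κ * (κ * n)) := by linarith
      _ = 20 * min (κ * m) (n ^ 2 * κ) + 345 * (n * κ ^ 2) := by ring
      _ ≤ 1000 * (min (κ * m) (n ^ 2 * κ) + n * κ ^ 2) := by omega
  · refine ⟨hdepth _ s h, ?_⟩
    have h1 := scans_le_of_labelBound hc hadj (fun t ht => (HighInv.of_reachable hc ht).bound) h
    -- Excess may exceed 1 here, so each merger is charged to its scan, at weight O(κ).
    have h3 := work_le (K := 0) (J := 3 * (2 * κ + 3) + 2) hc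
      (fun t ht => (HighInv.of_reachable hc ht).bound) (.inl ⟨rfl, by rw [hκ]⟩) h
    rw [hκ, hm, hn'] at h1
    rw [hκ, hn, hn'] at h3
    have hkn' := hkn.trans hnn
    have h2 : s.scans ≤ (12 * n) * (2 * m) := h1.trans (Nat.mul_le_mul_right _ (by omega))
    have h4 : (3 * (2 * κ + 3) + 2) * s.scans ≤ (17 * κ) * ((12 * n) * (2 * m)) :=
      Nat.mul_le_mul (by omega) h2
    -- This needs n' ≤ m and 1 ≤ κ ≤ m; with n in place of n' it could fail, as isolated left nodes
    -- can make n much larger than m.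
    have h5 : (n + κ) * (n' + κ + 4) ≤ (2 * n) * (6 * m) := Nat.mul_le_mul (by omega) (by omega)
    have h6 : 1 * (n * m) ≤ κ * (n * m) := Nat.mul_le_mul_right _ hk
    have h7 : n * 1 ≤ n * m := Nat.mul_le_mul_left _ (hk.trans hkm)
    calc s.work ≤ (17 * κ) * ((12 * n) * (2 * m)) + 3 * ((2 * n) * (6 * m)) + 8 * n := by linarith
      _ ≤ 408 * (κ * n * m) + 44 * (κ * (n * m)) := by linarith
      _ ≤ 1000 * (κ * n * m) := by linarith
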